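/- Session types are the terms $$S ::= \mathsf{end} \mid {?}[S_1,\dots,S_n]S \mid {!}[S_1,\dots,S_n]S \mid \oplus\{l_i:S_i\}_{1\le i\le n} \mid \&\{l_i:S_i\}_{1\le i\le n} \mid \mu X.S \mid X$$ that are contractive (no subterm has the form $\mu X_1.\mu X_2.\cdots\mu X_n.X_1$ with $n\ge 1$), in which the labels of each selection $\oplus$ and each branching $\&$ are pairwise distinct (their order being irrelevant), and in which no variable is both free and bound (for example, closed terms). Let $\mathrm{unfold}(\mu X.T)=\mathrm{unfold}(T[\mu X.T/X])$ and $\mathrm{unfold}(T)=T$ if $T$ is not of the form $\mu X.T'$. Subtyping $\le_c$ is the union of all relations $\mathcal R$ such that $T\,\mathcal R\,U$ implies: - if $\mathrm{unfold}(T)={?}[T_1,\dots,T_n]S_1$, then $\mathrm{unfold}(U)={?}[U_1,\dots,U_n]S_2$ with $T_i\,\mathcal R\,U_i$ for all $i$ and $S_1\,\mathcal R\,S_2$; - if $\mathrm{unfold}(T)={!}[T_1,\dots,T_n]S_1$, then $\mathrm{unfold}(U)={!}[U_1,\dots,U_n]S_2$ with $U_i\,\mathcal R\,T_i$ for all $i$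 and $S_1\,\mathcal R\,S_2$; - if $\mathrm{unfold}(T)$ is a branching, then so is $\mathrm{unfold}(U)$, and each label $l$ of $\mathrm{unfold}(T)$ is a label of $\mathrm{unfold}(U)$, with components $T_l\,\mathcal R\,U_l$; - if $\mathrm{unfold}(T)$ is a selection, then so is $\mathrm{unfold}(U)$, and each label $l$ of $\mathrm{unfold}(U)$ is a label of $\mathrm{unfold}(T)$, with components $T_l\,\mathcal R\,U_l$; - if $\mathrm{unfold}(T)=\mathsf{end}$, then $\mathrm{unfold}(U)=\mathsf{end}$. The size $|T|$ is the number of nodes of the syntax tree of $T$. The set $\mathrm{Sub}(T)$ of subterms is the least one such that $T\in\mathrm{Sub}(T)$, $\mathrm{Sub}(T[\mu X.T/X])\subseteq\mathrm{Sub}(\mu X.T)$, and $\mathrm{Sub}(T')\subseteq\mathrm{Sub}(T)$ for each immediate component $T'$ of an input, output, selection or branching $T$. Put $\mathrm{Sub}(T,U)=\mathrm{Sub}(T)\cup\mathrm{Sub}(U)$. **Statement.** There is an algorithm that, given session types $T$ and $U$, decides $T'\le_c U'$ simultaneously for all pairs of subterms $T',U'\in\mathrm{Sub}(T,U)$ in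 time $O(n^2)$, where $n=|T|+|U|$. Here time is the number of steps of a unit-cost random access machine (with increment, decrement, comparison and indexed addressing as its only arithmetic); variable names and labels are natural numbers that take one memory cell each, and the input is the list of the $n$ nodes of the syntax trees of $T$ and $U$ in preorder. Replacing the variables bound above a node by the recursive types they stand for, each node denotes a type, and the types denoted by the $n$ nodes are exactly the elements of $\mathrm{Sub}(T,U)$. The output is an $n\times n$ table, whose entry $(i,j)$ is $1$ if $T'\le_c U'$ and $0$ otherwise, where $T'$ and $U'$ are the types denoted by the nodes $i$ and $j$. -/

import Mathlib

namespace SessionTypes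

/-- Raw session types. Type variables and labels are drawn from the countable set `ℕ`.
`inp n Ts S` is the input type with payloads `Ts 0, ..., Ts (n-1)` and continuation `S`,
`out` is the corresponding output type; `sel n l Ts` and `bra n l Ts` are the selection and the
branching with labels `l 0, ..., l (n-1)` and components `Ts 0, ..., Ts (n-1)`. -/
inductive SType : Type
  | tend : SType
  | inp (n : ℕ) (Ts : Fin n → SType) (S : SType) : SType
  | out (n : ℕ) (Ts : Fin n → SType) (S : SType) : SType
  | sel (n : ℕ) (l : Fin n → ℕ) (Ts : Fin n → SType) : SType
  | bra (n : ℕ) (l : Fin n → ℕ) (Ts : Fin n → SType) : SType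
  | mu (X : ℕ) (B : SType) : SType
  | var (X : ℕ) : SType

namespace SType

/-- The size `|T|`. -/
def size : SType → ℕ
  | tend => 1
  | inp _ Ts S => (∑ i, (Ts i).size) + S.size + 1
  | out _ Ts S => (∑ i, (Ts i).size) + S.size + 1
  | sel _ _ Ts => (∑ i, (Ts i).size) + 1
  | bra _ _ Ts => (∑ i, (Ts i).size) + 1
  | mu _ B => B.size + 1
  | var _ => 1

/-- Free variables. -/
def fv : SType → Set ℕ
  | tend => ∅
  | inp _ Ts S => (⋃ i, (Ts i).fv) ∪ S.fv
  | out _ Ts S => (⋃ i, (Ts i).fv) ∪ S.fv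
  | sel _ _ Ts => ⋃ i, (Ts i).fv
  | bra _ _ Ts => ⋃ i, (Ts i).fv
  | mu X B => B.fv \ {X}
  | var X => {X}

/-- Variables that occur in a binder. -/
def bv : SType → Set ℕ
  | tend => ∅
  | inp _ Ts S => (⋃ i, (Ts i).bv) ∪ S.bv
  | out _ Ts S => (⋃ i, (Ts i).bv) ∪ S.bv
  | sel _ _ Ts => ⋃ i, (Ts i).bv
  | bra _ _ Ts => ⋃ i, (Ts i).bv
  | mu X B => insert X B.bv
  | var _ => ∅

/-- Simultaneous substitution of `σ X` for every free occurrence of every variable `X`.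
Binders are not renamed: this is the usual substitution as long as no free variable of a
substituted type is bound in the type it is put into. -/
def msubst : (ℕ → SType) → SType → SType
  | _, tend => tend
  | σ, inp n Ts S => inp n (fun i => msubst σ (Ts i)) (msubst σ S)
  | σ, out n Ts S => out n (fun i => msubst σ (Ts i)) (msubst σ S)
  | σ, sel n l Ts => sel n l (fun i => msubst σ (Ts i))
  | σ, bra n l Ts => bra n l (fun i => msubst σ (Ts i))
  | σ, mu X B => mu X (msubst (Function.update σ X (var X)) B)
  | σ, var X => σ X

/-- The single substitution `T[R/X]`. -/
def subst (X : ℕ) (R T : SType) : SType := msubst (Function.update var X R) T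

/-- The variable `X`, if the type has the form `μ Y₁ ... μ Yₖ. X` with `k ≥ 0`. -/
def chainVar : SType → Option ℕ
  | mu _ B => B.chainVar
  | var X => some X
  | _ => none

/-- Contractivity: no syntactic subterm has the form `μ X₁. μ X₂ ... μ Xₙ. X₁` with `n ≥ 1`. -/
def Contractive : SType → Prop
  | tend => True
  | inp _ Ts S => (∀ i, (Ts i).Contractive) ∧ S.Contractive
  | out _ Ts S => (∀ i, (Ts i).Contractive) ∧ S.Contractive
  | sel _ _ Ts => ∀ i, (Ts i).Contractive
  | bra _ _ Ts => ∀ i, (Ts i).Contractive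
  | mu X B => B.chainVar ≠ some X ∧ B.Contractive
  | var _ => True

/-- In each selection and each branching the labels are pairwise distinct. -/
def DistinctLabels : SType → Prop
  | tend => True
  | inp _ Ts S => (∀ i, (Ts i).DistinctLabels) ∧ S.DistinctLabels
  | out _ Ts S => (∀ i, (Ts i).DistinctLabels) ∧ S.DistinctLabels
  | sel _ l Ts => Function.Injective l ∧ ∀ i, (Ts i).DistinctLabels
  | bra _ l Ts => Function.Injective l ∧ ∀ i, (Ts i).DistinctLabels
  | mu _ B => B.DistinctLabels
  | var _ => True

/-- Session types: contractive terms with distinct labels, under the usual convention that no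
variable is both free and bound (which every closed term satisfies). -/
structure IsSessionType (T : SType) : Prop where
  contractive : T.Contractive
  distinctLabels : T.DistinctLabels
  varConvention : Disjoint T.fv T.bv

/-- `Unfolds T V` says `unfold(T) = V`. -/
inductive Unfolds : SType → SType → Prop
  | mu {X : ℕ} {B V : SType} (h : Unfolds (subst X (mu X B) B) V) : Unfolds (mu X B) V
  | refl {T : SType} (h : ∀ X B, T ≠ mu X B) : Unfolds T T

/-- Subtyping relations (type simulations). Components of selections and branchings are matched
by their labels; the order in which they are listed does not matter. -/
def IsSubtypingRel (R : SType → SType → Prop) : Prop :=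
  ∀ T U, R T U →
    (∀ n Ts S₁, Unfolds T (inp n Ts S₁) →
      ∃ Us S₂, Unfolds U (inp n Us S₂) ∧ (∀ i, R (Ts i) (Us i)) ∧ R S₁ S₂) ∧
    (∀ n Ts S₁, Unfolds T (out n Ts S₁) →
      ∃ Us S₂, Unfolds U (out n Us S₂) ∧ (∀ i, R (Us i) (Ts i)) ∧ R S₁ S₂) ∧
    (∀ m l Ts, Unfolds T (bra m l Ts) →
      ∃ n k Us, Unfolds U (bra n k Us) ∧ ∀ i, ∃ j, k j = l i ∧ R (Ts i) (Us j)) ∧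
    (∀ m l Ts, Unfolds T (sel m l Ts) →
      ∃ n k Us, Unfolds U (sel n k Us) ∧ ∀ j, ∃ i, l i = k j ∧ R (Ts i) (Us j)) ∧
    (Unfolds T tend → Unfolds U tend)

/-- Coinductive subtyping `T ≤_c U`. -/
def SubtypeOf (T U : SType) : Prop := ∃ R, IsSubtypingRel R ∧ R T U

/-- `InSub S T` says that `S` is a top-down subterm of `T`, that is `S ∈ Sub(T)`. -/
inductive InSub : SType → SType → Prop
  | refl (T : SType) : InSub T T
  | mu {S : SType} {X : ℕ} {B : SType} (h : InSub S (subst X (mu X B) B)) : InSub S (mu X B)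
  | inpPayload {S : SType} {n : ℕ} {Ts : Fin n → SType} {V : SType} (i : Fin n)
      (h : InSub S (Ts i)) : InSub S (inp n Ts V)
  | inpCont {S : SType} {n : ℕ} {Ts : Fin n → SType} {V : SType}
      (h : InSub S V) : InSub S (inp n Ts V)
  | outPayload {S : SType} {n : ℕ} {Ts : Fin n → SType} {V : SType} (i : Fin n)
      (h : InSub S (Ts i)) : InSub S (out n Ts V)
  | outCont {S : SType} {n : ℕ} {Ts : Fin n → SType} {V : SType}
      (h : InSub S V) : InSub S (out n Ts V)
  | sel {S : SType} {n : ℕ} {l : Fin n → ℕ} {Ts : Fin n → SType} (i : Fin n)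
      (h : InSub S (Ts i)) : InSub S (sel n l Ts)
  | bra {S : SType} {n : ℕ} {l : Fin n → ℕ} {Ts : Fin n → SType} (i : Fin n)
      (h : InSub S (Ts i)) : InSub S (bra n l Ts)

/-- `Sub(T, U) = Sub(T) ∪ Sub(U)`. -/
def Sub (T U : SType) : Set SType := {S | InSub S T ∨ InSub S U}

/-- The types denoted by the nodes of the syntax tree of a type, in preorder. The environment `σ`
holds, for each variable bound above the current node, the recursive type that it stands for. -/
def nodeTypes : (ℕ → SType) → SType → List SType
  | _, tend => [tend]
  | σ, inp n Ts S => msubst σ (inp n Ts S) ::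
      ((List.ofFn fun i => nodeTypes σ (Ts i)).flatten ++ nodeTypes σ S)
  | σ, out n Ts S => msubst σ (out n Ts S) ::
      ((List.ofFn fun i => nodeTypes σ (Ts i)).flatten ++ nodeTypes σ S)
  | σ, sel n l Ts => msubst σ (sel n l Ts) :: (List.ofFn fun i => nodeTypes σ (Ts i)).flatten
  | σ, bra n l Ts => msubst σ (bra n l Ts) :: (List.ofFn fun i => nodeTypes σ (Ts i)).flatten
  | σ, mu X B => msubst σ (mu X B) ::
      nodeTypes (Function.update σ X (msubst σ (mu X B))) B
  | σ, var X => [σ X]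

/-- The types denoted by the nodes of the syntax tree of `T` followed by those of `U`. -/
def pairNodeTypes (T U : SType) : List SType := nodeTypes var T ++ nodeTypes var U

/-- What is written down for one node of a syntax tree: the constructor, its argument (the name
of the variable, or the number of payloads or of components) and the label of the component
of which the node is the root (`0` if it is not the component of a selection or branching). -/
structure Token where
  tag : ℕ
  arg : ℕ
  label : ℕ

/-- The syntax tree of a type written down in preorder, with `c` the label of its root. -/
def code (c : ℕ) : SType → List Token
  | tend => [⟨0, 0, c⟩]
  | inp n Ts S => ⟨1, n, c⟩ :: ((List.ofFn fun i => code 0 (Ts i)).flatten ++ code 0 S)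
  | out n Ts S => ⟨2, n, c⟩ :: ((List.ofFn fun i => code 0 (Ts i)).flatten ++ code 0 S)
  | sel n l Ts => ⟨3, n, c⟩ :: (List.ofFn fun i => code (l i) (Ts i)).flatten
  | bra n l Ts => ⟨4, n, c⟩ :: (List.ofFn fun i => code (l i) (Ts i)).flatten
  | mu X B => ⟨5, X, c⟩ :: code 0 B
  | var X => [⟨6, X, c⟩]

/-- The two syntax trees, one after the other. -/
def pairCode (T U : SType) : List Token := code 0 T ++ code 0 U

end SType

/-! A random access machine with unit cost, programmed by structured programs. -/

/-- The memory: registers, and a supply of unbounded arrays. A program mentions only finitely many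
registers and arrays. -/
structure Store where
  reg : ℕ → ℕ
  arr : ℕ → ℕ → ℕ

/-- Tests: equality and order of the contents of two registers. -/
inductive Test : Type
  | eq (x y : ℕ) : Test
  | lt (x y : ℕ) : Test

/-- The truth value of a test. -/
def Test.Holds (s : Store) : Test → Prop
  | eq x y => s.reg x = s.reg y
  | lt x y => s.reg x < s.reg y

/-- Programs. `load x a y z` puts entry `y + z` of array `a` into register `x`, and
`store a y z x` does the converse, where `x`, `y`, `z` name registers. There is no arithmetic
beyond increment, decrement and indexed addressing: in `t` steps no number in memory can grow by
more than `t` beyond the input and the constants of the program. -/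
inductive Prog : Type
  | skip : Prog
  | const (x k : ℕ) : Prog
  | copy (x y : ℕ) : Prog
  | inc (x : ℕ) : Prog
  | dec (x : ℕ) : Prog
  | load (x a y z : ℕ) : Prog
  | store (a y z x : ℕ) : Prog
  | seq (p q : Prog) : Prog
  | cond (b : Test) (p q : Prog) : Prog
  | loop (b : Test) (p : Prog) : Prog

/-- Write a register. -/
def Store.setReg (s : Store) (x v : ℕ) : Store := ⟨Function.update s.reg x v, s.arr⟩

/-- Write an array entry. -/
def Store.setArr (s : Store) (a i v : ℕ) : Store :=
  ⟨s.reg, Function.update s.arr a (Function.update (s.arr a) i v)⟩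

/-- `Exec p s t s₁`: started in memory `s`, the program `p` halts after exactly `t` steps, in
memory `s₁`. Each elementary instruction and each evaluation of a test is one step. -/
inductive Exec : Prog → Store → ℕ → Store → Prop
  | skip (s : Store) : Exec .skip s 1 s
  | const (s : Store) (x k : ℕ) : Exec (.const x k) s 1 (s.setReg x k)
  | copy (s : Store) (x y : ℕ) : Exec (.copy x y) s 1 (s.setReg x (s.reg y))
  | inc (s : Store) (x : ℕ) : Exec (.inc x) s 1 (s.setReg x (s.reg x + 1))
  | dec (s : Store) (x : ℕ) : Exec (.dec x) s 1 (s.setReg x (s.reg x - 1))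
  | load (s : Store) (x a y z : ℕ) :
      Exec (.load x a y z) s 1 (s.setReg x (s.arr a (s.reg y + s.reg z)))
  | store (s : Store) (a y z x : ℕ) :
      Exec (.store a y z x) s 1 (s.setArr a (s.reg y + s.reg z) (s.reg x))
  | seq {p q : Prog} {s s₁ s₂ : Store} {t₁ t₂ : ℕ} (h₁ : Exec p s t₁ s₁) (h₂ : Exec q s₁ t₂ s₂) :
      Exec (.seq p q) s (t₁ + t₂) s₂
  | condTrue {b : Test} {p q : Prog} {s s₁ : Store} {t : ℕ} (hb : b.Holds s) (h : Exec p s t s₁) :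
      Exec (.cond b p q) s (t + 1) s₁
  | condFalse {b : Test} {p q : Prog} {s s₁ : Store} {t : ℕ} (hb : ¬ b.Holds s)
      (h : Exec q s t s₁) : Exec (.cond b p q) s (t + 1) s₁
  | loopTrue {b : Test} {p : Prog} {s s₁ s₂ : Store} {t₁ t₂ : ℕ} (hb : b.Holds s)
      (h₁ : Exec p s t₁ s₁) (h₂ : Exec (.loop b p) s₁ t₂ s₂) :
      Exec (.loop b p) s (t₁ + t₂ + 1) s₂
  | loopFalse {b : Test} {p : Prog} {s : Store} (hb : ¬ b.Holds s) : Exec (.loop b p) s 1 s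

/-- The initial memory for an input list of tokens: register `0` holds the number of tokens, arrays
`0`, `1`, `2` hold their tags, arguments and labels, and everything else is `0`. -/
def initStore (L : List SType.Token) : Store where
  reg := fun x => if x = 0 then L.length else 0
  arr := fun a i =>
    match L[i]?, a with
    | some c, 0 => c.tag
    | some c, 1 => c.arg
    | some c, 2 => c.label
    | _, _ => 0

end SessionTypes

namespace SessionTypes
namespace SType

/-! ### Substitution and unfolding -/

/-! Refuting a subtyping amounts to reachability in a graph that has one vertex and one edge for
every pair of nodes, and a graph of that size can be built and searched in time `O(n²)`.

Each node denotes a type in the environment that sends the variables bound above it to recursive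
types. The variable convention rules out capture, so a recursive type unfolds exactly to the type of
the next node, and a bound variable denotes the same type as its binder (`layout_typed`). Hence the
types of the nodes are closed under unfolding and under components, which identifies them with
`Sub(T, U)` (`mem_sub_iff`). It also makes the unfolding of each of them the type of another node,
its `head`: descend a chain of binders and, if it ends in a bound variable, restart at the binder of
that variable. Contractivity puts this binder before the start of the chain (`Occ.chainEnd`), so the
search ends.

Subtyping is a greatest fixed point, so its complement is a least one. A pair of heads fails at once
if constructors or arities clash or if a label is missing; otherwise it fails as soon as one pair of
corresponding components does. Since a single failing component suffices, failure spreads along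
edges, without conjunctions. Since a node has only one parent, a pair of nodes is a pair of
components of at most one pair, that of the parents, exchanged for payloads of outputs. So there is
one edge per pair of nodes, from the pair of its heads to the pair of its parents. Failing pairs are
not subtypes by induction on paths (`not_subtypeOf_of_fails`); the other pairs form a subtyping
relation (`isSubtypingRel_not_fails`).

On the machine, missing labels are found by marking, for every two components `c`, `d` with the same
label, the pair of `c` and the parent of `d`. The search starts at each vertex at most once and
follows each edge at most once, so `2n²` steps suffice (`SearchInv.iff_reach`). Running times are
proved with `Runs`, a Hoare triple with a step bound, by weakest preconditions for straight-line
code and the invariant rules `Runs.for_` and `Runs.for_pairs` for loops. -/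

theorem msubst_congr {S : SType} {σ τ : ℕ → SType} (h : ∀ Y ∈ S.fv, σ Y = τ Y) :
    msubst σ S = msubst τ S := by
  induction S generalizing σ τ with
  | tend => rfl
  | inp n Ts S ihT ihS | out n Ts S ihT ihS =>
    simp only [msubst, fv, Set.mem_union, Set.mem_iUnion] at h ⊢
    rw [ihS fun Y hY => h Y (.inr hY)]
    congr 1
    funext i
    exact ihT i fun Y hY => h Y (.inl ⟨i, hY⟩)
  | sel n l Ts ihT | bra n l Ts ihT =>
    simp only [msubst, fv, Set.mem_iUnion] at h ⊢
    congr 1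
    funext i
    exact ihT i fun Y hY => h Y ⟨i, hY⟩
  | mu X B ih =>
    simp only [msubst]
    rw [ih fun Y hY => ?_]
    by_cases hX : Y = X
    · subst hX; simp
    · simpa [hX] using h Y ⟨hY, hX⟩
  | var X => exact h X rfl

theorem msubst_var (S : SType) : msubst var S = S := by
  induction S with
  | tend | var => rfl
  | inp n Ts S ihT ihS | out n Ts S ihT ihS => simp [msubst, ihS, ihT]
  | sel n l Ts ihT | bra n l Ts ihT => simp [msubst, ihT]
  | mu X B ih => simp [msubst, ih]

theorem exists_of_mem_fv_msubst {S : SType} {σ : ℕ → SType} {Y : ℕ} (h : Y ∈ (msubst σ S).fv) :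
    ∃ Z ∈ S.fv, Y ∈ (σ Z).fv := by
  induction S generalizing σ with
  | tend => simp [msubst, fv] at h
  | inp n Ts S ihT ihS | out n Ts S ihT ihS =>
    simp only [msubst, fv, Set.mem_union, Set.mem_iUnion] at h ⊢
    rcases h with ⟨i, h⟩ | h
    · obtain ⟨Z, hZ, hY⟩ := ihT i h
      exact ⟨Z, .inl ⟨i, hZ⟩, hY⟩
    · obtain ⟨Z, hZ, hY⟩ := ihS h
      exact ⟨Z, .inr hZ, hY⟩
  | sel n l Ts ihT | bra n l Ts ihT =>
    simp only [msubst, fv, Set.mem_iUnion] at h ⊢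
    obtain ⟨i, h⟩ := h
    obtain ⟨Z, hZ, hY⟩ := ihT i h
    exact ⟨Z, ⟨i, hZ⟩, hY⟩
  | mu X B ih =>
    obtain ⟨h, hX⟩ := h
    obtain ⟨Z, hZ, hY⟩ := ih h
    by_cases hZX : Z = X
    · subst hZX
      simp only [Function.update_self, fv] at hY
      exact absurd hY hX
    · rw [Function.update_of_ne hZX] at hY
      exact ⟨Z, ⟨hZ, hZX⟩, hY⟩
  | var X => exact ⟨X, rfl, h⟩

/-- Composition of substitutions, in the absence of variable capture. -/
theorem msubst_msubst {S : SType} {σ τ : ℕ → SType}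
    (h : ∀ Y ∈ S.fv, σ Y = var Y ∨ Disjoint (σ Y).fv S.bv) :
    msubst τ (msubst σ S) = msubst (fun Y => msubst τ (σ Y)) S := by
  induction S generalizing σ τ with
  | tend | var => rfl
  | inp n Ts S ihT ihS | out n Ts S ihT ihS =>
    simp only [msubst, fv, bv, Set.mem_union, Set.mem_iUnion, Set.disjoint_union_right,
      Set.disjoint_iUnion_right] at h ⊢
    rw [ihS fun Y hY => (h Y (.inr hY)).imp id fun h => h.2]
    congr 1
    funext i
    exact ihT i fun Y hY => (h Y (.inl ⟨i, hY⟩)).imp id fun h => h.1 i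
  | sel n l Ts ihT | bra n l Ts ihT =>
    simp only [msubst, fv, bv, Set.mem_iUnion, Set.disjoint_iUnion_right] at h ⊢
    congr 1
    funext i
    exact ihT i fun Y hY => (h Y ⟨i, hY⟩).imp id fun h => h i
  | mu X B ih =>
    simp only [msubst]
    rw [ih]
    · congr 1
      refine msubst_congr fun Y hY => ?_
      by_cases hX : Y = X
      · subst hX; simp [msubst]
      · simp only [Function.update_of_ne hX]
        rcases h Y ⟨hY, hX⟩ with h | h
        · simp [h, msubst, hX]
        · refine msubst_congr fun Z hZ => Function.update_of_ne ?_ _ _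
          rintro rfl
          exact Set.disjoint_left.1 h hZ (Set.mem_insert _ _)
    · intro Y hY
      by_cases hX : Y = X
      · subst hX; simp
      · simp only [Function.update_of_ne hX]
        exact (h Y ⟨hY, hX⟩).imp id fun h => h.mono_right (Set.subset_insert _ _)

/-- Unfolding a recursive type commutes with a substitution that avoids its bound variables. -/
theorem subst_msubst_mu {X : ℕ} {B : SType} {σ : ℕ → SType}
    (h : ∀ Y ∈ (mu X B).fv, Disjoint (σ Y).fv (mu X B).bv) (R : SType) :
    subst X R (msubst (Function.update σ X (var X)) B) = msubst (Function.update σ X R) B := by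
  rw [subst, msubst_msubst]
  · refine msubst_congr fun Y hY => ?_
    by_cases hX : Y = X
    · subst hX; simp [msubst]
    · simp only [Function.update_of_ne hX]
      conv_rhs => rw [← msubst_var (σ Y)]
      refine msubst_congr fun Z hZ => Function.update_of_ne ?_ _ _
      rintro rfl
      exact Set.disjoint_left.1 (h Y ⟨hY, hX⟩) hZ (Set.mem_insert _ _)
  · intro Y hY
    by_cases hX : Y = X
    · subst hX; simp
    · simp only [Function.update_of_ne hX]
      exact .inr ((h Y ⟨hY, hX⟩).mono_right (Set.subset_insert _ _))

theorem Unfolds.unique {T V W : SType} (h : Unfolds T V) (h' : Unfolds T W) : V = W := by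
  induction h with
  | mu _ ih =>
    cases h' with
    | mu h' => exact ih h'
    | refl h' => exact absurd rfl (h' _ _)
  | refl h =>
    cases h' with
    | mu h' => exact absurd rfl (h _ _)
    | refl h' => rfl

theorem unfolds_mu {X : ℕ} {B V : SType} :
    Unfolds (mu X B) V ↔ Unfolds (subst X (mu X B) B) V := by
  refine ⟨fun h => ?_, .mu⟩
  cases h with
  | mu h => exact h
  | refl h => exact absurd rfl (h _ _)

theorem InSub.trans {S T U : SType} (h : InSub S T) (h' : InSub T U) : InSub S U := by
  induction h' with
  | refl => exact h
  | mu _ ih => exact .mu ih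
  | inpPayload i _ ih => exact .inpPayload i ih
  | inpCont _ ih => exact .inpCont ih
  | outPayload i _ ih => exact .outPayload i ih
  | outCont _ ih => exact .outCont ih
  | sel i _ ih => exact .sel i ih
  | bra i _ ih => exact .bra i ih

/-! ### A uniform view of syntax trees -/

/-- The immediate components of a term, each with its label. -/
def kids : SType → List (ℕ × SType)
  | tend => []
  | inp _ Ts S => (List.ofFn fun i => (0, Ts i)) ++ [(0, S)]
  | out _ Ts S => (List.ofFn fun i => (0, Ts i)) ++ [(0, S)]
  | sel _ l Ts => List.ofFn fun i => (l i, Ts i)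
  | bra _ l Ts => List.ofFn fun i => (l i, Ts i)
  | mu _ B => [(0, B)]
  | var _ => []

/-- The constructor of a term, as in its code. -/
def tagOf : SType → ℕ
  | tend => 0
  | inp _ _ _ => 1
  | out _ _ _ => 2
  | sel _ _ _ => 3
  | bra _ _ _ => 4
  | mu _ _ => 5
  | var _ => 6

/-- The argument of the constructor of a term, as in its code. -/
def argOf : SType → ℕ
  | tend => 0
  | inp n _ _ => n
  | out n _ _ => n
  | sel n _ _ => n
  | bra n _ _ => n
  | mu X _ => X
  | var X => X

/-- The number of children of a node of a syntax tree. -/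
def arity (t a : ℕ) : ℕ :=
  if t = 1 then a + 1 else if t = 2 then a + 1 else if t = 3 then a else if t = 4 then a else
    if t = 5 then 1 else 0

/-- The environment below the root of a term. -/
def extEnv (σ : ℕ → SType) : SType → ℕ → SType
  | mu X B => Function.update σ X (msubst σ (mu X B))
  | _ => σ

theorem length_kids (S : SType) : S.kids.length = arity S.tagOf S.argOf := by
  cases S <;> simp [kids, arity, tagOf, argOf]

/-- Together with `kids`, `tagOf` and `argOf` this replaces the seven-fold case distinction on
constructors in most of what follows. -/
theorem kids_induct {P : SType → Prop} (h : ∀ S, (∀ p ∈ S.kids, P p.2) → P S) (S : SType) : P S := by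
  induction S with
  | tend | var => exact h _ (by simp [kids])
  | inp n Ts S ihT ihS | out n Ts S ihT ihS =>
    refine h _ fun p hp => ?_
    simp only [kids, List.mem_append, List.mem_ofFn, List.mem_singleton] at hp
    rcases hp with ⟨i, rfl⟩ | rfl
    exacts [ihT i, ihS]
  | sel n l Ts ihT | bra n l Ts ihT =>
    refine h _ fun p hp => ?_
    simp only [kids, List.mem_ofFn] at hp
    obtain ⟨i, rfl⟩ := hp
    exact ihT i
  | mu X B ih => exact h _ (by simpa [kids] using ih)

theorem size_eq (S : SType) : S.size = (S.kids.map fun p => p.2.size).sum + 1 := by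
  cases S <;> simp [kids, size, List.map_ofFn, Function.comp_def, List.sum_ofFn]

theorem code_eq (c : ℕ) (S : SType) :
    code c S = ⟨S.tagOf, S.argOf, c⟩ :: (S.kids.map fun p => code p.1 p.2).flatten := by
  cases S <;> simp [kids, code, tagOf, argOf, List.map_ofFn, Function.comp_def]

theorem nodeTypes_eq (σ : ℕ → SType) (S : SType) :
    nodeTypes σ S =
      msubst σ S :: (S.kids.map fun p => nodeTypes (extEnv σ S) p.2).flatten := by
  cases S <;> simp [kids, nodeTypes, extEnv, List.map_ofFn, Function.comp_def, msubst]

/-- Recursive types are excluded because substitution protects their bound variable, whereas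
`extEnv` replaces it by the recursive type. -/
theorem kids_msubst (σ : ℕ → SType) {S : SType} (h : S.tagOf < 5) :
    (msubst σ S).kids = S.kids.map fun p => (p.1, msubst (extEnv σ S) p.2) := by
  cases S <;> simp_all [kids, extEnv, List.map_ofFn, Function.comp_def, msubst, tagOf]

theorem tagOf_msubst (σ : ℕ → SType) {S : SType} (h : S.tagOf < 6) :
    (msubst σ S).tagOf = S.tagOf ∧ (msubst σ S).argOf = S.argOf := by
  cases S <;> simp_all [msubst, tagOf, argOf]

theorem InSub.kid {S T : SType} {p : ℕ × SType} (hT : T.tagOf < 5) (hp : p ∈ T.kids)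
    (h : InSub S p.2) : InSub S T := by
  cases T <;> simp only [kids, List.mem_append, List.mem_ofFn, List.mem_singleton,
    List.not_mem_nil, tagOf] at hp hT
  · rcases hp with ⟨i, rfl⟩ | rfl
    exacts [.inpPayload i h, .inpCont h]
  · rcases hp with ⟨i, rfl⟩ | rfl
    exacts [.outPayload i h, .outCont h]
  · obtain ⟨i, rfl⟩ := hp
    exact .sel i h
  · obtain ⟨i, rfl⟩ := hp
    exact .bra i h
  · omega

/-- Induction on `InSub` in terms of immediate components. -/
theorem InSub.kid_induct {S : SType} {P : SType → Prop} (refl : P S)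
    (unfold : ∀ X B, P (subst X (SType.mu X B) B) → P (SType.mu X B))
    (kid : ∀ T p, T.tagOf < 5 → p ∈ T.kids → P p.2 → P T) {T : SType} (h : InSub S T) : P T := by
  induction h with
  | refl => exact refl
  | mu _ ih => exact unfold _ _ ih
  | @inpPayload n Ts V i _ ih => exact kid (inp n Ts V) (0, Ts i) (by simp [tagOf]) (by simp [kids]) ih
  | @inpCont n Ts V _ ih => exact kid (inp n Ts V) (0, V) (by simp [tagOf]) (by simp [kids]) ih
  | @outPayload n Ts V i _ ih => exact kid (out n Ts V) (0, Ts i) (by simp [tagOf]) (by simp [kids]) ih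
  | @outCont n Ts V _ ih => exact kid (out n Ts V) (0, V) (by simp [tagOf]) (by simp [kids]) ih
  | @sel n l Ts i _ ih => exact kid (SType.sel n l Ts) (l i, Ts i) (by simp [tagOf]) (List.mem_ofFn.2 ⟨i, rfl⟩) ih
  | @bra n l Ts i _ ih => exact kid (SType.bra n l Ts) (l i, Ts i) (by simp [tagOf]) (List.mem_ofFn.2 ⟨i, rfl⟩) ih

/-- Only a `mu` at the root can turn a variable that is not free in the term into a free one of its
component. -/
theorem fv_kid {S : SType} {p : ℕ × SType} (hp : p ∈ S.kids) :
    p.2.bv ⊆ S.bv ∧ (∀ Y ∈ p.2.fv, Y ∈ S.fv ∨ S.tagOf = 5 ∧ S.argOf = Y) ∧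
      (S.Contractive → p.2.Contractive) ∧ (S.DistinctLabels → p.2.DistinctLabels) := by
  cases S <;> simp only [kids, List.mem_append, List.mem_ofFn, List.mem_singleton,
    List.not_mem_nil] at hp
  · rcases hp with ⟨i, rfl⟩ | rfl
    · refine ⟨fun Y hY => ?_, fun Y hY => .inl ?_, fun h => h.1 i, fun h => h.1 i⟩
      · exact .inl (Set.mem_iUnion.2 ⟨i, hY⟩)
      · exact .inl (Set.mem_iUnion.2 ⟨i, hY⟩)
    · exact ⟨fun Y hY => .inr hY, fun Y hY => .inl (.inr hY), fun h => h.2, fun h => h.2⟩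
  · rcases hp with ⟨i, rfl⟩ | rfl
    · refine ⟨fun Y hY => ?_, fun Y hY => .inl ?_, fun h => h.1 i, fun h => h.1 i⟩
      · exact .inl (Set.mem_iUnion.2 ⟨i, hY⟩)
      · exact .inl (Set.mem_iUnion.2 ⟨i, hY⟩)
    · exact ⟨fun Y hY => .inr hY, fun Y hY => .inl (.inr hY), fun h => h.2, fun h => h.2⟩
  · obtain ⟨i, rfl⟩ := hp
    exact ⟨fun Y hY => Set.mem_iUnion.2 ⟨i, hY⟩, fun Y hY => .inl (Set.mem_iUnion.2 ⟨i, hY⟩),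
      fun h => h i, fun h => h.2 i⟩
  · obtain ⟨i, rfl⟩ := hp
    exact ⟨fun Y hY => Set.mem_iUnion.2 ⟨i, hY⟩, fun Y hY => .inl (Set.mem_iUnion.2 ⟨i, hY⟩),
      fun h => h i, fun h => h.2 i⟩
  · subst hp
    refine ⟨Set.subset_insert _ _, fun Y hY => ?_, fun h => h.2, fun h => h⟩
    exact or_iff_not_imp_right.2 fun h => ⟨hY, fun hX => h ⟨rfl, hX.symm⟩⟩

theorem kids_label_injective {S : SType} (h : S.DistinctLabels) (ht : S.tagOf = 3 ∨ S.tagOf = 4)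
    {k k' : ℕ} {p p' : ℕ × SType} (hp : S.kids[k]? = some p) (hp' : S.kids[k']? = some p')
    (hl : p.1 = p'.1) : k = k' := by
  cases S <;> simp only [tagOf] at ht <;> try omega
  all_goals
    simp only [kids, List.getElem?_ofFn, Option.dite_none_right_eq_some, Option.some.injEq] at hp hp'
    obtain ⟨hk, rfl⟩ := hp
    obtain ⟨hk', rfl⟩ := hp'
    simpa using h.1 hl

/-! ### Subtyping in terms of immediate components -/

/-- What a subtyping relation requires of the unfoldings of two related types. -/
structure StepRel (R : SType → SType → Prop) (V W : SType) : Prop where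
  tag : V.tagOf = W.tagOf
  arg : V.tagOf = 1 ∨ V.tagOf = 2 → V.argOf = W.argOf
  comp : V.tagOf = 1 ∨ V.tagOf = 2 → ∀ k A B, V.kids[k]? = some A → W.kids[k]? = some B →
    if V.tagOf = 2 ∧ k ≠ V.argOf then R B.2 A.2 else R A.2 B.2
  sel : V.tagOf = 3 → ∀ B ∈ W.kids, ∃ A ∈ V.kids, A.1 = B.1 ∧ R A.2 B.2
  bra : V.tagOf = 4 → ∀ A ∈ V.kids, ∃ B ∈ W.kids, A.1 = B.1 ∧ R A.2 B.2

theorem Unfolds.tagOf_ne {T V : SType} (h : Unfolds T V) : V.tagOf ≠ 5 := by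
  induction h with
  | mu _ ih => exact ih
  | @refl T h => cases T <;> simp_all [tagOf]

/-- The case `V.tagOf = 6` is left out because no clause of the definition constrains a type that
unfolds to a variable. In `StepRel`, the component with index `argOf` of an input or output is the
continuation, which is covariant in both. -/
theorem isSubtypingRel_iff {R : SType → SType → Prop} :
    IsSubtypingRel R ↔ ∀ T U, R T U → ∀ V, Unfolds T V → V.tagOf ≠ 6 →
      ∃ W, Unfolds U W ∧ StepRel R V W := by
  constructor
  · intro h T U hR V hV h6
    obtain ⟨h1, h2, h3, h4, h5⟩ := h T U hR
    cases V with
    | tend => exact ⟨_, h5 hV, rfl, by simp [tagOf], by simp [tagOf], by simp [tagOf], by simp [tagOf]⟩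
    | inp n Ts S =>
      obtain ⟨Us, S₂, hU, ha, hb⟩ := h1 _ _ _ hV
      refine ⟨_, hU, rfl, by simp [argOf], fun _ k A B hA hB => ?_, by simp [tagOf], by simp [tagOf]⟩
      simp only [kids, List.getElem?_append, List.getElem?_ofFn, List.length_ofFn,
        List.getElem?_singleton] at hA hB
      rw [if_neg (by simp [tagOf])]
      by_cases hk : k < n
      · simp only [hk, if_true, dite_true, Option.some.injEq] at hA hB
        subst hA hB
        exact ha _
      · simp only [hk, if_false, Option.ite_none_right_eq_some, Option.some.injEq] at hA hB
        rw [← hA.2, ← hB.2]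
        exact hb
    | out n Ts S =>
      obtain ⟨Us, S₂, hU, ha, hb⟩ := h2 _ _ _ hV
      refine ⟨_, hU, rfl, by simp [argOf], fun _ k A B hA hB => ?_, by simp [tagOf], by simp [tagOf]⟩
      simp only [kids, List.getElem?_append, List.getElem?_ofFn, List.length_ofFn,
        List.getElem?_singleton] at hA hB
      by_cases hk : k < n
      · simp only [hk, if_true, dite_true, Option.some.injEq] at hA hB
        subst hA hB
        rw [if_pos (by simp [tagOf, argOf]; omega)]
        exact ha _
      · simp only [hk, if_false, Option.ite_none_right_eq_some, Option.some.injEq] at hA hB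
        rw [if_neg (by simp [tagOf, argOf]; omega), ← hA.2, ← hB.2]
        exact hb
    | sel n l Ts =>
      obtain ⟨m, k, Us, hU, ha⟩ := h4 _ _ _ hV
      refine ⟨_, hU, rfl, by simp [tagOf], by simp [tagOf], fun _ => ?_, by simp [tagOf]⟩
      simpa [kids] using ha
    | bra n l Ts =>
      obtain ⟨m, k, Us, hU, ha⟩ := h3 _ _ _ hV
      refine ⟨_, hU, rfl, by simp [tagOf], by simp [tagOf], by simp [tagOf], fun _ => ?_⟩
      simpa [kids, eq_comm] using ha
    | mu X B => exact absurd rfl hV.tagOf_ne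
    | var X => simp [tagOf] at h6
  · intro h T U hR
    refine ⟨fun n Ts S hV => ?_, fun n Ts S hV => ?_, fun n l Ts hV => ?_, fun n l Ts hV => ?_,
      fun hV => ?_⟩ <;> obtain ⟨W, hW, hs⟩ := h T U hR _ hV (by simp [tagOf]) <;>
      have ht := hs.tag <;> cases W <;> simp only [tagOf] at ht <;> (try omega) <;> clear ht
    · rename_i m Us S₂
      obtain rfl : n = m := hs.arg (by simp [tagOf])
      have hc := hs.comp (by simp [tagOf])
      refine ⟨Us, S₂, hW, fun i => ?_, ?_⟩
      · simpa [tagOf] using hc i (0, Ts i) (0, Us i) (by simp [kids])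
          (by simp [kids])
      · simpa [tagOf] using hc n (0, S) (0, S₂) (by simp [kids])
          (by simp [kids])
    · rename_i m Us S₂
      obtain rfl : n = m := hs.arg (by simp [tagOf])
      have hc := hs.comp (by simp [tagOf])
      refine ⟨Us, S₂, hW, fun i => ?_, ?_⟩
      · simpa [tagOf, argOf, i.2.ne] using hc i (0, Ts i) (0, Us i)
          (by simp [kids]) (by simp [kids])
      · simpa [tagOf, argOf] using hc n (0, S) (0, S₂) (by simp [kids])
          (by simp [kids])
    · refine ⟨_, _, _, hW, ?_⟩
      simpa [kids, eq_comm] using hs.bra rfl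
    · refine ⟨_, _, _, hW, ?_⟩
      simpa [kids] using hs.sel rfl

theorem StepRel.mono {R R' : SType → SType → Prop} (h : ∀ A B, R A B → R' A B) {V W : SType}
    (hs : StepRel R V W) : StepRel R' V W where
  tag := hs.tag
  arg := hs.arg
  comp ht k A B hA hB := by
    have := hs.comp ht k A B hA hB
    split_ifs at this ⊢ <;> exact h _ _ this
  sel ht B hB := (hs.sel ht B hB).imp fun A hA => ⟨hA.1, hA.2.1, h _ _ hA.2.2⟩
  bra ht A hA := (hs.bra ht A hA).imp fun B hB => ⟨hB.1, hB.2.1, h _ _ hB.2.2⟩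

theorem isSubtypingRel_subtypeOf : IsSubtypingRel SubtypeOf := by
  rw [isSubtypingRel_iff]
  rintro T U ⟨R, hR, h⟩ V hV h6
  obtain ⟨W, hW, hs⟩ := isSubtypingRel_iff.1 hR T U h V hV h6
  exact ⟨W, hW, hs.mono fun A B h => ⟨R, hR, h⟩⟩

/-- Subtyping sees a type only through its unfolding. Adding the one new pair to the largest
subtyping relation gives a subtyping relation again, since the obligations of the new pair are met
inside the old one. -/
theorem SubtypeOf.congr {T U T' U' : SType} (hT : ∀ V, Unfolds T' V → Unfolds T V)
    (hU : ∀ V, Unfolds U V → Unfolds U' V) (h : SubtypeOf T U) : SubtypeOf T' U' := by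
  refine ⟨fun A B => SubtypeOf A B ∨ A = T' ∧ B = U', ?_, .inr ⟨rfl, rfl⟩⟩
  rw [isSubtypingRel_iff]
  have key := isSubtypingRel_iff.1 isSubtypingRel_subtypeOf
  rintro A B (hAB | ⟨rfl, rfl⟩) V hV h6
  · obtain ⟨W, hW, hs⟩ := key A B hAB V hV h6
    exact ⟨W, hW, hs.mono fun _ _ => .inl⟩
  · obtain ⟨W, hW, hs⟩ := key T U h V (hT V hV) h6
    exact ⟨W, hU W hW, hs.mono fun _ _ => .inl⟩

end SType
end SessionTypes

namespace SessionTypes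
open SType

/-! ### Syntax trees laid out in preorder -/

/-- A forest of `n` nodes in preorder: `par i` is `0` for a root and `p + 1` for a child of node
`p`, `pos i` is the index of `i` among its siblings, `fin i` is the end of the subtree rooted at `i`
and `child i k` is the `k`-th child of `i`. -/
structure Layout where
  n : ℕ
  tag : ℕ → ℕ
  arg : ℕ → ℕ
  lab : ℕ → ℕ
  par : ℕ → ℕ
  pos : ℕ → ℕ
  fin : ℕ → ℕ
  child : ℕ → ℕ → ℕ
  child_zero : ∀ i < n, child i 0 = i + 1
  child_succ : ∀ i < n, ∀ k < arity (tag i) (arg i), child i (k + 1) = fin (child i k)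
  child_arity : ∀ i < n, child i (arity (tag i) (arg i)) = fin i
  child_lt : ∀ i < n, ∀ k < arity (tag i) (arg i), i < child i k ∧ child i k < n ∧
    par (child i k) = i + 1 ∧ pos (child i k) = k
  of_par : ∀ c < n, ∀ p, par c = p + 1 →
    p < c ∧ pos c < arity (tag p) (arg p) ∧ child p (pos c) = c
  par_le : ∀ c, par c ≤ c
  arity_le : ∀ i < n, arity (tag i) (arg i) ≤ n

namespace Layout

variable (L : Layout)

/-- `look X x` is the innermost binder of `X` among node `x - 1` and its ancestors (plus one),
or `0` if there is none. -/
def look (X : ℕ) : ℕ → ℕ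
  | 0 => 0
  | p + 1 => if L.tag p = 5 ∧ L.arg p = X then p + 1 else look X (L.par p)
termination_by x => x
decreasing_by exact Nat.lt_succ_of_le (L.par_le p)

/-- The binder of the variable at node `i` (plus one), or `0` if it is free. -/
def binder (i : ℕ) : ℕ := L.look (L.arg i) (L.par i)

/-- The end of the chain of recursive binders that starts at a node. -/
def chainEnd (i : ℕ) : ℕ := if L.tag i = 5 ∧ i < L.n then chainEnd (i + 1) else i
termination_by L.n - i

/-- The node of the unfolding of the type at a node. -/
def head (i : ℕ) : ℕ :=
  if L.tag (L.chainEnd i) = 6 ∧ 0 < L.binder (L.chainEnd i) ∧ L.binder (L.chainEnd i) ≤ i then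
    head (L.binder (L.chainEnd i) - 1)
  else L.chainEnd i
termination_by i

theorem look_le (X x : ℕ) : L.look X x ≤ x := by
  induction x using Nat.strong_induction_on with
  | _ x ih =>
    cases x with
    | zero => simp [look]
    | succ p =>
      rw [look]
      split_ifs
      · exact le_rfl
      · exact (ih _ (Nat.lt_succ_of_le (L.par_le p))).trans ((L.par_le p).trans p.le_succ)

theorem look_tag {X x b : ℕ} (h : L.look X x = b + 1) : L.tag b = 5 ∧ L.arg b = X := by
  induction x using Nat.strong_induction_on with
  | _ x ih =>
    cases x with
    | zero => simp [look] at h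
    | succ p =>
      rw [look] at h
      split_ifs at h with hp
      · obtain rfl : p = b := by omega
        exact hp
      · exact ih _ (Nat.lt_succ_of_le (L.par_le p)) h

/-- A layout whose nodes denote types. -/
structure Typed (ty : ℕ → SType) : Prop where
  tagOf_ty : ∀ i < L.n, (L.tag i = 6 → L.binder i = 0) →
    (ty i).tagOf = L.tag i ∧ (ty i).argOf = L.arg i
  kids_ty : ∀ i < L.n, L.tag i < 5 → ∀ k < arity (L.tag i) (L.arg i),
    (ty i).kids[k]? = some (L.lab (L.child i k), ty (L.child i k))
  unfold_ty : ∀ i < L.n, L.tag i = 5 → ∀ X B, ty i = mu X B →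
    subst X (mu X B) B = ty (i + 1)
  bound_ty : ∀ i < L.n, L.tag i = 6 → ∀ b, L.binder i = b + 1 → ty i = ty b
  lab_inj : ∀ i < L.n, L.tag i = 3 ∨ L.tag i = 4 → ∀ k < arity (L.tag i) (L.arg i),
    ∀ k' < arity (L.tag i) (L.arg i), L.lab (L.child i k) = L.lab (L.child i k') → k = k'
  binder_chainEnd : ∀ i < L.n, L.tag (L.chainEnd i) = 6 → L.binder (L.chainEnd i) ≤ i

end Layout

/-! ### The nodes of the two syntax trees and their indices -/

namespace SType

/-- The place of a node in a forest, and the environment at the node. -/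
structure Place where
  idx : ℕ
  par : ℕ
  pos : ℕ
  lab : ℕ
  env : ℕ → SType

/-- The total size of the first `k` components of a term. -/
def sizeBefore (S : SType) (k : ℕ) : ℕ := ((S.kids.take k).map fun p => p.2.size).sum

/-- The place of the `k`-th component of a term. -/
def kidPlace (c : Place) (S : SType) (k : ℕ) : Place where
  idx := c.idx + 1 + S.sizeBefore k
  par := c.idx + 1
  pos := k
  lab := (S.kids[k]?.map Prod.fst).getD 0
  env := extEnv c.env S

/-- The nodes of a syntax tree in preorder. -/
def nodes : SType → Place → List (Place × SType)
  | tend, c => [(c, tend)]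
  | inp n Ts S, c => (c, inp n Ts S) ::
      ((List.ofFn fun i => nodes (Ts i) (kidPlace c (inp n Ts S) i)).flatten ++
        nodes S (kidPlace c (inp n Ts S) n))
  | out n Ts S, c => (c, out n Ts S) ::
      ((List.ofFn fun i => nodes (Ts i) (kidPlace c (out n Ts S) i)).flatten ++
        nodes S (kidPlace c (out n Ts S) n))
  | sel n l Ts, c => (c, sel n l Ts) ::
      (List.ofFn fun i => nodes (Ts i) (kidPlace c (sel n l Ts) i)).flatten
  | bra n l Ts, c => (c, bra n l Ts) ::
      (List.ofFn fun i => nodes (Ts i) (kidPlace c (bra n l Ts) i)).flatten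
  | mu X B, c => (c, mu X B) :: nodes B (kidPlace c (mu X B) 0)
  | var X, c => [(c, var X)]

theorem nodes_eq (S : SType) (c : Place) :
    nodes S c = (c, S) :: (S.kids.mapIdx fun k p => nodes p.2 (kidPlace c S k)).flatten := by
  have ofFn_eq : ∀ {n : ℕ} (f : Fin n → ℕ × SType) (g : ℕ → ℕ × SType → List (Place × SType)),
      (List.ofFn f).mapIdx g = List.ofFn fun i => g i (f i) := by
    intro n f g
    refine List.ext_getElem (by simp) fun i h1 h2 => by simp
  cases S <;> simp [nodes, kids, ofFn_eq, List.mapIdx_append]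

theorem map_nodes_eq {α : Type*} {f : Place × SType → α} {g : ℕ × SType → Place → List α}
    {S : SType} {c : Place}
    (h : ∀ k p, S.kids[k]? = some p → (nodes p.2 (kidPlace c S k)).map f = g p (kidPlace c S k)) :
    (nodes S c).map f =
      f (c, S) :: (S.kids.mapIdx fun k p => g p (kidPlace c S k)).flatten := by
  rw [nodes_eq, List.map_cons, List.map_flatten]
  congr 2
  refine List.ext_getElem (by simp) fun i h1 h2 => ?_
  simp only [List.getElem_map, List.getElem_mapIdx]
  refine h _ _ (List.getElem?_eq_getElem _)

theorem mapIdx_congr_map {α β : Type*} {f : ℕ → α → β} {g : α → β} {l : List α}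
    (h : ∀ k a, l[k]? = some a → f k a = g a) : l.mapIdx f = l.map g := by
  refine List.ext_getElem (by simp) fun i h1 h2 => ?_
  simp only [List.getElem_map, List.getElem_mapIdx]
  exact h _ _ (List.getElem?_eq_getElem _)

theorem map_mapIdx {α β γ : Type*} (f : ℕ → α → β) (g : β → γ) (l : List α) :
    (l.mapIdx f).map g = l.mapIdx fun k a => g (f k a) :=
  List.ext_getElem (by simp) fun i h1 h2 => by simp

theorem kidPlace_lab {c : Place} {S : SType} {k : ℕ} {p : ℕ × SType} (h : S.kids[k]? = some p) :
    (kidPlace c S k).lab = p.1 := by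
  simp [kidPlace, h]

theorem code_eq_map_nodes (S : SType) (c : Place) :
    code c.lab S = (nodes S c).map fun x => ⟨x.2.tagOf, x.2.argOf, x.1.lab⟩ := by
  induction S using kids_induct generalizing c with
  | h S ih =>
    rw [map_nodes_eq (g := fun p c => code c.lab p.2)
      fun k p hp => (ih p (List.mem_of_getElem? hp) _).symm, code_eq]
    congr 2
    exact (mapIdx_congr_map fun k p hp => by rw [kidPlace_lab hp]).symm

theorem nodeTypes_eq_map_nodes (S : SType) (c : Place) :
    nodeTypes c.env S = (nodes S c).map fun x => msubst x.1.env x.2 := by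
  induction S using kids_induct generalizing c with
  | h S ih =>
    rw [map_nodes_eq (g := fun p c => nodeTypes c.env p.2)
      fun k p hp => (ih p (List.mem_of_getElem? hp) _).symm, nodeTypes_eq]
    congr 2
    exact (mapIdx_congr_map (g := fun p : ℕ × SType => nodeTypes (extEnv c.env S) p.2) fun k p hp => rfl).symm

theorem length_nodes (S : SType) (c : Place) : (nodes S c).length = S.size := by
  induction S using kids_induct generalizing c with
  | h S ih =>
    rw [nodes_eq, List.length_cons, List.length_flatten, size_eq, map_mapIdx]
    congr 2
    exact mapIdx_congr_map fun k p hp => ih p (List.mem_of_getElem? hp) _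

theorem drop_flatten {α : Type*} {l : List (List α)} {k : ℕ} {x : List α} (h : l[k]? = some x) :
    ∃ r, l.flatten.drop ((l.take k).map List.length).sum = x ++ r := by
  induction l generalizing k with
  | nil => simp at h
  | cons a l ih =>
    cases k with
    | zero => exact ⟨l.flatten, by simp_all⟩
    | succ k =>
      obtain ⟨r, hr⟩ := ih (k := k) (by simpa using h)
      exact ⟨r, by simpa [List.drop_append, List.drop_eq_nil_of_le] using hr⟩

/-- Locates the summand into which the offset `m` falls; for subtree sizes, this is the component
that contains a given node. -/
theorem exists_sum_take_le {α : Type*} (f : α → ℕ) {l : List α} {m : ℕ} (h : m < (l.map f).sum) :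
    ∃ k a, l[k]? = some a ∧ ((l.take k).map f).sum ≤ m ∧ m < ((l.take k).map f).sum + f a := by
  induction l generalizing m with
  | nil => simp at h
  | cons a l ih =>
    by_cases hm : m < f a
    · exact ⟨0, a, rfl, by simp, by simpa using hm⟩
    · simp only [List.map_cons, List.sum_cons] at h
      obtain ⟨k, b, hk, h1, h2⟩ := ih (m := m - f a) (by omega)
      exact ⟨k + 1, b, by simpa using hk, by
        rw [List.take_succ_cons, List.map_cons, List.sum_cons]; omega, by
        rw [List.take_succ_cons, List.map_cons, List.sum_cons]; omega⟩

/-- The nodes of the two syntax trees, one after the other. -/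
def allNodes (T U : SType) : List (Place × SType) :=
  nodes T ⟨0, 0, 0, 0, var⟩ ++ nodes U ⟨T.size, 0, 0, 0, var⟩

/-- `Occ T U R c S`: the term `S` occurs in place `c` of the syntax tree of `R`, which is one of `T`
and `U`. -/
inductive Occ (T U : SType) : SType → Place → SType → Prop
  | left : Occ T U T ⟨0, 0, 0, 0, var⟩ T
  | right : Occ T U U ⟨T.size, 0, 0, 0, var⟩ U
  | kid {R : SType} {c : Place} {S : SType} {k : ℕ} {p : ℕ × SType} (h : Occ T U R c S)
      (hk : S.kids[k]? = some p) : Occ T U R (kidPlace c S k) p.2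

variable {T U : SType}

/-- In preorder each subtree is a contiguous segment, so the index that `kidPlace` computes from
sizes is the true position of the node. -/
theorem Occ.drop {R : SType} {c : Place} {S : SType} (h : Occ T U R c S) :
    ∃ r, (allNodes T U).drop c.idx = nodes S c ++ r := by
  induction h with
  | left => exact ⟨_, rfl⟩
  | right => exact ⟨[], by simp [allNodes, length_nodes]⟩
  | @kid R c S k p h hk ih =>
    obtain ⟨r, hr⟩ := ih
    obtain ⟨r', hr'⟩ := drop_flatten (l := S.kids.mapIdx fun k p => nodes p.2 (kidPlace c S k))
      (k := k) (x := nodes p.2 (kidPlace c S k)) (by simp [hk])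
    refine ⟨r' ++ r, ?_⟩
    have hlen : ((List.take k (S.kids.mapIdx fun k p => nodes p.2 (kidPlace c S k))).map
        List.length).sum = S.sizeBefore k := by
      rw [List.map_take, map_mapIdx, sizeBefore, List.map_take,
        mapIdx_congr_map fun k p _ => length_nodes p.2 _]
    rw [hlen] at hr'
    rw [show (kidPlace c S k).idx = c.idx + (1 + S.sizeBefore k) from add_assoc _ _ _, ← List.drop_drop, hr, nodes_eq, List.cons_append, add_comm 1,
      List.drop_succ_cons, List.drop_append_of_le_length, hr', List.append_assoc]
    -- The offset stays within the segment: otherwise nothing would be left, yet the subtree of a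
    -- component is not empty.
    · by_contra! hlt
      rw [List.drop_eq_nil_of_le hlt.le] at hr'
      have := congrArg List.length hr'
      simp [nodes_eq p.2] at this

theorem Occ.getElem? {R : SType} {c : Place} {S : SType} (h : Occ T U R c S) :
    (allNodes T U)[c.idx]? = some (c, S) := by
  obtain ⟨r, hr⟩ := h.drop
  rw [← List.head?_drop, hr, nodes_eq]
  rfl

theorem length_allNodes : (allNodes T U).length = T.size + U.size := by
  simp [allNodes, length_nodes]

theorem Occ.idx_add_size_le {R : SType} {c : Place} {S : SType} (h : Occ T U R c S) :
    c.idx + S.size ≤ T.size + U.size := by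
  obtain ⟨r, hr⟩ := h.drop
  have := congrArg List.length hr
  rw [List.length_drop, length_allNodes, List.length_append, length_nodes] at this
  have : 0 < S.size := by rw [size_eq]; omega
  omega

/-- Occurrences fill the segment of a subtree without gaps, so facts about all nodes may be proved
by induction on `Occ`. -/
theorem Occ.exists_occ {R : SType} {c : Place} {S : SType} (h : Occ T U R c S) {m : ℕ}
    (hm : m < S.size) : ∃ c' S', Occ T U R c' S' ∧ c'.idx = c.idx + m := by
  induction S using kids_induct generalizing c m with
  | h S ih =>
    cases m with
    | zero => exact ⟨c, S, h, rfl⟩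
    | succ m =>
      rw [size_eq] at hm
      obtain ⟨k, p, hk, h1, h2⟩ := exists_sum_take_le (fun p : ℕ × SType => p.2.size)
        (l := S.kids) (m := m) (by omega)
      obtain ⟨c', S', ho, hi⟩ := ih p (List.mem_of_getElem? hk) (h.kid hk)
        (m := m - S.sizeBefore k) (by rw [sizeBefore]; omega)
      refine ⟨c', S', ho, ?_⟩
      rw [hi, kidPlace]
      simp only [sizeBefore]
      omega

theorem exists_occ {i : ℕ} (hi : i < T.size + U.size) :
    ∃ R c S, Occ T U R c S ∧ c.idx = i := by
  by_cases h : i < T.size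
  · obtain ⟨c, S, h, h'⟩ := Occ.left (T := T) (U := U) |>.exists_occ h
    exact ⟨_, c, S, h, by simpa using h'⟩
  · obtain ⟨c, S, h, h'⟩ := Occ.right (T := T) (U := U) |>.exists_occ (m := i - T.size) (by omega)
    exact ⟨_, c, S, h, by simp only at h'; omega⟩

theorem sizeBefore_succ {S : SType} {k : ℕ} {p : ℕ × SType} (h : S.kids[k]? = some p) :
    S.sizeBefore (k + 1) = S.sizeBefore k + p.2.size := by
  simp [sizeBefore, List.take_add_one, h]

theorem sizeBefore_length (S : SType) : S.sizeBefore S.kids.length + 1 = S.size := by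
  rw [size_eq, sizeBefore, List.take_length]

theorem length_kids_lt_size (S : SType) : S.kids.length < S.size := by
  rw [size_eq, Nat.lt_succ_iff]
  have := List.length_le_sum_of_one_le (S.kids.map fun p => p.2.size) (fun i hi => by
    obtain ⟨p, -, rfl⟩ := List.mem_map.1 hi
    rw [size_eq]
    omega)
  simpa using this

theorem exists_kid {S : SType} {k : ℕ} (hk : k < arity S.tagOf S.argOf) :
    ∃ p, S.kids[k]? = some p :=
  ⟨_, List.getElem?_eq_getElem (by rwa [length_kids])⟩

theorem lt_arity {S : SType} {k : ℕ} {p : ℕ × SType} (hk : S.kids[k]? = some p) :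
    k < arity S.tagOf S.argOf := by
  rw [← length_kids]
  exact (List.getElem?_eq_some_iff.1 hk).1

/-- The value of `f` at the `i`-th node. -/
def nodeVal (T U : SType) (f : Place × SType → ℕ) (i : ℕ) : ℕ := ((allNodes T U)[i]?.map f).getD 0

theorem Occ.nodeVal {R : SType} {c : Place} {S : SType} (h : Occ T U R c S)
    (f : Place × SType → ℕ) : SType.nodeVal T U f c.idx = f (c, S) := by
  simp [SType.nodeVal, h.getElem?]

theorem Occ.par_le {R : SType} {c : Place} {S : SType} (h : Occ T U R c S) : c.par ≤ c.idx := by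
  cases h <;> simp [kidPlace]

/-- The layout of the syntax trees of two types. -/
def layout (T U : SType) : Layout where
  n := T.size + U.size
  tag := nodeVal T U fun x => x.2.tagOf
  arg := nodeVal T U fun x => x.2.argOf
  lab := nodeVal T U fun x => x.1.lab
  par := nodeVal T U fun x => x.1.par
  pos := nodeVal T U fun x => x.1.pos
  fin := nodeVal T U fun x => x.1.idx + x.2.size
  child i k := nodeVal T U (fun x => (kidPlace x.1 x.2 k).idx) i
  child_zero i hi := by
    obtain ⟨R, c, S, h, rfl⟩ := exists_occ hi
    simp [h.nodeVal, kidPlace, sizeBefore]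
  child_succ i hi k hk := by
    obtain ⟨R, c, S, h, rfl⟩ := exists_occ hi
    rw [h.nodeVal, h.nodeVal] at hk
    obtain ⟨p, hp⟩ := exists_kid hk
    rw [h.nodeVal, h.nodeVal, (h.kid hp).nodeVal]
    simp [kidPlace, sizeBefore_succ hp, add_assoc]
  child_arity i hi := by
    obtain ⟨R, c, S, h, rfl⟩ := exists_occ hi
    rw [h.nodeVal, h.nodeVal, h.nodeVal, h.nodeVal, ← length_kids]
    simp only [kidPlace, ← sizeBefore_length S]
    omega
  child_lt i hi k hk := by
    obtain ⟨R, c, S, h, rfl⟩ := exists_occ hi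
    rw [h.nodeVal, h.nodeVal] at hk
    obtain ⟨p, hp⟩ := exists_kid hk
    have h' := h.kid hp
    have := h'.idx_add_size_le
    have : 0 < p.2.size := by rw [size_eq]; omega
    rw [h.nodeVal, h'.nodeVal, h'.nodeVal]
    refine ⟨?_, by simp only; omega, rfl, rfl⟩
    simp only [kidPlace]
    omega
  of_par c hc p hp := by
    obtain ⟨R, c, S, h, rfl⟩ := exists_occ hc
    rw [h.nodeVal] at hp
    rw [h.nodeVal]
    cases h with
    | left | right => simp at hp
    | @kid _ c S k p' h hk =>
      obtain rfl : c.idx = p := by simpa [kidPlace] using hp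
      rw [h.nodeVal, h.nodeVal, h.nodeVal]
      refine ⟨?_, lt_arity hk, rfl⟩
      simp only [kidPlace]
      omega
  par_le i := by
    by_cases hi : i < T.size + U.size
    · obtain ⟨R, c, S, h, rfl⟩ := exists_occ hi
      rw [h.nodeVal]
      exact h.par_le
    -- `Layout.look` recurses through `par` at arbitrary numbers, so the bound is needed outside the
    -- trees too, where the default value is `0`.
    · simp [nodeVal, List.getElem?_eq_none (length_allNodes.trans_le (not_lt.1 hi))]
  arity_le i hi := by
    obtain ⟨R, c, S, h, rfl⟩ := exists_occ hi
    rw [h.nodeVal, h.nodeVal, ← length_kids]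
    have := h.idx_add_size_le
    have := length_kids_lt_size S
    simp only
    omega

end SType
end SessionTypes

/-! ### The types denoted by the nodes -/

namespace SessionTypes
namespace SType

variable {T U : SType}

/-- The type denoted by the `i`-th node. -/
def nodeTy (T U : SType) (i : ℕ) : SType :=
  ((allNodes T U)[i]?.map fun x => msubst x.1.env x.2).getD tend

theorem pairNodeTypes_eq (T U : SType) :
    pairNodeTypes T U = (allNodes T U).map fun x => msubst x.1.env x.2 := by
  rw [pairNodeTypes, allNodes, List.map_append, ← nodeTypes_eq_map_nodes, ← nodeTypes_eq_map_nodes]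

theorem pairCode_eq (T U : SType) :
    pairCode T U = (allNodes T U).map fun x => ⟨x.2.tagOf, x.2.argOf, x.1.lab⟩ := by
  rw [pairCode, allNodes, List.map_append, ← code_eq_map_nodes, ← code_eq_map_nodes]

theorem nodeTy_of_getElem? {i : ℕ} {S : SType} (h : (pairNodeTypes T U)[i]? = some S) :
    i < T.size + U.size ∧ nodeTy T U i = S := by
  have hi := (List.getElem?_eq_some_iff.1 h).1
  rw [pairNodeTypes_eq, List.length_map, length_allNodes] at hi
  rw [pairNodeTypes_eq, List.getElem?_map] at h
  exact ⟨hi, by rw [nodeTy, h]; rfl⟩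

theorem mem_pairNodeTypes {S : SType} :
    S ∈ pairNodeTypes T U ↔ ∃ i < T.size + U.size, nodeTy T U i = S := by
  rw [List.mem_iff_getElem?]
  constructor
  · rintro ⟨i, hi⟩
    exact ⟨i, nodeTy_of_getElem? hi⟩
  · rintro ⟨i, hi, rfl⟩
    refine ⟨i, ?_⟩
    rw [pairNodeTypes_eq, List.getElem?_map, nodeTy, List.getElem?_eq_getElem
      (by rwa [length_allNodes])]
    rfl

namespace Occ

variable {R : SType} {c : Place} {S : SType} (h : Occ T U R c S)
include h

theorem nodeTy : SType.nodeTy T U c.idx = msubst c.env S := by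
  simp [SType.nodeTy, h.getElem?]

theorem tag : (layout T U).tag c.idx = S.tagOf := h.nodeVal _
theorem arg : (layout T U).arg c.idx = S.argOf := h.nodeVal _
theorem lab : (layout T U).lab c.idx = c.lab := h.nodeVal _
theorem par : (layout T U).par c.idx = c.par := h.nodeVal _
theorem child (k : ℕ) : (layout T U).child c.idx k = (kidPlace c S k).idx := h.nodeVal _

theorem idx_lt : c.idx < (layout T U).n := by
  have := h.idx_add_size_le
  have : 0 < S.size := by rw [size_eq]; omega
  simp only [layout]
  omega

theorem root : R = T ∨ R = U := by
  induction h with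
  | left => exact .inl rfl
  | right => exact .inr rfl
  | kid _ _ ih => exact ih

/-- At every node, what is substituted has only free variables of the root, and what is bound below
is bound in the root. As these sets are disjoint, the substitutions at all nodes are free of
capture. -/
theorem inv (hR : R.IsSessionType) : S.bv ⊆ R.bv ∧ (∀ Y ∈ S.fv, (c.env Y).fv ⊆ R.fv) ∧
    S.Contractive ∧ S.DistinctLabels := by
  induction h with
  | left | right =>
    refine ⟨subset_rfl, fun Y hY => ?_, hR.contractive, hR.distinctLabels⟩
    rintro Z rfl
    exact hY
  | @kid R c S k p h hk ih =>
    obtain ⟨h1, h2, h3, h4⟩ := ih hR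
    obtain ⟨k1, k2, k3, k4⟩ := fv_kid (List.mem_of_getElem? hk)
    refine ⟨k1.trans h1, fun Y hY => ?_, k3 h3, k4 h4⟩
    have key : Y ∈ S.fv → (c.env Y).fv ⊆ R.fv := h2 Y
    change (extEnv c.env S Y).fv ⊆ R.fv
    rcases k2 Y hY with hY | ⟨h5, hY⟩
    · cases S with
      | mu X B =>
        rw [extEnv, Function.update_of_ne]
        · exact key hY
        · rintro rfl
          exact hY.2 rfl
      | _ => exact key hY
    -- The variable bound here stands for the recursive type itself, whose free variables come from
    -- the environment above.
    · cases S <;> simp only [tagOf] at h5 <;> try omega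
      obtain rfl : _ = Y := hY
      simp only [extEnv, argOf, Function.update_self]
      intro Z hZ
      obtain ⟨W, hW, hZ⟩ := exists_of_mem_fv_msubst hZ
      exact h2 W hW hZ

/-- Shadowing in the environment is the same as taking the innermost binder: going down past a `mu`
updates exactly the variable that `Layout.look` stops at. -/
theorem look (Y : ℕ) : ((layout T U).look Y c.par = 0 → c.env Y = var Y) ∧
    ∀ b, (layout T U).look Y c.par = b + 1 → c.env Y = SType.nodeTy T U b := by
  induction h with
  | left | right => simp [Layout.look]
  | @kid R c S k p h hk ih =>
    simp only [kidPlace]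
    rw [Layout.look, h.tag, h.arg, h.par]
    split_ifs with hS
    · cases S <;> simp only [tagOf] at hS <;> try omega
      obtain rfl : _ = Y := hS.2
      refine ⟨by simp, fun b hb => ?_⟩
      obtain rfl : c.idx = b := by omega
      rw [h.nodeTy]
      simp [extEnv, argOf]
    · have : extEnv c.env S Y = c.env Y := by
        cases S with
        | mu X B =>
          refine Function.update_of_ne ?_ _ _
          rintro rfl
          exact hS ⟨rfl, rfl⟩
        | _ => rfl
      rwa [this]

/-- By contractivity, no binder of the chain binds the variable at its end, so the search for the
binder passes the whole chain and continues above its first node. -/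
theorem chainEnd (hS : S.Contractive) (ht : (layout T U).tag ((layout T U).chainEnd c.idx) = 6) :
    (layout T U).binder ((layout T U).chainEnd c.idx) =
        (layout T U).look ((layout T U).arg ((layout T U).chainEnd c.idx)) c.par ∧
      S.chainVar = some ((layout T U).arg ((layout T U).chainEnd c.idx)) := by
  induction S using kids_induct generalizing c with
  | h S ih =>
    by_cases h5 : S.tagOf = 5
    · cases S <;> simp only [tagOf] at h5 <;> try omega
      rename_i X B
      have h' := h.kid (k := 0) (p := (0, B)) rfl
      have hc : (layout T U).chainEnd c.idx =
          (layout T U).chainEnd (kidPlace c (mu X B) 0).idx := by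
        rw [Layout.chainEnd, if_pos ⟨h.tag, h.idx_lt⟩]
        rfl
      rw [hc] at ht ⊢
      obtain ⟨i1, i2⟩ := ih (0, B) (by simp [kids]) h' hS.2 ht
      refine ⟨i1.trans ?_, i2⟩
      simp only [kidPlace]
      -- If this `mu` bound the variable at the end of the chain, then `B.chainVar` would be its own
      -- variable, against contractivity.
      rw [Layout.look, if_neg, h.par]
      rintro ⟨-, ha⟩
      rw [h.arg] at ha
      refine hS.1 (i2.trans (congrArg some ?_))
      exact ha.symm
    · have hc : (layout T U).chainEnd c.idx = c.idx := by
        rw [Layout.chainEnd, if_neg]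
        rw [h.tag]
        exact fun h => h5 h.1
      rw [hc] at ht ⊢
      rw [h.tag] at ht
      rw [Layout.binder, h.par, h.arg]
      cases S <;> simp only [tagOf] at ht <;> try omega
      exact ⟨rfl, rfl⟩

end Occ

theorem layout_typed (hT : T.IsSessionType) (hU : U.IsSessionType) :
    (layout T U).Typed (nodeTy T U) := by
  have root : ∀ {R c S}, Occ T U R c S → R.IsSessionType := by
    intro R c S h
    rcases h.root with rfl | rfl <;> assumption
  constructor
  · intro i hi h6
    obtain ⟨R, c, S, h, rfl⟩ := exists_occ hi
    rw [h.tag] at h6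
    rw [h.nodeTy, h.tag, h.arg]
    cases S with
    | var X =>
      have h6 := h6 rfl
      rw [Layout.binder, h.par, h.arg] at h6
      have := (h.look X).1 h6
      simp [msubst, this, tagOf, argOf]
    | _ => exact tagOf_msubst _ (by simp [tagOf])
  · intro i hi h5 k hk
    obtain ⟨R, c, S, h, rfl⟩ := exists_occ hi
    rw [h.tag, h.arg] at hk
    rw [h.tag] at h5
    obtain ⟨p, hp⟩ := exists_kid hk
    have h' := h.kid hp
    rw [h.nodeTy, h.child, h'.lab, h'.nodeTy, kids_msubst _ h5, List.getElem?_map, hp,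
      kidPlace_lab hp]
    rfl
  · intro i hi h5 X B hXB
    obtain ⟨R, c, S, h, rfl⟩ := exists_occ hi
    rw [h.tag] at h5
    cases S <;> simp only [tagOf] at h5 <;> try omega
    rename_i Y B'
    have h' := h.kid (k := 0) (p := (0, B')) rfl
    have hidx : c.idx + 1 = (kidPlace c (mu Y B') 0).idx := rfl
    rw [hidx, h'.nodeTy]
    rw [h.nodeTy] at hXB
    obtain ⟨h1, h2, -⟩ := h.inv (root h)
    rw [← hXB]
    rw [msubst] at hXB
    obtain ⟨rfl, rfl⟩ := SType.mu.inj hXB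
    -- Unfolding after substituting replaces the bound variable by the recursive type, which is how
    -- the environment of the body is defined.
    rw [subst_msubst_mu]
    · rfl
    · exact fun Z hZ => ((root h).varConvention.mono_left (h2 Z hZ)).mono_right h1
  · intro i hi h6 b hb
    obtain ⟨R, c, S, h, rfl⟩ := exists_occ hi
    rw [h.tag] at h6
    cases S <;> simp only [tagOf] at h6 <;> try omega
    rw [Layout.binder, h.par, h.arg] at hb
    rw [h.nodeTy]
    exact (h.look _).2 b hb
  · intro i hi ht k hk k' hk' hl
    obtain ⟨R, c, S, h, rfl⟩ := exists_occ hi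
    rw [h.tag, h.arg] at hk hk'
    rw [h.tag] at ht
    obtain ⟨p, hp⟩ := exists_kid hk
    obtain ⟨p', hp'⟩ := exists_kid hk'
    rw [h.child, h.child, (h.kid hp).lab, (h.kid hp').lab, kidPlace_lab hp, kidPlace_lab hp'] at hl
    exact kids_label_injective (h.inv (root h)).2.2.2 ht hp hp' hl
  · intro i hi h6
    obtain ⟨R, c, S, h, rfl⟩ := exists_occ hi
    rw [(h.chainEnd (h.inv (root h)).2.2.1 h6).1]
    exact ((layout T U).look_le _ _).trans h.par_le

theorem Occ.inSub (hT : T.IsSessionType) (hU : U.IsSessionType) {R : SType} {c : Place} {S : SType}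
    (h : Occ T U R c S) : InSub (SType.nodeTy T U c.idx) R := by
  have ht := layout_typed hT hU
  induction h with
  | left =>
    rw [Occ.left.nodeTy, msubst_var]
    exact .refl _
  | right =>
    rw [Occ.right.nodeTy, msubst_var]
    exact .refl _
  | @kid R c S k p h hk ih =>
    refine InSub.trans ?_ ih
    have ht5 := h.tag
    by_cases h5 : S.tagOf < 5
    · have := ht.kids_ty _ h.idx_lt (by rwa [h.tag]) k (by rw [h.tag, h.arg]; exact lt_arity hk)
      refine InSub.kid ?_ (List.mem_of_getElem? this) ?_
      · rwa [(ht.tagOf_ty _ h.idx_lt (by omega)).1, h.tag]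
      · rw [h.child]
        exact .refl _
    · cases S with
      | mu X B =>
        obtain rfl : k = 0 := by simpa [kids, List.getElem?_singleton] using (List.getElem?_eq_some_iff.1 hk).1
        have := ht.unfold_ty _ h.idx_lt h.tag _ _ h.nodeTy
        rw [h.nodeTy]
        refine .mu ?_
        change InSub _ (subst X (msubst c.env (mu X B)) _)
        erw [this]
        exact .refl _
      | var X => simp [kids] at hk
      | _ => simp [tagOf] at h5

end SType

/-! ### Subterms are the types of nodes -/

namespace Layout.Typed
open SType

variable {L : Layout} {ty : ℕ → SType} (h : L.Typed ty)
include h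

/-- A bound variable may be traded for its binder, which denotes the same type; the node obtained
shows the outermost constructor of its type. -/
theorem exists_unbound {i : ℕ} (hi : i < L.n) :
    ∃ j < L.n, ty j = ty i ∧ (L.tag j = 6 → L.binder j = 0) := by
  by_cases h6 : L.tag i = 6 ∧ L.binder i ≠ 0
  · obtain ⟨b, hb⟩ := Nat.exists_eq_succ_of_ne_zero h6.2
    have hle := L.look_le (L.arg i) (L.par i)
    have := L.par_le i
    have ht := (L.look_tag hb).1
    rw [binder] at hb
    exact ⟨b, by omega, (h.bound_ty i hi h6.1 b hb).symm, by omega⟩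
  · exact ⟨i, hi, rfl, by tauto⟩

/-- The types of nodes are closed under the rules that generate `Sub`: a recursive type unfolds to
the type of the next node, and components are types of children. -/
theorem exists_of_inSub {S T : SType} (hS : InSub S T) :
    ∀ i < L.n, ty i = T → ∃ j < L.n, ty j = S := by
  refine InSub.kid_induct (P := fun T => ∀ i < L.n, ty i = T → ∃ j < L.n, ty j = S) ?_ ?_ ?_ hS
  · exact fun i hi h => ⟨i, hi, h⟩
  · intro X B ih i hi hXB
    obtain ⟨j, hj, hji, h6⟩ := h.exists_unbound hi
    obtain ⟨h5, -⟩ := h.tagOf_ty j hj h6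
    rw [hji, hXB] at h5
    have hlt := L.child_lt j hj 0 (by simp [← h5, arity, tagOf])
    rw [L.child_zero j hj] at hlt
    exact ih (j + 1) hlt.2.1 (h.unfold_ty j hj h5.symm X B (hji.trans hXB)).symm
  · intro T p hT hp ih i hi hiT
    obtain ⟨j, hj, hji, h6⟩ := h.exists_unbound hi
    obtain ⟨h5, ha⟩ := h.tagOf_ty j hj h6
    obtain ⟨k, hk⟩ := List.mem_iff_getElem?.1 hp
    rw [hji, hiT] at h5 ha
    have hk' := lt_arity hk
    rw [h5, ha] at hk'
    have hkid := h.kids_ty j hj (by omega) k hk'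
    rw [hji, hiT, hk] at hkid
    exact ih _ (L.child_lt j hj k hk').2.1 (congrArg Prod.snd (Option.some.inj hkid)).symm

end Layout.Typed

namespace SType

theorem mem_sub_iff {T U : SType} (hT : T.IsSessionType) (hU : U.IsSessionType) (S : SType) :
    S ∈ T.Sub U ↔ S ∈ T.pairNodeTypes U := by
  have ht := layout_typed hT hU
  rw [mem_pairNodeTypes]
  constructor
  · rintro (h | h)
    · have := (Occ.left (T := T) (U := U)).nodeTy
      rw [msubst_var] at this
      exact ht.exists_of_inSub h _ (Occ.left (T := T) (U := U)).idx_lt this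
    · have := (Occ.right (T := T) (U := U)).nodeTy
      rw [msubst_var] at this
      exact ht.exists_of_inSub h _ (Occ.right (T := T) (U := U)).idx_lt this
  · rintro ⟨i, hi, rfl⟩
    obtain ⟨R, c, S, h, rfl⟩ := exists_occ hi
    have := h.inSub hT hU
    rcases h.root with rfl | rfl
    exacts [.inl this, .inr this]

end SType
end SessionTypes

namespace SessionTypes
open SType

/-! ### Subtyping as non-reachability in a graph of pairs of nodes -/

/-- The vertices reachable from `F` along the edges `src e ⟶ dst e` with `e < K`. -/
inductive Reach (K : ℕ) (src dst : ℕ → ℕ) (F : ℕ → Prop) : ℕ → Prop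
  | init {v : ℕ} (hv : v < K) (h : F v) : Reach K src dst F v
  | step {e : ℕ} (he : e < K) (h : Reach K src dst F (src e)) : Reach K src dst F (dst e)

theorem pair_inj {n a b c d : ℕ} (hb : b < n) (hd : d < n) :
    a * n + b = c * n + d ↔ a = c ∧ b = d := by
  constructor
  · intro h
    have hn : 0 < n := by omega
    have h1 := congrArg (· / n) h
    simp only [Nat.mul_comm _ n, Nat.mul_add_div hn, Nat.div_eq_of_lt hb, Nat.div_eq_of_lt hd] at h1
    obtain rfl : a = c := by simpa using h1
    exact ⟨rfl, by omega⟩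
  · rintro ⟨rfl, rfl⟩
    rfl

theorem pair_lt {n a b : ℕ} (ha : a < n) (hb : b < n) : a * n + b < n * n :=
  calc a * n + b < (a + 1) * n := by rw [Nat.succ_mul]; omega
    _ ≤ n * n := Nat.mul_le_mul_right _ ha

theorem pair_div {n a b : ℕ} (hb : b < n) : (a * n + b) / n = a ∧ (a * n + b) % n = b := by
  have hn : 0 < n := by omega
  constructor
  · rw [Nat.mul_comm, Nat.mul_add_div hn, Nat.div_eq_of_lt hb, add_zero]
  · rw [Nat.mul_comm, Nat.mul_add_mod, Nat.mod_eq_of_lt hb]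

namespace Layout

variable (L : Layout)

/-- Node `i` is not a recursive type and not a bound variable. -/
def Headed (i : ℕ) : Prop := L.tag i ≠ 5 ∧ (L.tag i = 6 → L.binder i = 0)

/-- Nodes `c` and `d` are components with the same label of two selections or of two branchings. -/
def LabMatch (c d : ℕ) : Prop :=
  L.par c ≠ 0 ∧ L.par d ≠ 0 ∧ L.tag (L.par c - 1) = L.tag (L.par d - 1) ∧
    (L.tag (L.par c - 1) = 3 ∨ L.tag (L.par c - 1) = 4) ∧ L.lab c = L.lab d

/-- Nodes `c` and `d` are corresponding components of two inputs or of two outputs. -/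
def PosMatch (c d : ℕ) : Prop :=
  L.par c ≠ 0 ∧ L.par d ≠ 0 ∧ L.tag (L.par c - 1) = L.tag (L.par d - 1) ∧
    (L.tag (L.par c - 1) = 1 ∨ L.tag (L.par c - 1) = 2) ∧
    L.arg (L.par c - 1) = L.arg (L.par d - 1) ∧ L.pos c = L.pos d

/-- Node `c` is a payload of an output. -/
def Contra (c : ℕ) : Prop := L.tag (L.par c - 1) = 2 ∧ L.pos c ≠ L.arg (L.par c - 1)

/-- Node `c` is a component of a selection or branching, `q` is a node of the same kind, but no
component of `q` has the label of `c`. -/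
def Missing (c q : ℕ) : Prop :=
  L.par c ≠ 0 ∧ L.tag (L.par c - 1) = L.tag q ∧ (L.tag q = 3 ∨ L.tag q = 4) ∧
    ¬ ∃ d < L.n, L.LabMatch c d ∧ L.par d = q + 1

/-- The pair that is not in the subtyping relation if `c` is missing in `q`. -/
def target (c q : ℕ) : ℕ :=
  if L.tag q = 4 then (L.par c - 1) * L.n + q else q * L.n + (L.par c - 1)

/-- The tags and arguments of `a` and `b` prevent subtyping. -/
def Clash (a b : ℕ) : Prop :=
  L.tag a ≠ 6 ∧ (L.tag a ≠ L.tag b ∨ (L.tag a = 1 ∨ L.tag a = 2) ∧ L.arg a ≠ L.arg b)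

open Classical in
/-- The pair of which the pair of components `c`, `d` is a part. -/
noncomputable def parPair (c d : ℕ) : ℕ :=
  if L.PosMatch c d ∨ L.LabMatch c d then
    if L.Contra c then (L.par d - 1) * L.n + (L.par c - 1)
    else (L.par c - 1) * L.n + (L.par d - 1)
  else L.head c * L.n + L.head d

/-- The pair of the unfoldings. -/
def edgeSrc (e : ℕ) : ℕ := L.head (e / L.n) * L.n + L.head (e % L.n)

/-- The pair that depends on a pair. -/
noncomputable def edgeDst (e : ℕ) : ℕ := L.parPair (e / L.n) (e % L.n)

/-- The pairs that are not in the subtyping relation for an immediate reason. -/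
def Bad (v : ℕ) : Prop :=
  L.Clash (v / L.n) (v % L.n) ∨ ∃ c < L.n, ∃ q < L.n, L.Missing c q ∧ v = L.target c q

/-- The pairs that are not in the subtyping relation. -/
abbrev Fails : ℕ → Prop := Reach (L.n * L.n) L.edgeSrc L.edgeDst L.Bad

variable {L} {ty : ℕ → SType}

theorem LabMatch.symm {c d : ℕ} (h : L.LabMatch c d) : L.LabMatch d c :=
  ⟨h.2.1, h.1, h.2.2.1.symm, h.2.2.1 ▸ h.2.2.2.1, h.2.2.2.2.symm⟩

theorem Fails.pair {c d : ℕ} (hc : c < L.n) (hd : d < L.n)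
    (h : L.Fails (L.head c * L.n + L.head d)) : L.Fails (L.parPair c d) := by
  have he := pair_lt hc hd
  have h1 := pair_div (a := c) hd
  have := Reach.step (src := L.edgeSrc) (dst := L.edgeDst) (F := L.Bad) he
    (by rwa [edgeSrc, h1.1, h1.2])
  rwa [edgeDst, h1.1, h1.2] at this

theorem par_sub_one_lt {c : ℕ} (hc : c < L.n) (h : L.par c ≠ 0) :
    L.par c - 1 < L.n ∧ L.par c = L.par c - 1 + 1 := by
  have := L.par_le c
  omega

/-! ### Correctness of the graph -/

namespace Typed

variable (h : L.Typed ty)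
include h

theorem chainEnd_spec : ∀ i < L.n, i ≤ L.chainEnd i ∧ L.chainEnd i < L.n ∧
    L.tag (L.chainEnd i) ≠ 5 ∧ ∀ V, Unfolds (ty i) V ↔ Unfolds (ty (L.chainEnd i)) V := by
  intro i hi
  induction hk : L.n - i using Nat.strong_induction_on generalizing i with
  | _ k ih =>
    rw [chainEnd]
    split_ifs with h5
    · have hlt := L.child_lt i hi 0 (by simp [h5.1, arity])
      rw [L.child_zero i hi] at hlt
      obtain ⟨i1, i2, i3, i4⟩ := ih _ (by omega) (i + 1) hlt.2.1 rfl
      refine ⟨by omega, i2, i3, fun V => ?_⟩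
      rw [← i4]
      have ht := (h.tagOf_ty i hi (by omega)).1
      rw [h5.1] at ht
      have hu := h.unfold_ty i hi h5.1
      cases hty : ty i <;> rw [hty] at ht <;> simp only [tagOf] at ht <;> try omega
      rw [unfolds_mu, hu _ _ hty]
    · exact ⟨le_rfl, hi, fun h => h5 ⟨h, hi⟩, fun V => Iff.rfl⟩

/-- Strong induction works because the restart is at a smaller index. The guard in `head` that
ensures this is always met in a typed layout, by `binder_chainEnd`, so that the search stops at a
variable only if it is free. -/
theorem head_spec : ∀ i < L.n, L.head i < L.n ∧ L.Headed (L.head i) ∧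
    ∀ V, Unfolds (ty i) V ↔ Unfolds (ty (L.head i)) V := by
  intro i
  induction i using Nat.strong_induction_on with
  | _ i ih =>
    intro hi
    obtain ⟨e1, e2, e3, e4⟩ := h.chainEnd_spec i hi
    have hb := h.binder_chainEnd i hi
    rw [head]
    split_ifs with h6
    · obtain ⟨i1, i2, i3⟩ := ih (L.binder (L.chainEnd i) - 1) (by omega) (by omega)
      refine ⟨i1, i2, fun V => ?_⟩
      rw [e4, ← i3, h.bound_ty _ e2 h6.1 (L.binder (L.chainEnd i) - 1) (by omega)]
    · exact ⟨e2, ⟨e3, fun h => by have := hb h; simp only [h, true_and] at h6; omega⟩, e4⟩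

theorem unfolds_iff {i : ℕ} (hi : i < L.n) (hh : L.Headed i) (V : SType) :
    Unfolds (ty i) V ↔ V = ty i := by
  have ht := (h.tagOf_ty i hi hh.2).1
  have := hh.1
  have hr : Unfolds (ty i) (ty i) := by
    refine .refl fun X B hXB => ?_
    rw [hXB] at ht
    simp only [tagOf] at ht
    omega
  exact ⟨fun h => h.unique hr, fun h => h ▸ hr⟩

theorem kid_of_par {c p : ℕ} (hc : c < L.n) (hp : L.par c = p + 1) (ht : L.tag p < 5) :
    (ty p).kids[L.pos c]? = some (L.lab c, ty c) := by
  obtain ⟨h1, h2, h3⟩ := L.of_par c hc p hp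
  rw [h.kids_ty p (by omega) ht _ h2, h3]

theorem exists_of_kid {q k : ℕ} {B : ℕ × SType} (hq : q < L.n) (ht : L.tag q < 5)
    (hB : (ty q).kids[k]? = some B) :
    ∃ d < L.n, L.par d = q + 1 ∧ L.pos d = k ∧ B = (L.lab d, ty d) := by
  have hk := lt_arity hB
  obtain ⟨h1, h2⟩ := h.tagOf_ty q hq (by omega)
  rw [h1, h2] at hk
  have hc := L.child_lt q hq k hk
  refine ⟨_, hc.2.1, hc.2.2.1, hc.2.2.2, ?_⟩
  rw [h.kids_ty q hq ht k hk] at hB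
  exact (Option.some.inj hB).symm

theorem eq_of_lab {c d q : ℕ} (hc : c < L.n) (hd : d < L.n) (hcq : L.par c = q + 1)
    (hdq : L.par d = q + 1) (ht : L.tag q = 3 ∨ L.tag q = 4) (hl : L.lab c = L.lab d) : c = d := by
  obtain ⟨h1, h2, h3⟩ := L.of_par c hc q hcq
  obtain ⟨k1, k2, k3⟩ := L.of_par d hd q hdq
  rw [← h3, ← k3] at hl
  have := h.lab_inj q (by omega) ht _ h2 _ k2 hl
  rw [← h3, ← k3, this]

theorem stepRel {a b : ℕ} (ha : a < L.n) (hb : b < L.n) (hha : L.Headed a) (hhb : L.Headed b)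
    (h6 : L.tag a ≠ 6) (hs : SubtypeOf (ty a) (ty b)) : StepRel SubtypeOf (ty a) (ty b) := by
  obtain ⟨W, hW, hs⟩ := isSubtypingRel_iff.1 isSubtypingRel_subtypeOf _ _ hs (ty a)
    ((h.unfolds_iff ha hha _).2 rfl) (by rwa [(h.tagOf_ty a ha hha.2).1])
  rwa [(h.unfolds_iff hb hhb _).1 hW] at hs

theorem subtypeOf_head {i j : ℕ} (hi : i < L.n) (hj : j < L.n) :
    SubtypeOf (ty (L.head i)) (ty (L.head j)) ↔ SubtypeOf (ty i) (ty j) := by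
  have h1 := (h.head_spec i hi).2.2
  have h2 := (h.head_spec j hj).2.2
  exact ⟨SubtypeOf.congr (fun V => (h1 V).1) fun V => (h2 V).2,
    SubtypeOf.congr (fun V => (h1 V).2) fun V => (h2 V).1⟩

theorem not_subtypeOf_of_clash {a b : ℕ} (ha : a < L.n) (hb : b < L.n) (hha : L.Headed a)
    (hhb : L.Headed b) (hc : L.Clash a b) : ¬ SubtypeOf (ty a) (ty b) := by
  intro hs
  have hs := h.stepRel ha hb hha hhb hc.1 hs
  obtain ⟨h1, h2⟩ := h.tagOf_ty a ha hha.2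
  obtain ⟨k1, k2⟩ := h.tagOf_ty b hb hhb.2
  have s1 := hs.tag
  have s2 := hs.arg
  rw [h1, k1] at s1
  rw [h1, h2, k2] at s2
  rcases hc.2 with hc | ⟨hc, hc'⟩
  exacts [hc s1, hc' (s2 hc)]

/-- A branching must find its labels on the right, a selection on the left. So the parent of `c` is
the left member of the failing pair for branchings and the right one for selections. -/
theorem not_subtypeOf_of_missing {a b c q : ℕ} (ha : a < L.n) (hb : b < L.n) (hha : L.Headed a)
    (hhb : L.Headed b) (hc : c < L.n) (hq : q < L.n) (hm : L.Missing c q)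
    (hab : a * L.n + b = L.target c q) : ¬ SubtypeOf (ty a) (ty b) := by
  intro hs
  obtain ⟨m1, m2, m3, m4⟩ := hm
  obtain ⟨p1, p2⟩ := L.par_sub_one_lt hc m1
  have hkid := List.mem_of_getElem? (h.kid_of_par hc p2 (by omega))
  have key : ∀ B ∈ (ty q).kids, B.1 ≠ L.lab c := by
    intro B hB hl
    obtain ⟨k, hk⟩ := List.mem_iff_getElem?.1 hB
    obtain ⟨d, hd, hdq, -, rfl⟩ := h.exists_of_kid hq (by omega) hk
    exact m4 ⟨d, hd, ⟨m1, by omega, by rw [m2, hdq]; rfl, by omega, hl.symm⟩, hdq⟩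
  rw [target] at hab
  split_ifs at hab with h4
  · obtain ⟨rfl, rfl⟩ := (pair_inj hb hq).1 hab
    have hs := h.stepRel ha hb hha hhb (by omega) hs
    obtain ⟨B, hB, hl, -⟩ := hs.bra (by rw [(h.tagOf_ty _ ha hha.2).1]; omega) _ hkid
    exact key B hB hl.symm
  · obtain ⟨rfl, rfl⟩ := (pair_inj hb p1).1 hab
    have hs := h.stepRel ha hb hha hhb (by omega) hs
    obtain ⟨B, hB, hl, -⟩ := hs.sel (by rw [(h.tagOf_ty _ ha hha.2).1]; omega) _ hkid
    exact key B hB hl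

/-- A single failing component refutes the pair of parents. For labelled components this needs
distinct labels: the existential in the clause then has only one candidate. -/
theorem not_subtypeOf_of_parPair {a b c d : ℕ} (ha : a < L.n) (hb : b < L.n) (hha : L.Headed a)
    (hhb : L.Headed b) (hc : c < L.n) (hd : d < L.n) (hm : L.PosMatch c d ∨ L.LabMatch c d)
    (hab : a * L.n + b = L.parPair c d) (hn : ¬ SubtypeOf (ty c) (ty d)) :
    ¬ SubtypeOf (ty a) (ty b) := by
  intro hs
  refine hn ?_
  rw [parPair, if_pos hm] at hab
  rcases hm with ⟨m1, m2, m3, m4, m5, m6⟩ | ⟨m1, m2, m3, m4, m5⟩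
  all_goals
    obtain ⟨p1, p2⟩ := L.par_sub_one_lt hc m1
    obtain ⟨q1, q2⟩ := L.par_sub_one_lt hd m2
    have hkc := h.kid_of_par hc p2 (by omega)
    have hkd := h.kid_of_par hd q2 (by omega)
  · split_ifs at hab with hcon
    -- Contravariance: the parent of `d` is on the left here, so the requirement reads off as `c ≤
    -- d`.
    · obtain ⟨rfl, rfl⟩ := (pair_inj hb p1).1 hab
      have hs := h.stepRel ha hb hha hhb (by omega) hs
      obtain ⟨h1, h2⟩ := h.tagOf_ty _ ha hha.2
      have := hs.comp (by omega) _ _ _ hkd (m6 ▸ hkc)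
      rwa [if_pos (by rw [h1, h2]; exact ⟨by have := hcon.1; omega, by have := hcon.2; omega⟩)]
        at this
    · obtain ⟨rfl, rfl⟩ := (pair_inj hb q1).1 hab
      have hs := h.stepRel ha hb hha hhb (by omega) hs
      obtain ⟨h1, h2⟩ := h.tagOf_ty _ ha hha.2
      have := hs.comp (by omega) _ _ _ hkc (m6 ▸ hkd)
      rwa [if_neg (by rw [h1, h2]; exact hcon)] at this
  · rw [if_neg (by rintro ⟨hcon, -⟩; omega)] at hab
    obtain ⟨rfl, rfl⟩ := (pair_inj hb q1).1 hab
    have hs := h.stepRel ha hb hha hhb (by omega) hs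
    obtain ⟨h1, h2⟩ := h.tagOf_ty _ ha hha.2
    rcases m4 with m4 | m4
    · obtain ⟨A, hA, hl, hs⟩ := hs.sel (by omega) _ (List.mem_of_getElem? hkd)
      obtain ⟨k, hk⟩ := List.mem_iff_getElem?.1 hA
      obtain ⟨c', hc', hcq, -, rfl⟩ := h.exists_of_kid p1 (by omega) hk
      rwa [h.eq_of_lab hc' hc hcq p2 (by omega) (hl.trans m5.symm)] at hs
    · obtain ⟨B, hB, hl, hs⟩ := hs.bra (by omega) _ (List.mem_of_getElem? hkc)
      obtain ⟨k, hk⟩ := List.mem_iff_getElem?.1 hB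
      obtain ⟨d', hd', hdq, -, rfl⟩ := h.exists_of_kid q1 (by omega) hk
      rwa [h.eq_of_lab hd' hd hdq q2 (by omega) (hl.symm.trans m5)] at hs

theorem not_subtypeOf_of_fails {v : ℕ} (hv : L.Fails v) : ∀ a < L.n, ∀ b < L.n, L.Headed a →
    L.Headed b → v = a * L.n + b → ¬ SubtypeOf (ty a) (ty b) := by
  induction hv with
  | init _ hv =>
    rintro a ha b hb hha hhb rfl
    rcases hv with hv | ⟨c, hc, q, hq, hm, hv⟩
    · rw [(pair_div hb).1, (pair_div hb).2] at hv
      exact h.not_subtypeOf_of_clash ha hb hha hhb hv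
    · exact h.not_subtypeOf_of_missing ha hb hha hhb hc hq hm hv
  | @step e he _ ih =>
    intro a ha b hb hha hhb hab
    have hn : 0 < L.n := by omega
    have hc : e / L.n < L.n := Nat.div_lt_of_lt_mul he
    have hd : e % L.n < L.n := Nat.mod_lt _ hn
    obtain ⟨c1, c2, -⟩ := h.head_spec _ hc
    obtain ⟨d1, d2, -⟩ := h.head_spec _ hd
    by_cases hm : L.PosMatch (e / L.n) (e % L.n) ∨ L.LabMatch (e / L.n) (e % L.n)
    · refine h.not_subtypeOf_of_parPair ha hb hha hhb hc hd hm hab.symm ?_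
      rw [← h.subtypeOf_head hc hd]
      exact ih _ c1 _ d1 c2 d2 rfl
    -- The edge of a pair that is no pair of components is a loop, so nothing new is claimed.
    · rw [edgeDst, parPair, if_neg hm] at hab
      exact ih a ha b hb hha hhb hab

/-- Coinduction: a pair that is not reachable has neither a clash nor a missing label, and none of
its component pairs is reachable, for their edges lead back to it. -/
theorem isSubtypingRel_not_fails : IsSubtypingRel fun A B => ∃ i < L.n, ∃ j < L.n,
    A = ty i ∧ B = ty j ∧ ¬ L.Fails (L.head i * L.n + L.head j) := by
  rw [isSubtypingRel_iff]
  rintro _ _ ⟨i, hi, j, hj, rfl, rfl, hf⟩ V hV h6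
  obtain ⟨ha, hha, hia⟩ := h.head_spec i hi
  obtain ⟨hb, hhb, hjb⟩ := h.head_spec j hj
  rw [hia, h.unfolds_iff ha hha] at hV
  subst hV
  refine ⟨ty (L.head j), (hjb _).2 ((h.unfolds_iff hb hhb _).2 rfl), ?_⟩
  generalize L.head i = a at *
  generalize L.head j = b at *
  obtain ⟨a1, a2⟩ := h.tagOf_ty a ha hha.2
  obtain ⟨b1, b2⟩ := h.tagOf_ty b hb hhb.2
  rw [a1] at h6
  have hbad : ¬ L.Bad (a * L.n + b) := fun hbad => hf (.init (pair_lt ha hb) hbad)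
  have hclash : ¬ L.Clash a b := fun hc => hbad (.inl (by
    rwa [(pair_div hb).1, (pair_div hb).2]))
  have htag : L.tag a = L.tag b := by
    by_contra hne
    exact hclash ⟨h6, .inl hne⟩
  have harg : L.tag a = 1 ∨ L.tag a = 2 → L.arg a = L.arg b := by
    intro ht
    by_contra hne
    exact hclash ⟨h6, .inr ⟨ht, hne⟩⟩
  have hlab : ∀ c d, c < L.n → d < L.n → L.par c = a + 1 → L.par d = b + 1 → L.LabMatch c d →
      ¬ L.Fails (L.head c * L.n + L.head d) := by
    intro c d hc hd hca hdb hm hcd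
    have := Fails.pair hc hd hcd
    have h34 := hm.2.2.2.1
    rw [parPair, if_pos (.inr hm), if_neg, hca, hdb] at this
    · exact hf this
    · rintro ⟨hcon, -⟩
      omega
  constructor
  · rw [a1, b1, htag]
  · rwa [a1, a2, b2]
  · rw [a1, a2]
    intro ht k A B hA hB
    obtain ⟨c, hc, hca, hck, rfl⟩ := h.exists_of_kid ha (by omega) hA
    obtain ⟨d, hd, hdb, hdk, rfl⟩ := h.exists_of_kid hb (by omega) hB
    have hpc : L.par c - 1 = a := by omega
    have hpd : L.par d - 1 = b := by omega
    have harg := harg ht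
    split_ifs with hsw
    -- For payloads of outputs the pair to consider is `d`, `c`, whose edge exchanges the parents
    -- back to `a`, `b`.
    · refine ⟨d, hd, c, hc, rfl, rfl, fun hdc => hf ?_⟩
      have := Fails.pair hd hc hdc
      rwa [parPair, if_pos (.inl ⟨by omega, by omega, by rw [hpc, hpd, htag], by rw [hpd]; omega,
        by rw [hpc, hpd, harg], by omega⟩), if_pos ⟨by rw [hpd]; omega, by rw [hpd]; omega⟩,
        hpc, hpd] at this
    · refine ⟨c, hc, d, hd, rfl, rfl, fun hcd => hf ?_⟩
      have := Fails.pair hc hd hcd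
      rwa [parPair, if_pos (.inl ⟨by omega, by omega, by rw [hpc, hpd, htag], by rw [hpc]; omega,
        by rw [hpc, hpd, harg], by omega⟩), if_neg (by rw [Contra, hpc, hck]; exact hsw),
        hpc, hpd] at this
  · rw [a1]
    intro ht B hB
    obtain ⟨k, hk⟩ := List.mem_iff_getElem?.1 hB
    obtain ⟨d, hd, hdb, -, rfl⟩ := h.exists_of_kid hb (by omega) hk
    have hpd : L.par d - 1 = b := by omega
    by_cases hm : L.Missing d a
    · refine absurd (.inr ⟨d, hd, a, ha, hm, ?_⟩) hbad
      rw [target, if_neg (by omega), hpd]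
    · obtain ⟨c, hc, hdc, hca⟩ : ∃ c < L.n, L.LabMatch d c ∧ L.par c = a + 1 := by
        by_contra hno
        exact hm ⟨by omega, by rw [hpd, htag], by omega, hno⟩
      exact ⟨_, List.mem_of_getElem? (h.kid_of_par hc hca (by omega)), hdc.symm.2.2.2.2, c, hc, d,
        hd, rfl, rfl, hlab c d hc hd hca hdb hdc.symm⟩
  · rw [a1]
    intro ht A hA
    obtain ⟨k, hk⟩ := List.mem_iff_getElem?.1 hA
    obtain ⟨c, hc, hca, -, rfl⟩ := h.exists_of_kid ha (by omega) hk
    have hpc : L.par c - 1 = a := by omega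
    by_cases hm : L.Missing c b
    · refine absurd (.inr ⟨c, hc, b, hb, hm, ?_⟩) hbad
      rw [target, if_pos (by omega), hpc]
    · obtain ⟨d, hd, hcd, hdb⟩ : ∃ d < L.n, L.LabMatch c d ∧ L.par d = b + 1 := by
        by_contra hno
        exact hm ⟨by omega, by rw [hpc, htag], by omega, hno⟩
      exact ⟨_, List.mem_of_getElem? (h.kid_of_par hd hdb (by omega)), hcd.2.2.2.2, c, hc, d,
        hd, rfl, rfl, hlab c d hc hd hca hdb hcd⟩

theorem subtypeOf_iff {i j : ℕ} (hi : i < L.n) (hj : j < L.n) :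
    SubtypeOf (ty i) (ty j) ↔ ¬ L.Fails (L.head i * L.n + L.head j) := by
  constructor
  · intro hs hf
    obtain ⟨ha, hha, -⟩ := h.head_spec i hi
    obtain ⟨hb, hhb, -⟩ := h.head_spec j hj
    exact h.not_subtypeOf_of_fails hf _ ha _ hb hha hhb rfl ((h.subtypeOf_head hi hj).2 hs)
  · intro hf
    exact ⟨_, h.isSubtypingRel_not_fails, i, hi, j, hj, rfl, rfl, hf⟩

end Typed
end Layout
end SessionTypes

namespace SessionTypes

/-! ### Reasoning about programs -/

@[simp] theorem Store.setReg_arr (s : Store) (x v : ℕ) : (s.setReg x v).arr = s.arr := rfl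
@[simp] theorem Store.setArr_reg (s : Store) (a i v : ℕ) : (s.setArr a i v).reg = s.reg := rfl
@[simp] theorem Store.setReg_reg (s : Store) (x v y : ℕ) :
    (s.setReg x v).reg y = if y = x then v else s.reg y := by
  simp [Store.setReg, Function.update_apply]
@[simp] theorem Store.setArr_arr (s : Store) (a i v b : ℕ) :
    (s.setArr a i v).arr b = if b = a then Function.update (s.arr a) i v else s.arr b := by
  simp [Store.setArr, Function.update_apply]

namespace Prog

/-- The registers that a program may write. -/
def regs : Prog → List ℕ
  | const x _ => [x]
  | copy x _ => [x]
  | inc x => [x]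
  | dec x => [x]
  | load x _ _ _ => [x]
  | seq p q => p.regs ++ q.regs
  | cond _ p q => p.regs ++ q.regs
  | loop _ p => p.regs
  | _ => []

/-- The arrays that a program may write. -/
def arrs : Prog → List ℕ
  | store a _ _ _ => [a]
  | seq p q => p.arrs ++ q.arrs
  | cond _ p q => p.arrs ++ q.arrs
  | loop _ p => p.arrs
  | _ => []

/-- A bound for the running time of a program without loops. -/
def cost : Prog → ℕ
  | seq p q => p.cost + q.cost
  | cond _ p q => p.cost + q.cost + 1
  | _ => 1

/-- The weakest precondition of a program without loops. -/
def wp : Prog → (Store → Prop) → Store → Prop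
  | skip, Q, s => Q s
  | const x k, Q, s => Q (s.setReg x k)
  | copy x y, Q, s => Q (s.setReg x (s.reg y))
  | inc x, Q, s => Q (s.setReg x (s.reg x + 1))
  | dec x, Q, s => Q (s.setReg x (s.reg x - 1))
  | load x a y z, Q, s => Q (s.setReg x (s.arr a (s.reg y + s.reg z)))
  | store a y z x, Q, s => Q (s.setArr a (s.reg y + s.reg z) (s.reg x))
  | seq p q, Q, s => p.wp (q.wp Q) s
  | cond b p q, Q, s => (b.Holds s → p.wp Q s) ∧ (¬ b.Holds s → q.wp Q s)
  | loop _ _, _, _ => False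

/-- Sequential composition of a list of programs. -/
def block : List Prog → Prog
  | [] => skip
  | [p] => p
  | p :: q :: l => seq p (block (q :: l))

/-- `for i = 0, ..., b - 1 do p`, where `i` and `b` are registers. -/
def for_ (i b : ℕ) (p : Prog) : Prog := seq (const i 0) (loop (.lt i b) (seq p (inc i)))

end Prog

open Prog

/-- `s'` differs from `s` only in what `p` may write. -/
structure Frame (p : Prog) (s s' : Store) : Prop where
  reg : ∀ r, r ∉ p.regs → s'.reg r = s.reg r
  arr : ∀ a, a ∉ p.arrs → s'.arr a = s.arr a

theorem Frame.of_subset {p q : Prog} {s s' : Store} (h : Frame p s s') (hr : p.regs ⊆ q.regs)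
    (ha : p.arrs ⊆ q.arrs) : Frame q s s' :=
  ⟨fun r hr' => h.reg r fun h => hr' (hr h), fun a ha' => h.arr a fun h => ha' (ha h)⟩

theorem Frame.trans {p : Prog} {s₁ s₂ s₃ : Store} (h : Frame p s₁ s₂) (h' : Frame p s₂ s₃) :
    Frame p s₁ s₃ :=
  ⟨fun r hr => (h'.reg r hr).trans (h.reg r hr), fun a ha => (h'.arr a ha).trans (h.arr a ha)⟩

/-- Frames carry earlier results through later code without mention in its invariants; the side
conditions concern concrete register and array numbers and are decidable. -/
theorem Exec.frame {p : Prog} {s s' : Store} {t : ℕ} (h : Exec p s t s') : Frame p s s' := by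
  induction h with
  | skip | loopFalse => exact ⟨fun _ _ => rfl, fun _ _ => rfl⟩
  | const | copy | inc | dec | load =>
    refine ⟨fun r hr => ?_, fun _ _ => rfl⟩
    simp only [regs, List.mem_singleton] at hr
    simp [hr]
  | store =>
    refine ⟨fun _ _ => rfl, fun a ha => ?_⟩
    simp only [arrs, List.mem_singleton] at ha
    simp [ha]
  | seq _ _ ih₁ ih₂ =>
    exact (ih₁.of_subset (List.subset_append_left _ _) (List.subset_append_left _ _)).trans
      (ih₂.of_subset (List.subset_append_right _ _) (List.subset_append_right _ _))
  | condTrue _ _ ih =>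
    exact ih.of_subset (List.subset_append_left _ _) (List.subset_append_left _ _)
  | condFalse _ _ ih =>
    exact ih.of_subset (List.subset_append_right _ _) (List.subset_append_right _ _)
  | loopTrue _ _ _ ih₁ ih₂ => exact Frame.trans ⟨ih₁.reg, ih₁.arr⟩ ih₂

/-- Started in `s`, the program `p` halts within `B` steps in a memory that satisfies `Q`. -/
def Runs (p : Prog) (s : Store) (B : ℕ) (Q : Store → Prop) : Prop :=
  ∃ t s', Exec p s t s' ∧ t ≤ B ∧ Q s'

namespace Runs

variable {p q : Prog} {s : Store} {B B' : ℕ} {Q Q' : Store → Prop}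

theorem mono (h : Runs p s B Q) (hB : B ≤ B') (hQ : ∀ s', Frame p s s' → Q s' → Q' s') :
    Runs p s B' Q' := by
  obtain ⟨t, s', h1, h2, h3⟩ := h
  exact ⟨t, s', h1, h2.trans hB, hQ s' h1.frame h3⟩

theorem seq (h : Runs p s B Q) (h' : ∀ s', Frame p s s' → Q s' → Runs q s' B' Q') :
    Runs (.seq p q) s (B + B') Q' := by
  obtain ⟨t, s₁, h1, h2, h3⟩ := h
  obtain ⟨t', s₂, k1, k2, k3⟩ := h' s₁ h1.frame h3
  exact ⟨_, _, h1.seq k1, Nat.add_le_add h2 k2, k3⟩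

theorem of_wp (h : p.wp Q s) : Runs p s p.cost Q := by
  induction p generalizing s Q with
  | skip => exact ⟨1, _, .skip s, le_rfl, h⟩
  | const x k => exact ⟨1, _, .const s x k, le_rfl, h⟩
  | copy x y => exact ⟨1, _, .copy s x y, le_rfl, h⟩
  | inc x => exact ⟨1, _, .inc s x, le_rfl, h⟩
  | dec x => exact ⟨1, _, .dec s x, le_rfl, h⟩
  | load x a y z => exact ⟨1, _, .load s x a y z, le_rfl, h⟩
  | store a y z x => exact ⟨1, _, .store s a y z x, le_rfl, h⟩
  | seq p q ihp ihq => exact (ihp h).seq fun s' _ h' => ihq h'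
  | cond b p q ihp ihq =>
    by_cases hb : b.Holds s
    · obtain ⟨t, s', h1, h2, h3⟩ := ihp (h.1 hb)
      exact ⟨_, _, .condTrue hb h1, by simp only [cost]; omega, h3⟩
    · obtain ⟨t, s', h1, h2, h3⟩ := ihq (h.2 hb)
      exact ⟨_, _, .condFalse hb h1, by simp only [cost]; omega, h3⟩
  | loop => exact h.elim

theorem of_wp_le (hB : p.cost ≤ B) (h : p.wp Q s) : Runs p s B Q :=
  (of_wp h).mono hB fun _ _ h => h

/-- A round costs `c` for the body and one step each for the increment and the test; the final `2`
pays for the initialisation and the failing test. -/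
theorem for_ {i b N c : ℕ} {I : ℕ → Store → Prop} (hN : s.reg b = N)
    (hi : i ∉ p.regs) (hb : b ∉ p.regs) (hib : b ≠ i) (h0 : I 0 (s.setReg i 0))
    (hs : ∀ k < N, ∀ s', s'.reg i = k → Frame (.for_ i b p) s s' → I k s' →
      Runs p s' c fun s'' => I (k + 1) (s''.setReg i (k + 1))) :
    Runs (.for_ i b p) s ((c + 2) * N + 2) (I N) := by
  have key : ∀ m k s', m + k = N → s'.reg i = k → Frame (.for_ i b p) s s' → I k s' →
      Runs (.loop (.lt i b) (.seq p (.inc i))) s' ((c + 2) * m + 1) (I N) := by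
    intro m
    induction m with
    | zero =>
      intro k s' hk hik hf hI
      obtain rfl : k = N := by omega
      refine ⟨1, s', .loopFalse ?_, by omega, hI⟩
      simp only [Test.Holds, hik]
      rw [hf.reg b (by simp [Prog.for_, regs, hb, hib]), hN]
      omega
    | succ m ih =>
      intro k s' hk hik hf hI
      obtain ⟨t, s₁, h1, h2, h3⟩ := hs k (by omega) s' hik hf hI
      have hi1 : s₁.reg i = k := (h1.frame.reg i hi).trans hik
      have hinc := Exec.inc s₁ i
      rw [hi1] at hinc
      have hf1 : Frame (.for_ i b p) s (s₁.setReg i (k + 1)) :=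
        hf.trans ((h1.seq hinc).frame.of_subset (by simp [Prog.for_, regs])
          (by simp [Prog.for_, arrs]))
      obtain ⟨t', s₂, k1, k2, k3⟩ := ih (k + 1) _ (by omega) (by simp) hf1 h3
      refine ⟨_, _, .loopTrue ?_ (h1.seq hinc) k1, ?_, k3⟩
      · simp only [Test.Holds, hik]
        rw [hf.reg b (by simp [Prog.for_, regs, hb, hib]), hN]
        omega
      · rw [Nat.mul_succ]
        omega
  have h := Exec.const s i 0
  have hf : Frame (.for_ i b p) s (s.setReg i 0) :=
    h.frame.of_subset (by simp [Prog.for_, regs]) (by simp [arrs])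
  obtain ⟨t, s₁, h1, h2, h3⟩ := key N 0 _ (by omega) (by simp) hf h0
  exact ⟨_, _, h.seq h1, by omega, h3⟩

/-- A loop over all pairs, with a running index for the pairs. -/
theorem for_pairs {i j b x n c : ℕ} {I : ℕ → Store → Prop} (hN : s.reg b = n)
    (hi : i ∉ p.regs) (hj : j ∉ p.regs) (hx : x ∉ p.regs) (hb : b ∉ p.regs)
    (hne : [b, i, j, x].Nodup)
    (hI : ∀ k s r v, r = i ∨ r = j ∨ r = x → I k s → I k (s.setReg r v))
    (h0 : I 0 s)
    (hs : ∀ k < n, ∀ l < n, ∀ s', s'.reg i = k → s'.reg j = l → s'.reg x = k * n + l →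
      Frame (.seq (.const x 0) (.for_ i b (.for_ j b (.seq p (.inc x))))) s s' →
      I (k * n + l) s' → Runs p s' c (I (k * n + l + 1))) :
    Runs (.seq (.const x 0) (.for_ i b (.for_ j b (.seq p (.inc x))))) s
      ((((c + 3) * n + 4) * n) + 3) fun s' => s'.reg x = n * n ∧ I (n * n) s' := by
  simp only [List.nodup_cons, List.mem_cons, List.not_mem_nil, or_false, not_or, not_false_eq_true,
    and_true, List.nodup_nil] at hne
  obtain ⟨⟨hbi, hbj, hbx⟩, ⟨hij, hix⟩, hjx⟩ := hne
  set P : Prog := .seq (.const x 0) (.for_ i b (.for_ j b (.seq p (.inc x)))) with hP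
  -- One step initialises `x`. The increment of `x` raises the cost of the inner body to `c + 1`,
  -- and each of the two loops then adds the overhead of `Runs.for_`.
  rw [show (((c + 3) * n + 4) * n) + 3 = 1 + ((((c + 3) * n + 4) * n) + 2) by omega]
  refine Runs.seq (Q := fun s' => s'.reg x = 0 ∧ I 0 s')
    ⟨1, _, Exec.const s x 0, le_rfl, by simp, hI _ _ _ _ (by simp) h0⟩ fun s₁ hf₁ h₁ => ?_
  have hf₁ : Frame P s s₁ := hf₁.of_subset (by simp [hP, regs]) (by simp [hP, arrs])
  have hb₁ : s₁.reg b = n := by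
    rw [hf₁.reg b (by simp [hP, Prog.for_, regs, hb, hbi, hbj, hbx]), hN]
  refine (Runs.for_ (c := (c + 3) * n + 2) (I := fun k s' => s'.reg x = k * n ∧ I (k * n) s') hb₁
    (by simp [Prog.for_, regs, hi, hij, hix]) (by simp [Prog.for_, regs, hb, hbj, hbx]) hbi ?_ ?_).mono
    le_rfl fun s' _ h => h
  · simp only [Store.setReg_reg, zero_mul]
    rw [if_neg (Ne.symm hix)]
    exact ⟨h₁.1, hI _ _ _ _ (by simp) h₁.2⟩
  intro k hk s₂ hi₂ hf₂ h₂
  have hf₂ : Frame P s s₂ :=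
    hf₁.trans (hf₂.of_subset (by simp [hP, regs]) (by simp [hP, arrs]))
  have hb₂ : s₂.reg b = n := by
    rw [hf₂.reg b (by simp [hP, Prog.for_, regs, hb, hbi, hbj, hbx]), hN]
  refine (Runs.for_ (c := c + 1)
    (I := fun l s' => s'.reg x = k * n + l ∧ I (k * n + l) s') hb₂
    (by simp [regs, hj, hjx]) (by simp [regs, hb, hbx]) hbj ?_ ?_).mono
    le_rfl fun s' _ h => ?_
  · simp only [Store.setReg_reg, add_zero]
    rw [if_neg (Ne.symm hjx)]
    exact ⟨h₂.1, hI _ _ _ _ (by simp) h₂.2⟩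
  · intro l hl s₃ hj₃ hf₃ h₃
    have hi₃ : s₃.reg i = k := by
      rw [hf₃.reg i (by simp [Prog.for_, regs, hi, hij, hix]), hi₂]
    have hf₃ : Frame P s s₃ :=
      hf₂.trans (hf₃.of_subset
        (fun r => by simp only [hP, Prog.for_, regs, List.mem_append]; tauto)
        (fun a => by simp only [hP, Prog.for_, arrs, List.mem_append]; tauto))
    refine (hs k hk l hl s₃ hi₃ hj₃ h₃.1 hf₃ h₃.2).seq fun s₄ hf₄ h₄ => ?_
    refine ⟨1, _, Exec.inc s₄ x, le_rfl, ?_, hI _ _ _ _ (by simp) (hI _ _ _ _ (by simp) h₄)⟩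
    simp only [Store.setReg_reg]
    rw [if_neg (Ne.symm hjx), if_pos trivial, hf₄.reg x hx, h₃.1]
    rfl
  · simp only [Store.setReg_reg]
    rw [if_neg (Ne.symm hix), Nat.succ_mul]
    exact ⟨h.1, hI _ _ _ _ (by simp) h.2⟩

end Runs
end SessionTypes

namespace SessionTypes
open Prog SType

/-! ### The program -/

/-- Register `k + 1` is loaded with the constant `k`. -/
def initProg : Prog :=
  block [.const 1 0, .const 2 1, .const 3 2, .const 4 3, .const 5 4, .const 6 5, .const 7 6]

/-- The input and the constants are in place. -/
structure Basic (L : Layout) (s : Store) : Prop where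
  n : s.reg 0 = L.n
  c0 : s.reg 1 = 0
  c1 : s.reg 2 = 1
  c2 : s.reg 3 = 2
  c3 : s.reg 4 = 3
  c4 : s.reg 5 = 4
  c5 : s.reg 6 = 5
  c6 : s.reg 7 = 6
  tag : ∀ i, s.arr 0 i = L.tag i
  arg : ∀ i, s.arr 1 i = L.arg i
  lab : ∀ i, s.arr 2 i = L.lab i

variable {L : Layout} {s s' : Store}

/-- Registers below `8` and arrays below `3` hold constants and input and are never written again.
Of the other arrays, `3` is for the output, `4` to `9` describe nodes (subtree end, parent,
position, chain end, binder, head), `10` and `12` replace arithmetic, `11` and `13` are marks for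
labels, and `14` to `19` hold the graph and its search. -/
theorem Basic.of_frame {p : Prog} (h : Basic L s) (hf : Frame p s s')
    (hr : ∀ r ∈ p.regs, 8 ≤ r := by decide) (ha : ∀ a ∈ p.arrs, 3 ≤ a := by decide) :
    Basic L s' := by
  have hr' : ∀ r < 8, s'.reg r = s.reg r :=
    fun r h8 => hf.reg r fun hm => absurd (hr r hm) (by omega)
  have ha' : ∀ a < 3, s'.arr a = s.arr a :=
    fun a h3 => hf.arr a fun hm => absurd (ha a hm) (by omega)
  constructor
  · rw [hr' 0 (by omega), h.n]
  · rw [hr' 1 (by omega), h.c0]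
  · rw [hr' 2 (by omega), h.c1]
  · rw [hr' 3 (by omega), h.c2]
  · rw [hr' 4 (by omega), h.c3]
  · rw [hr' 5 (by omega), h.c4]
  · rw [hr' 6 (by omega), h.c5]
  · rw [hr' 7 (by omega), h.c6]
  · rw [ha' 0 (by omega)]; exact h.tag
  · rw [ha' 1 (by omega)]; exact h.arg
  · rw [ha' 2 (by omega)]; exact h.lab

/-- Read the node below node `reg 8`: its arity goes to register `22`. -/
def readNode : Prog :=
  block [.dec 8, .load 20 0 8 1, .load 21 1 8 1, .copy 23 8, .inc 23, .copy 24 23,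
    .cond (.eq 20 2) (.seq (.copy 22 21) (.inc 22)) <|
    .cond (.eq 20 3) (.seq (.copy 22 21) (.inc 22)) <|
    .cond (.eq 20 4) (.copy 22 21) <|
    .cond (.eq 20 5) (.copy 22 21) <|
    .cond (.eq 20 6) (.const 22 1) (.const 22 0)]

/-- Record the parent and the index of the child in register `23`, and go to the next child. -/
def linkChild : Prog := block [.store 5 23 1 24, .store 6 23 1 10, .load 23 4 23 1]

/-- Record the end of the subtree and of the chain of binders. -/
def closeNode : Prog :=
  block [.store 4 8 1 23,
    .cond (.eq 20 6) (.seq (.load 25 7 8 2) (.store 7 8 1 25)) (.store 7 8 1 8)]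

/-- Compute the tree structure, from right to left. -/
def parseProg : Prog :=
  .seq (.copy 8 0) (.for_ 9 0 (.seq readNode (.seq (.for_ 10 22 linkChild) closeNode)))

theorem runs_readNode (h : Basic L s) {i : ℕ} (hi : s.reg 8 = i + 1) :
    Runs readNode s 30 fun s' => s'.reg 8 = i ∧ s'.reg 20 = L.tag i ∧
      s'.reg 22 = arity (L.tag i) (L.arg i) ∧ s'.reg 23 = i + 1 ∧ s'.reg 24 = i + 1 := by
  refine Runs.of_wp_le (by decide) ?_
  simp only [readNode, block, wp, Test.Holds, Store.setReg_reg, Store.setReg_arr, h.c0, h.c1, h.c2,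
    h.c3, h.c4, h.c5, hi, h.tag, h.arg, arity]
  simp +contextual

/-- The nodes from `m` on have been parsed. -/
structure ParseInv (L : Layout) (m : ℕ) (s : Store) : Prop where
  fin : ∀ i < L.n, m ≤ i → s.arr 4 i = L.fin i
  par : ∀ c < L.n, s.arr 5 c = if m < L.par c then L.par c else 0
  pos : ∀ c < L.n, m < L.par c → s.arr 6 c = L.pos c
  chainEnd : ∀ i < L.n, m ≤ i → s.arr 7 i = L.chainEnd i

/-- The first `k` children of node `i` have been linked. -/
structure LinkInv (L : Layout) (i k : ℕ) (s : Store) : Prop where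
  next : s.reg 23 = L.child i k
  par : ∀ c < L.n, s.arr 5 c =
    if i + 1 < L.par c ∨ L.par c = i + 1 ∧ L.pos c < k then L.par c else 0
  pos : ∀ c < L.n, i + 1 < L.par c ∨ L.par c = i + 1 ∧ L.pos c < k → s.arr 6 c = L.pos c

theorem runs_linkChild (h : Basic L s) {i k : ℕ} (hi : i < L.n)
    (hk : k < arity (L.tag i) (L.arg i)) (h10 : s.reg 10 = k) (h24 : s.reg 24 = i + 1)
    (hfin : ∀ j < L.n, i < j → s.arr 4 j = L.fin j) (hI : LinkInv L i k s) :
    Runs linkChild s 3 fun s' => LinkInv L i (k + 1) s' := by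
  obtain ⟨c1, c2, c3, c4⟩ := L.child_lt i hi k hk
  -- The node being linked is the only one whose status changes in this round.
  have key : ∀ c < L.n, c ≠ L.child i k →
      (i + 1 < L.par c ∨ L.par c = i + 1 ∧ L.pos c < k + 1 ↔
        i + 1 < L.par c ∨ L.par c = i + 1 ∧ L.pos c < k) := by
    intro c hc hne
    constructor
    · rintro (h | ⟨h, h'⟩)
      · exact .inl h
      · refine .inr ⟨h, lt_of_le_of_ne (by omega) fun hp => hne ?_⟩
        rw [← hp, (L.of_par c hc i h).2.2]
    · rintro (h | ⟨h, h'⟩)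
      exacts [.inl h, .inr ⟨h, by omega⟩]
  refine Runs.of_wp_le (by decide) ?_
  simp only [linkChild, block, wp, Store.setArr_reg, Store.setArr_arr, h.c0, h10, h24, hI.next, add_zero]
  constructor
  · simp [hfin _ c2 c1, L.child_succ i hi k hk]
  · intro c hc
    by_cases hck : c = L.child i k
    · subst hck
      simp [c3, c4]
    · rw [if_congr (key c hc hck) rfl rfl]
      simp [hck, hI.par c hc]
  · intro c hc hp
    by_cases hck : c = L.child i k
    · subst hck
      simp [c4]
    · simp [hck, hI.pos c hc ((key c hc hck).1 hp)]

theorem runs_closeNode (h : Basic L s) {i : ℕ} (hi : i < L.n) (h8 : s.reg 8 = i)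
    (h20 : s.reg 20 = L.tag i) (hI : LinkInv L i (arity (L.tag i) (L.arg i)) s)
    (hfin : ∀ j < L.n, i < j → s.arr 4 j = L.fin j)
    (hend : ∀ j < L.n, i < j → s.arr 7 j = L.chainEnd j) :
    Runs closeNode s 6 fun s' => ParseInv L i s' := by
  refine Runs.of_wp_le (by decide) ?_
  have key : ∀ c < L.n, (i + 1 < L.par c ∨ L.par c = i + 1 ∧ L.pos c < arity (L.tag i) (L.arg i) ↔
      i < L.par c) := by
    intro c hc
    constructor
    · rintro (h | ⟨h, -⟩) <;> omega
    · intro h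
      by_cases hp : L.par c = i + 1
      · exact .inr ⟨hp, (L.of_par c hc i hp).2.1⟩
      · exact .inl (by omega)
  have hpar : ∀ c < L.n, s.arr 5 c = if i < L.par c then L.par c else 0 := fun c hc => by
    rw [hI.par c hc, if_congr (key c hc) rfl rfl]
  have hpos : ∀ c < L.n, i < L.par c → s.arr 6 c = L.pos c := fun c hc hp =>
    hI.pos c hc ((key c hc).2 hp)
  have hfin' : ∀ j < L.n, i ≤ j → Function.update (s.arr 4) i (s.reg 23) j = L.fin j := by
    intro j hj hij
    by_cases hji : j = i
    · subst hji
      simp [hI.next, L.child_arity j hj]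
    · simp [hji, hfin j hj (by omega)]
  have hend' : ∀ e, e = L.chainEnd i → ∀ j < L.n, i ≤ j →
      Function.update (s.arr 7) i e j = L.chainEnd j := by
    rintro _ rfl j hj hij
    by_cases hji : j = i
    · subst hji
      simp
    · simp [hji, hend j hj (by omega)]
  simp only [closeNode, block, wp, Test.Holds, Store.setReg_reg, Store.setArr_reg,
    Store.setArr_arr, h.c0, h.c1, h.c5, h8, h20, add_zero]
  refine ⟨fun ht => ?_, fun ht => ?_⟩
  · have hlt := L.child_lt i hi 0 (by simp [arity, ht])
    rw [L.child_zero i hi] at hlt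
    refine ⟨by simpa using hfin', by simpa using hpar, by simpa using hpos, ?_⟩
    -- The program reads the entry of node `i + 1`, which is already there because nodes are parsed
    -- from right to left.
    simpa using hend' _ (by rw [hend _ hlt.2.1 (by omega), Layout.chainEnd.eq_def L i, if_pos ⟨ht, hi⟩])
  · refine ⟨by simpa using hfin', by simpa using hpar, by simpa using hpos, ?_⟩
    simpa using hend' i (by rw [Layout.chainEnd, if_neg fun h => ht h.1])

/-- When a node is reached from the right, the ends of all subtrees after it are known, so its
children can be enumerated: the first is the next node, and each further one starts where its
predecessor ends. The arity is at most `n`, which is enough for a quadratic bound. -/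
theorem runs_parseProg (h : Basic L s) (h0 : ∀ a, 3 ≤ a → ∀ i, s.arr a i = 0) :
    Runs parseProg s ((30 + (((3 + 2) * L.n + 2) + 6) + 2) * L.n + 2 + 1)  fun s' => ParseInv L 0 s' := by
  refine (Runs.seq (Q := fun s' => s'.reg 8 = L.n) (Runs.of_wp ?_) fun s₁ hf₁ h₁ => ?_).mono
    (B := 1 + ((30 + (((3 + 2) * L.n + 2) + 6) + 2) * L.n + 2)) (by omega) fun _ _ h => h
  · simp [wp, h.n]
  have hb₁ : Basic L s₁ := h.of_frame hf₁
  refine (Runs.for_ (I := fun k s => s.reg 8 = L.n - k ∧ ParseInv L (L.n - k) s) hb₁.n (by decide)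
    (by decide) (by decide) ?_ ?_).mono le_rfl fun s' _ h => ?_
  · refine ⟨by simpa using h₁, fun i _ _ => by omega, fun c hc => ?_, fun c hc hp => ?_,
      fun i _ _ => by omega⟩
    · have := L.par_le c
      rw [if_neg (by omega), Store.setReg_arr, hf₁.arr 5 (by decide), h0 5 (by omega)]
    · have := L.par_le c
      omega
  · rintro k hk s₂ - hf₂ ⟨h8, hI⟩
    have hb₂ : Basic L s₂ := hb₁.of_frame hf₂
    obtain ⟨i, hi⟩ : ∃ i, L.n - k = i + 1 := ⟨L.n - k - 1, by omega⟩
    have hi' : L.n - (k + 1) = i := by omega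
    rw [hi] at h8 hI
    have hin : i < L.n := by omega
    rw [hi']
    refine Runs.seq (runs_readNode hb₂ h8) fun s₃ hf₃ ⟨r8, r20, r22, r23, r24⟩ => ?_
    have hb₃ : Basic L s₃ := hb₂.of_frame hf₃
    have h4 := hf₃.arr 4 (by decide)
    have h5 := hf₃.arr 5 (by decide)
    have h6 := hf₃.arr 6 (by decide)
    have h7 := hf₃.arr 7 (by decide)
    have har := L.arity_le i hin
    refine Runs.seq (B := (3 + 2) * L.n + 2) ((Runs.for_ (I := LinkInv L i) r22 (by decide) (by decide)
      (by decide) ?_ ?_).mono (by gcongr) fun _ _ h => h) fun s₄ hf₄ h₄ => ?_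
    · constructor
      · simp [r23, L.child_zero i hin]
      · simp [h5]
        exact hI.par
      · simp [h6]
        exact hI.pos
    · intro l hl s₄ h10 hf₄ hI₄
      refine (runs_linkChild (hb₃.of_frame hf₄) hin hl h10 ?_ ?_ hI₄).mono le_rfl fun s' _ h => ?_
      · rw [hf₄.reg 24 (by decide), r24]
      · rw [hf₄.arr 4 (by decide), h4]
        exact fun j hj hij => hI.fin j hj hij
      · exact ⟨by simpa using h.next, h.par, h.pos⟩
    · have h4' := hf₄.arr 4 (by decide)
      have h7' := hf₄.arr 7 (by decide)
      have h8' := hf₄.reg 8 (by decide)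
      refine (runs_closeNode (hb₃.of_frame hf₄) hin (h8'.trans r8)
        ((hf₄.reg 20 (by decide)).trans r20) h₄ ?_ ?_).mono le_rfl
        fun s' hf h => ⟨?_, h.fin, h.par, h.pos, h.chainEnd⟩
      · rw [h4', h4]
        exact fun j hj hij => hI.fin j hj hij
      · rw [h7', h7]
        exact fun j hj hij => hI.chainEnd j hj hij
      · simp [hf.reg 8 (by decide), h8', r8]
  · simpa using h.2

end SessionTypes

/-! ### Computing binders, heads and multiples of `n` -/

namespace SessionTypes
open Prog SType

variable {L : Layout} {s s' : Store} {ty : ℕ → SType}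

/-- Go from node `reg 21 - 1` to its parent, unless it binds the variable in register `20`. -/
def climb : Prog :=
  .cond (.eq 21 1) .skip (block [.copy 22 21, .dec 22, .load 23 0 22 1,
    .cond (.eq 23 6)
      (.seq (.load 24 1 22 1) (.cond (.eq 24 20) .skip (.load 21 5 22 1)))
      (.load 21 5 22 1)])

/-- Find the binders of all variables. -/
def bindProg : Prog :=
  .for_ 8 0 (.seq (.seq (.load 20 1 8 1) (.load 21 5 8 1)) (.seq (.for_ 9 0 climb) (.store 8 8 1 21)))

/-- The state of the search for the binder of `X` after `k` steps. -/
structure ClimbInv (L : Layout) (X b k : ℕ) (s : Store) : Prop where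
  look : L.look X (s.reg 21) = b
  le : s.reg 21 ≤ L.n
  done : s.reg 21 + k ≤ L.n ∨ s.reg 21 = b

theorem runs_climb (h : Basic L s) {X b k : ℕ} (hpar : ∀ i < L.n, s.arr 5 i = L.par i)
    (h20 : s.reg 20 = X) (hI : ClimbInv L X b k s) :
    Runs climb s 20 fun s' => ClimbInv L X b (k + 1) s' := by
  refine Runs.of_wp_le (by decide) ?_
  simp only [climb, block, wp, Test.Holds, Store.setReg_reg, Store.setReg_arr, h.c0, h.c5, h20,
    h.tag, h.arg]
  obtain ⟨h1, h2, h3⟩ := hI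
  cases hx : s.reg 21 with
  | zero =>
    rw [hx, Layout.look] at h1
    refine ⟨fun _ => ⟨by rw [hx, Layout.look]; exact h1, by omega, by omega⟩, by simp⟩
  | succ p =>
    rw [hx, Layout.look] at h1
    have hp := L.par_le p
    simp only [Nat.add_eq_zero_iff, one_ne_zero, and_false, false_imp_iff, not_false_eq_true,
      true_imp_iff, true_and, if_true, if_false, add_tsub_cancel_right, Nat.reduceEqDiff, add_zero]
    rw [hpar p (by omega)]
    refine ⟨fun h5 => ⟨fun hX => ?_, fun hX => ?_⟩, fun h5 => ?_⟩
    · rw [if_pos ⟨h5, hX⟩] at h1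
      constructor <;> simp [hx, Layout.look, h5, hX] <;> omega
    · rw [if_neg (by tauto)] at h1
      -- The binder is at most `L.par p`, so the search was not finished yet, and moving to the
      -- parent is real progress.
      have hpb : p + 1 ≠ b := fun he => by
        have := L.look_le X (L.par p)
        omega
      constructor <;> simp [h1] <;> omega
    · rw [if_neg (by tauto)] at h1
      have hpb : p + 1 ≠ b := fun he => by
        have := L.look_le X (L.par p)
        omega
      constructor <;> simp [h1] <;> omega

/-- Every unfinished round lowers register `21`, which starts at most at `n`, so `n` rounds suffice;
once the binder or `0` is reached, further rounds change nothing. -/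
theorem runs_bindProg (h : Basic L s) (hpar : ∀ i < L.n, s.arr 5 i = L.par i) :
    Runs bindProg s ((2 + (((20 + 2) * L.n + 2) + 1) + 2) * L.n + 2)
      fun s' => ∀ i < L.n, s'.arr 8 i = L.binder i := by
  refine (Runs.for_ (I := fun k s => ∀ i < L.n, i < k → s.arr 8 i = L.binder i) h.n (by decide)
    (by decide) (by decide) (by simp) ?_).mono le_rfl fun s' _ h i hi => h i hi hi
  intro i hi s₁ h8 hf₁ hI
  have hb₁ := h.of_frame hf₁
  have hpar₁ : ∀ i < L.n, s₁.arr 5 i = L.par i := by rwa [hf₁.arr 5 (by decide)]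
  refine Runs.seq (Q := fun s => s.reg 20 = L.arg i ∧ s.reg 21 = L.par i)
    (Runs.of_wp_le (by decide) ?_) fun s₂ hf₂ ⟨r20, r21⟩ => ?_
  · simp [wp, hb₁.c0, h8, hb₁.arg, hpar₁ i hi]
  have hb₂ := hb₁.of_frame hf₂
  have hpar₂ : ∀ i < L.n, s₂.arr 5 i = L.par i := by rwa [hf₂.arr 5 (by decide)]
  refine Runs.seq (Runs.for_ (I := ClimbInv L (L.arg i) (L.binder i)) hb₂.n (by decide)
    (by decide) (by decide) ?_ ?_) fun s₃ hf₃ h₃ => ?_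
  · have := L.par_le i
    constructor <;> simp [r21, Layout.binder] <;> omega
  · intro k _ s₃ _ hf₃ hI₃
    refine (runs_climb (hb₂.of_frame hf₃) ?_ ?_ hI₃).mono le_rfl fun s' _ h =>
      ⟨by simpa using h.look, by simpa using h.le, by simpa using h.done⟩
    · rwa [hf₃.arr 5 (by decide)]
    · rw [hf₃.reg 20 (by decide), r20]
  · have h21 : s₃.reg 21 = L.binder i := by
      rcases h₃.done with h | h
      · have h0 : s₃.reg 21 = 0 := by omega
        have := h₃.look
        rw [h0, Layout.look] at this
        rw [h0, this]
      · exact h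
    have hb₃ := hb₂.of_frame hf₃
    refine Runs.of_wp_le (by decide) ?_
    simp only [wp, Store.setArr_arr, Store.setReg_arr, hb₃.c0, h21, add_zero,
      hf₃.reg 8 (by decide), hf₂.reg 8 (by decide), h8, hf₃.arr 8 (by decide),
      hf₂.arr 8 (by decide), if_true]
    intro j hj hji
    by_cases hij : j = i
    · subst hij
      simp
    · simp [hij, hI j hj (by omega)]

/-- Find the node of the unfolding of each node. -/
def headProg : Prog :=
  .for_ 8 0 (block [.load 20 7 8 1, .load 21 0 20 1, .load 22 8 20 1,
    .cond (.eq 21 7)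
      (.cond (.lt 1 22) (block [.dec 22, .load 23 9 22 1, .store 9 8 1 23]) (.store 9 8 1 20))
      (.store 9 8 1 20)])

/-- Going from left to right, the binder at which the search for the head restarts is an earlier
node, whose head is already tabulated. -/
theorem runs_headProg (h : Basic L s) (ht : L.Typed ty)
    (hend : ∀ i < L.n, s.arr 7 i = L.chainEnd i) (hbind : ∀ i < L.n, s.arr 8 i = L.binder i) :
    Runs headProg s ((20 + 2) * L.n + 2) fun s' => ∀ i < L.n, s'.arr 9 i = L.head i := by
  refine (Runs.for_ (I := fun k s => ∀ i < L.n, i < k → s.arr 9 i = L.head i) h.n (by decide)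
    (by decide) (by decide) (by simp) ?_).mono le_rfl fun s' _ h i hi => h i hi hi
  intro i hi s₁ h8 hf₁ hI
  have hb₁ := h.of_frame hf₁
  have hE := ht.chainEnd_spec i hi
  have hB := ht.binder_chainEnd i hi
  refine Runs.of_wp_le (by decide) ?_
  simp only [block, wp, Test.Holds, Store.setReg_reg, Store.setReg_arr, Store.setArr_arr,
    hb₁.c0, hb₁.c6, add_zero, h8, hb₁.tag, hf₁.arr 7 (by decide),
    hf₁.arr 8 (by decide), if_true, if_false, Nat.reduceEqDiff, hend i hi, hbind _ hE.2.1]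
  have key : ∀ v, v = L.head i → ∀ j < L.n, j < i + 1 →
      Function.update (s₁.arr 9) i v j = L.head j := by
    rintro _ rfl j hj hji
    by_cases hij : j = i
    · subst hij
      simp
    · simp [hij, hI j hj (by omega)]
  refine ⟨fun h6 => ⟨fun hb => key _ ?_, fun hb => key _ ?_⟩, fun h6 => key _ ?_⟩
  · have := hB h6
    rw [hI _ (by omega) (by omega)]
    conv_rhs => rw [Layout.head, if_pos ⟨h6, hb, this⟩]
  · rw [Layout.head, if_neg (by tauto)]
  · rw [Layout.head, if_neg (by tauto)]

/-- A loop over all pairs of nodes, with the index of the pair in register `10`. -/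
def forPairs (p : Prog) : Prog :=
  .seq (.const 10 0) (.for_ 8 0 (.for_ 9 0 (.seq p (.inc 10))))

/-- Tabulate multiplication by `n` and the identity, as a substitute for arithmetic. -/
def tableProg : Prog :=
  .seq (forPairs (.seq (.store 12 10 1 10) (.cond (.eq 9 1) (.store 10 8 1 10) .skip)))
    (.copy 11 10)

/-- The running index of the pairs passes `k * n` when the inner counter is `0`. Loading from the
identity table at a sum of two registers yields that sum, so the index of any pair costs two loads.
-/
theorem runs_tableProg (h : Basic L s) :
    Runs tableProg s (((4 + 3) * L.n + 4) * L.n + 3 + 1) fun s' => s'.reg 11 = L.n * L.n ∧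
      (∀ i < L.n, s'.arr 10 i = i * L.n) ∧ ∀ v < L.n * L.n, s'.arr 12 v = v := by
  refine Runs.seq (Runs.for_pairs (c := 4) (n := L.n) (I := fun k s =>
    (∀ i < L.n, i * L.n < k → s.arr 10 i = i * L.n) ∧ ∀ v < k, s.arr 12 v = v)
    h.n (by decide) (by decide) (by decide) (by decide) (by decide) ?_ ?_ ?_) fun s₁ hf₁ h₁ => ?_
  · exact fun _ _ _ _ _ h => h
  · simp
  · rintro k hk l hl s₁ h8 h9 h10 hf₁ ⟨hI1, hI2⟩
    have hb₁ := h.of_frame hf₁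
    refine Runs.of_wp_le (by decide) ?_
    simp only [wp, Test.Holds, Store.setArr_arr, Store.setArr_reg, hb₁.c0, add_zero, h8, h9, h10,
      if_true, if_false, Nat.reduceEqDiff]
    have key : ∀ v < k * L.n + l + 1,
        Function.update (s₁.arr 12) (k * L.n + l) (k * L.n + l) v = v := by
      intro v hv
      by_cases hvk : v = k * L.n + l
      · simp [hvk]
      · simp [hvk, hI2 v (by omega)]
    have inj : ∀ i, i * L.n = k * L.n + l → i = k ∧ 0 = l := fun i =>
      (pair_inj (a := i) (b := 0) (by omega) hl).1
    refine ⟨fun hl0 => ⟨fun i hi hik => ?_, key⟩, fun hl0 => ⟨fun i hi hik => ?_, key⟩⟩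
    · by_cases hik' : i = k
      · subst hik'
        simp [hl0]
      · have : i * L.n ≠ k * L.n + l := fun h => hik' (inj i h).1
        rw [Function.update_of_ne hik', hI1 i hi (by omega)]
    · have : i * L.n ≠ k * L.n + l := fun h => hl0 (inj i h).2.symm
      exact hI1 i hi (by omega)
  · refine Runs.of_wp_le (by decide) ?_
    simp only [wp, Store.setReg_reg, Store.setReg_arr, if_true]
    refine ⟨h₁.1, fun i hi => h₁.2.1 i hi ?_, h₁.2.2⟩
    exact pair_lt (b := 0) hi (by omega)

end SessionTypes

/-! ### Building the graph of pairs -/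

namespace SessionTypes
open Prog SType

variable {L : Layout} {s s' : Store} {ty : ℕ → SType}

/-- The tables that describe the nodes. -/
structure Tables (L : Layout) (s : Store) : Prop extends Basic L s where
  par : ∀ i < L.n, s.arr 5 i = L.par i
  pos : ∀ i < L.n, L.par i ≠ 0 → s.arr 6 i = L.pos i
  head : ∀ i < L.n, s.arr 9 i = L.head i
  base : ∀ i < L.n, s.arr 10 i = i * L.n
  id : ∀ v < L.n * L.n, s.arr 12 v = v

theorem Tables.of_frame {p : Prog} (h : Tables L s) (hf : Frame p s s')
    (hr : ∀ r ∈ p.regs, 8 ≤ r := by decide)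
    (ha : ∀ a ∈ p.arrs, a ∈ [3, 11, 13, 14, 15, 16, 17, 18, 19] := by decide) : Tables L s' where
  toBasic := h.toBasic.of_frame hf hr fun a hm => by
    have := ha a hm
    simp only [List.mem_cons, List.not_mem_nil, or_false] at this
    omega
  par := by rw [hf.arr 5 fun hm => absurd (ha 5 hm) (by decide)]; exact h.par
  pos := by rw [hf.arr 6 fun hm => absurd (ha 6 hm) (by decide)]; exact h.pos
  head := by rw [hf.arr 9 fun hm => absurd (ha 9 hm) (by decide)]; exact h.head
  base := by rw [hf.arr 10 fun hm => absurd (ha 10 hm) (by decide)]; exact h.base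
  id := by rw [hf.arr 12 fun hm => absurd (ha 12 hm) (by decide)]; exact h.id

/-- The non-zero entries of `f` are those at `g c d` for the first `m` pairs `c`, `d`, as far as
these satisfy `P`. -/
def Scattered (n : ℕ) (P : ℕ → ℕ → Prop) (g : ℕ → ℕ → ℕ) (m : ℕ) (f : ℕ → ℕ) : Prop :=
  ∀ v, f v ≠ 0 ↔ ∃ c < n, ∃ d < n, c * n + d < m ∧ P c d ∧ v = g c d

section
variable {n k l : ℕ} {P : ℕ → ℕ → Prop} {g : ℕ → ℕ → ℕ} {f : ℕ → ℕ}

/-- The map `g` need not be injective: all writes put the same value `1`, so overwriting does no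
harm. -/
theorem Scattered.update (h : Scattered n P g (k * n + l) f) (hk : k < n) (hl : l < n)
    (hP : P k l) : Scattered n P g (k * n + l + 1) (Function.update f (g k l) 1) := by
  intro v
  by_cases hv : v = g k l
  · simp only [hv, Function.update_self, ne_eq, one_ne_zero, not_false_eq_true, true_iff]
    exact ⟨k, hk, l, hl, by omega, hP, rfl⟩
  · rw [Function.update_of_ne hv, h v]
    constructor
    · rintro ⟨c, hc, d, hd, hm, hcd, rfl⟩
      exact ⟨c, hc, d, hd, by omega, hcd, rfl⟩
    · rintro ⟨c, hc, d, hd, hm, hcd, rfl⟩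
      refine ⟨c, hc, d, hd, lt_of_le_of_ne (by omega) fun he => ?_, hcd, rfl⟩
      obtain ⟨rfl, rfl⟩ := (pair_inj hd hl).1 he
      exact hv rfl

theorem Scattered.skip (h : Scattered n P g (k * n + l) f) (hl : l < n)
    (hP : ¬ P k l) : Scattered n P g (k * n + l + 1) f := by
  intro v
  rw [h v]
  constructor
  · rintro ⟨c, hc, d, hd, hm, hcd, rfl⟩
    exact ⟨c, hc, d, hd, by omega, hcd, rfl⟩
  · rintro ⟨c, hc, d, hd, hm, hcd, rfl⟩
    refine ⟨c, hc, d, hd, lt_of_le_of_ne (by omega) fun he => ?_, hcd, rfl⟩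
    obtain ⟨rfl, rfl⟩ := (pair_inj hd hl).1 he
    exact hP hcd

theorem Scattered.iff (h : Scattered n P g (n * n) f) (v : ℕ) :
    f v ≠ 0 ↔ ∃ c < n, ∃ d < n, P c d ∧ v = g c d := by
  rw [h v]
  constructor
  · rintro ⟨c, hc, d, hd, -, hcd, hv⟩
    exact ⟨c, hc, d, hd, hcd, hv⟩
  · rintro ⟨c, hc, d, hd, hcd, hv⟩
    exact ⟨c, hc, d, hd, pair_lt hc hd, hcd, hv⟩

end

theorem runs_scatter {p : Prog} {a c : ℕ} {P : ℕ → ℕ → Prop} {g : ℕ → ℕ → ℕ} (h : Tables L s)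
    (h0 : ∀ i, s.arr a i = 0) (hr : ∀ r ∈ p.regs, 11 ≤ r)
    (hs : ∀ k < L.n, ∀ l < L.n, ∀ s', s'.reg 8 = k → s'.reg 9 = l → s'.reg 10 = k * L.n + l →
      Frame (forPairs p) s s' → Scattered L.n P g (k * L.n + l) (s'.arr a) →
      Runs p s' c fun s'' => Scattered L.n P g (k * L.n + l + 1) (s''.arr a)) :
    Runs (forPairs p) s ((((c + 3) * L.n + 4) * L.n) + 3)
      fun s' => ∀ v, s'.arr a v ≠ 0 ↔ ∃ c < L.n, ∃ d < L.n, P c d ∧ v = g c d := by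
  have hr' : ∀ r < 11, r ∉ p.regs := fun r hr11 hm => absurd (hr r hm) (by omega)
  refine (Runs.for_pairs (I := fun m s => Scattered L.n P g m (s.arr a)) h.n (hr' 8 (by omega))
    (hr' 9 (by omega)) (hr' 10 (by omega)) (hr' 0 (by omega)) (by decide) ?_ ?_ hs).mono le_rfl
    fun s' _ h => h.2.iff
  · exact fun _ _ _ _ _ h => h
  · simp [Scattered, h0]

/-- Compute an entry for each pair in register `r` by `p`, and store it in array `a`. -/
def fillPairs (a r : ℕ) (p : Prog) : Prog := forPairs (.seq p (.store a 10 1 r))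

theorem runs_fillPairs {p : Prog} {a r c : ℕ} {G : ℕ → ℕ → Prop} (h : Tables L s)
    (hr : ∀ r ∈ p.regs, 11 ≤ r) (ha : a ∉ p.arrs)
    (hs : ∀ k < L.n, ∀ l < L.n, ∀ s', s'.reg 8 = k → s'.reg 9 = l → s'.reg 10 = k * L.n + l →
      Frame (fillPairs a r p) s s' →
      Runs p s' c fun s'' => G (k * L.n + l) (s''.reg r)) :
    Runs (fillPairs a r p) s ((((c + 1 + 3) * L.n + 4) * L.n) + 3)
      fun s' => ∀ v < L.n * L.n, G v (s'.arr a v) := by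
  have hr' : ∀ r < 11, r ∉ p.regs := fun r hr11 hm => absurd (hr r hm) (by omega)
  refine (Runs.for_pairs (I := fun m s => ∀ v < m, G v (s.arr a v)) h.n (by simp [regs, hr'])
    (by simp [regs, hr']) (by simp [regs, hr']) (by simp [regs, hr']) (by decide) ?_ (by simp)
    ?_).mono le_rfl fun s' _ h => h.2
  · exact fun _ _ _ _ _ h => h
  · intro k hk l hl s₁ h8 h9 h10 hf₁ hI
    refine (hs k hk l hl s₁ h8 h9 h10 hf₁).seq fun s₂ hf₂ h₂ => Runs.of_wp_le le_rfl ?_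
    have h1 : s₂.reg 1 = 0 := by
      rw [hf₂.reg 1 (hr' 1 (by omega)),
        hf₁.reg 1 (by simp [Prog.for_, regs, hr' 1 (by omega)]), h.c0]
    simp only [wp, Store.setArr_arr, if_true, h1, add_zero, hf₂.reg 10 (hr' 10 (by omega)), h10]
    intro v hv
    by_cases hvk : v = k * L.n + l
    · rw [hvk, Function.update_self]
      exact h₂
    · rw [Function.update_of_ne hvk, hf₂.arr a ha]
      exact hI v (by omega)

/-- Mark the node `c` and the parent of `d` in array `11`, if `c` and `d` are components with the
same label. -/
def labMatchBody : Prog :=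
  block [.load 20 5 8 1, .load 21 5 9 1,
    .cond (.eq 20 1) .skip <| .cond (.eq 21 1) .skip <|
    block [.dec 20, .dec 21, .load 22 0 20 1, .load 23 0 21 1, .load 24 2 8 1, .load 25 2 9 1,
      .load 26 10 8 1,
      .cond (.eq 22 23) (.cond (.eq 24 25) (.cond (.eq 22 4) (.store 11 26 21 2)
        (.cond (.eq 22 5) (.store 11 26 21 2) .skip)) .skip) .skip]]

/-- Recording the parent of `d` instead of `d` itself lets one lookup decide later whether a node
has a component with the label of `c`. -/
theorem runs_labMatch (h : Tables L s) (h0 : ∀ i, s.arr 11 i = 0) :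
    Runs (forPairs labMatchBody) s ((((30 + 3) * L.n + 4) * L.n) + 3)
      fun s' => ∀ v, s'.arr 11 v ≠ 0 ↔
        ∃ c < L.n, ∃ d < L.n, L.LabMatch c d ∧ v = c * L.n + (L.par d - 1) := by
  refine runs_scatter h h0 (by decide) fun k hk l hl s₁ h8 h9 h10 hf₁ hI => ?_
  have h₁ := h.of_frame hf₁
  refine Runs.of_wp_le (by decide) ?_
  have yes := fun hP => hI.update hk hl hP
  have no := hI.skip hl
  simp only [labMatchBody, block, wp, Test.Holds, Store.setReg_reg, Store.setReg_arr,
    Store.setArr_arr, h₁.c0, h₁.c1, h₁.c3, h₁.c4, h8, h9, h₁.tag, h₁.lab, h₁.par k hk, h₁.par l hl,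
    h₁.base k hk, add_zero, if_true, if_false, Nat.reduceEqDiff]
  refine ⟨fun h1 => no ?_, fun h1 => ⟨fun h2 => no ?_, fun h2 => ⟨fun h3 => ⟨fun h4 =>
    ⟨fun h5 => yes ?_, fun h5 => ⟨fun h6 => yes ?_, fun h6 => no ?_⟩⟩, fun h4 => no ?_⟩,
    fun h3 => no ?_⟩⟩⟩ <;> simp only [Layout.LabMatch] <;> tauto

/-- Mark the pairs that are not in the subtyping relation because of a missing label, in
array `13`. -/
def missingBody : Prog :=
  block [.load 20 5 8 1, .load 24 11 10 1, .load 23 0 9 1, .load 26 10 9 1,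
    .cond (.eq 20 1) .skip <| block [.dec 20, .load 22 0 20 1, .load 25 10 20 1,
      .cond (.eq 22 23) (.cond (.eq 24 1) (.cond (.eq 23 5) (.store 13 25 9 2)
        (.cond (.eq 23 4) (.store 13 26 20 2) .skip)) .skip) .skip]]

theorem runs_missing (h : Tables L s) (h0 : ∀ i, s.arr 13 i = 0)
    (hM : ∀ v, s.arr 11 v ≠ 0 ↔
        ∃ c < L.n, ∃ d < L.n, L.LabMatch c d ∧ v = c * L.n + (L.par d - 1)) :
    Runs (forPairs missingBody) s ((((30 + 3) * L.n + 4) * L.n) + 3)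
      fun s' => ∀ v, s'.arr 13 v ≠ 0 ↔
        ∃ c < L.n, ∃ q < L.n, L.Missing c q ∧ v = L.target c q := by
  refine runs_scatter h h0 (by decide) fun k hk l hl s₁ h8 h9 h10 hf₁ hI => ?_
  have h₁ := h.of_frame hf₁
  -- An unmarked pair means that no component of `l` matches `k`; this is the last condition of
  -- `Missing`.
  have key : s₁.arr 11 (k * L.n + l) = 0 ↔ ¬ ∃ d < L.n, L.LabMatch k d ∧ L.par d = l + 1 := by
    rw [hf₁.arr 11 (by decide), ← not_iff_not, not_not]
    refine (hM _).trans ?_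
    constructor
    · rintro ⟨c, hc, d, hd, hcd, he⟩
      obtain ⟨p1, p2⟩ := L.par_sub_one_lt hd hcd.2.1
      obtain ⟨rfl, rfl⟩ := (pair_inj hl p1).1 he
      exact ⟨d, hd, hcd, p2⟩
    · rintro ⟨d, hd, hcd, he⟩
      exact ⟨k, hk, d, hd, hcd, by rw [he]; rfl⟩
  refine Runs.of_wp_le (by decide) ?_
  have yes := fun hP => hI.update hk hl hP
  have no := hI.skip hl
  simp only [missingBody, block, wp, Test.Holds, Store.setReg_reg, Store.setReg_arr,
    Store.setArr_arr, h₁.c0, h₁.c1, h₁.c3, h₁.c4, h8, h9, h10, h₁.tag, h₁.par k hk, 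
    h₁.base l hl, add_zero, if_true, if_false, Nat.reduceEqDiff, key]
  have hb : ¬ L.par k = 0 → s₁.arr 10 (L.par k - 1) = (L.par k - 1) * L.n := fun h1 =>
    h₁.base _ (L.par_sub_one_lt hk h1).1
  refine ⟨fun h1 => no ?_, fun h1 => ⟨fun h2 => ⟨fun h3 => ⟨fun h4 => ?_, fun h4 =>
    ⟨fun h5 => ?_, fun h5 => no ?_⟩⟩, fun h3 => no ?_⟩, fun h2 => no ?_⟩⟩
  · exact fun h => h.1 h1
  · have := yes ⟨h1, h2, .inr h4, h3⟩
    rwa [Layout.target, if_pos h4, ← hb h1] at this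
  · have := yes ⟨h1, h2, .inl h5, h3⟩
    rwa [Layout.target, if_neg h4] at this
  · exact fun h => by have := h.2.2.1; tauto
  · exact fun h => h3 h.2.2.2
  · exact fun h => h2 h.2.1

/-- The pair of unfoldings, to register `23`. -/
def srcBody : Prog :=
  block [.load 20 9 8 1, .load 21 9 9 1, .load 22 10 20 1, .load 23 12 22 21]

theorem runs_srcBody (h : Tables L s) (ht : L.Typed ty) {k l : ℕ} (hk : k < L.n) (hl : l < L.n)
    (h8 : s.reg 8 = k) (h9 : s.reg 9 = l) :
    Runs srcBody s 4 fun s' => s'.reg 23 = L.head k * L.n + L.head l := by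
  have hk' := (ht.head_spec k hk).1
  have hl' := (ht.head_spec l hl).1
  refine Runs.of_wp_le (by decide) ?_
  simp only [srcBody, block, wp, Store.setReg_reg, Store.setReg_arr, h.c0, h8, h9, add_zero,
    h.head k hk, h.head l hl, h.base _ hk', h.id _ (pair_lt hk' hl'), if_true, if_false,
    Nat.reduceEqDiff]

theorem runs_src (h : Tables L s) (ht : L.Typed ty) :
    Runs (fillPairs 14 23 srcBody) s ((((4 + 1 + 3) * L.n + 4) * L.n) + 3)
      fun s' => ∀ v < L.n * L.n, s'.arr 14 v = L.edgeSrc v := by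
  refine runs_fillPairs (G := fun v x => x = L.edgeSrc v) h (by decide) (by decide)
    fun k hk l hl s₁ h8 h9 h10 hf₁ => ?_
  rw [Layout.edgeSrc, (pair_div hl).1, (pair_div hl).2]
  exact runs_srcBody (h.of_frame hf₁) ht hk hl h8 h9

/-- The pair that depends on a pair, to register `23`. -/
def dstBody : Prog :=
  .seq srcBody <| block [.load 24 5 8 1, .load 25 5 9 1,
    .cond (.eq 24 1) .skip <| .cond (.eq 25 1) .skip <| .seq
    (block [.dec 24, .dec 25, .load 26 0 24 1, .load 27 0 25 1, .load 28 1 24 1, .load 29 1 25 1,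
      .load 30 6 8 1, .load 31 6 9 1, .load 32 2 8 1, .load 33 2 9 1, .load 34 10 24 1,
      .load 35 10 25 1, .load 34 12 34 25, .load 35 12 35 24]) <|
    .cond (.eq 26 27) (.cond (.eq 26 2)
        (.cond (.eq 28 29) (.cond (.eq 30 31) (.copy 23 34) .skip) .skip)
      (.cond (.eq 26 3) (.cond (.eq 28 29) (.cond (.eq 30 31)
        (.cond (.eq 30 28) (.copy 23 34) (.copy 23 35)) .skip) .skip)
      (.cond (.eq 26 4) (.cond (.eq 32 33) (.copy 23 34) .skip)
      (.cond (.eq 26 5) (.cond (.eq 32 33) (.copy 23 34) .skip) .skip)))) .skip]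

/-- Register `23` still holds the pair of heads from `srcBody`, so each branch that does nothing
yields the loop that `parPair` prescribes for unmatched pairs. -/
theorem runs_dstBody (h : Tables L s) (ht : L.Typed ty) {k l : ℕ} (hk : k < L.n) (hl : l < L.n)
    (h8 : s.reg 8 = k) (h9 : s.reg 9 = l) :
    Runs dstBody s 60 fun s' => s'.reg 23 = L.parPair k l := by
  refine Runs.seq (B := 4) (B' := 56) (runs_srcBody h ht hk hl h8 h9) fun s₁ hf₁ h23 => ?_
  have h₁ := h.of_frame hf₁
  have h8 : s₁.reg 8 = k := by rw [hf₁.reg 8 (by decide), h8]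
  have h9 : s₁.reg 9 = l := by rw [hf₁.reg 9 (by decide), h9]
  refine Runs.of_wp_le (by decide) ?_
  simp only [block, wp, Test.Holds, Store.setReg_reg, Store.setReg_arr, h₁.c0, h₁.c1, h₁.c2,
    h₁.c3, h₁.c4, h8, h9, h23, add_zero, h₁.tag, h₁.arg, h₁.lab, h₁.par k hk, h₁.par l hl,
    if_true, if_false, Nat.reduceEqDiff]
  refine ⟨fun h1 => ?_, fun h1 => ⟨fun h2 => ?_, fun h2 => ?_⟩⟩
  · rw [Layout.parPair, if_neg]
    rintro (h | h) <;> exact h.1 h1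
  · rw [Layout.parPair, if_neg]
    rintro (h | h) <;> exact h.2.1 h2
  obtain ⟨p1, -⟩ := L.par_sub_one_lt hk h1
  obtain ⟨q1, -⟩ := L.par_sub_one_lt hl h2
  rw [h₁.pos k hk h1, h₁.pos l hl h2, h₁.base _ p1, h₁.base _ q1, h₁.id _ (pair_lt p1 q1), h₁.id _ (pair_lt q1 p1)]
  simp only [Layout.parPair, Layout.PosMatch, Layout.LabMatch, Layout.Contra]
  refine ⟨fun h3 => ⟨fun h4 => ⟨fun h5 => ⟨fun h6 => ?_, fun h6 => ?_⟩, fun h5 => ?_⟩, fun h4 =>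
    ⟨fun h5 => ⟨fun h6 => ⟨fun h7 => ⟨fun h8 => ?_, fun h8 => ?_⟩, fun h7 => ?_⟩, fun h6 => ?_⟩,
    fun h5 => ⟨fun h6 => ⟨fun h7 => ?_, fun h7 => ?_⟩, fun h6 => ⟨fun h7 => ⟨fun h8 => ?_,
    fun h8 => ?_⟩, fun h7 => ?_⟩⟩⟩⟩, fun h3 => ?_⟩ <;> split_ifs <;> grind

/-- Whether a pair is not in the subtyping relation for an immediate reason, to register `23`. -/
def badBody : Prog :=
  block [.load 20 0 8 1, .load 21 0 9 1, .load 24 1 8 1, .load 25 1 9 1, .load 26 13 10 1,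
    .const 23 1,
    .cond (.eq 26 1) (.cond (.eq 20 7) (.const 23 0) (.cond (.eq 20 21)
      (.cond (.eq 20 2) (.cond (.eq 24 25) (.const 23 0) .skip)
        (.cond (.eq 20 3) (.cond (.eq 24 25) (.const 23 0) .skip) (.const 23 0))) .skip)) .skip]

theorem runs_bad (h : Tables L s) (hB : ∀ v, s.arr 13 v ≠ 0 ↔
        ∃ c < L.n, ∃ q < L.n, L.Missing c q ∧ v = L.target c q) :
    Runs (fillPairs 16 23 badBody) s ((((30 + 1 + 3) * L.n + 4) * L.n) + 3)
      fun s' => ∀ v < L.n * L.n, s'.arr 16 v ≠ 0 ↔ L.Bad v := by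
  refine runs_fillPairs (G := fun v x => x ≠ 0 ↔ L.Bad v) h (by decide) (by decide)
    fun k hk l hl s₁ h8 h9 h10 hf₁ => ?_
  have h₁ := h.of_frame hf₁
  rw [Layout.Bad, (pair_div hl).1, (pair_div hl).2, ← hB, ← hf₁.arr 13 (by decide), Layout.Clash]
  refine Runs.of_wp_le (by decide) ?_
  simp only [badBody, block, wp, Test.Holds, Store.setReg_reg, Store.setReg_arr, h₁.c0, h₁.c1,
    h₁.c2, h₁.c6, h8, h9, h10, add_zero, h₁.tag, h₁.arg, if_true, if_false, Nat.reduceEqDiff]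
  generalize s₁.arr 13 (k * L.n + l) = x
  generalize L.tag k = t
  generalize L.tag l = t'
  generalize L.arg k = a
  generalize L.arg l = a'
  refine ⟨fun h1 => ⟨fun h2 => ?_, fun h2 => ⟨fun h3 => ⟨fun h4 => ⟨fun h5 => ?_, fun h5 => ?_⟩,
    fun h4 => ⟨fun h5 => ⟨fun h6 => ?_, fun h6 => ?_⟩, fun h5 => ?_⟩⟩, fun h3 => ?_⟩⟩,
    fun h1 => ?_⟩ <;> (simp_all; try omega)

end SessionTypes

namespace SessionTypes
open Prog

variable {L : Layout} {s s' : Store} {K : ℕ} {src dst : ℕ → ℕ} {F : ℕ → Prop}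

/-! ### Reachability in linear time -/

/-- The last edge before `e` with source `v` (plus one), or `0` if there is none. -/
def lastEdge (src : ℕ → ℕ) : ℕ → ℕ → ℕ
  | 0, _ => 0
  | e + 1, v => if src e = v then e + 1 else lastEdge src e v

theorem lastEdge_le (src : ℕ → ℕ) (e v : ℕ) : lastEdge src e v ≤ e := by
  induction e with
  | zero => exact le_rfl
  | succ e ih => rw [lastEdge]; split_ifs <;> omega

theorem src_lastEdge {e v : ℕ} (h : lastEdge src e v ≠ 0) : src (lastEdge src e v - 1) = v := by
  induction e with
  | zero => exact absurd rfl h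
  | succ e ih =>
    rw [lastEdge] at h ⊢
    split_ifs with hv
    · exact hv
    · rw [if_neg hv] at h
      exact ih h

theorem lt_lastEdge {e e' v : ℕ} (h : e' < e) (hv : src e' = v) : e' < lastEdge src e v := by
  induction e with
  | zero => omega
  | succ e ih =>
    rw [lastEdge]
    split_ifs with hs
    · exact h
    · exact ih (lt_of_le_of_ne (by omega) fun he => hs (he ▸ hv))

/-- Link the edges with the same source. -/
def linkProg : Prog :=
  .for_ 8 11 (block [.load 20 14 8 1, .load 21 17 20 1, .store 18 8 1 21, .copy 22 8, .inc 22,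
    .store 17 20 1 22])

/-- These are adjacency lists: array `17` holds the latest edge of each source and array `18` the
preceding edge with the same source. Edges are shifted by one so that `0` ends a list. -/
theorem runs_linkProg (h1 : s.reg 1 = 0) (hK : s.reg 11 = K) (h0 : ∀ v, s.arr 17 v = 0)
    (hsrc : ∀ e < K, s.arr 14 e = src e) :
    Runs linkProg s ((6 + 2) * K + 2) fun s' =>
      (∀ v, s'.arr 17 v = lastEdge src K v) ∧ ∀ e < K, s'.arr 18 e = lastEdge src e (src e) := by
  refine Runs.for_ (I := fun k s => (∀ v, s.arr 17 v = lastEdge src k v) ∧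
    ∀ e < k, s.arr 18 e = lastEdge src e (src e)) hK (by decide) (by decide) (by decide) ?_ ?_
  · exact ⟨h0, fun e he => by omega⟩
  · rintro k hk s₁ h8 hf₁ ⟨hI1, hI2⟩
    refine Runs.of_wp_le (by decide) ?_
    simp only [block, wp, Store.setReg_reg, Store.setReg_arr, Store.setArr_arr, Store.setArr_reg,
      hf₁.reg 1 (by decide), h1, h8, add_zero, hf₁.arr 14 (by decide), hsrc k hk, if_true, if_false,
      Nat.reduceEqDiff]
    constructor
    · intro v
      rw [lastEdge]
      split_ifs with hv
      · rw [hv, Function.update_self]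
      · rw [Function.update_of_ne (Ne.symm hv), hI1]
    · intro e he
      by_cases hek : e = k
      · rw [hek, Function.update_self, hI1]
      · rw [Function.update_of_ne hek, hI2 e (by omega)]

/-- The first `tail` entries of `q` are the numbers below `K` with `f v ≠ 0`, without repetition. -/
structure IsQueue (K : ℕ) (f q : ℕ → ℕ) (tail : ℕ) : Prop where
  inj : ∀ i < tail, ∀ j < tail, q i = q j → i = j
  mem : ∀ i < tail, q i < K ∧ f (q i) ≠ 0
  surj : ∀ v < K, f v ≠ 0 → ∃ i < tail, q i = v

theorem IsQueue.tail_le {f q : ℕ → ℕ} {tail : ℕ} (h : IsQueue K f q tail) : tail ≤ K := by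
  have := Finset.card_le_card_of_injOn (s := Finset.range tail) (t := Finset.range K) q
    (fun i hi => by simpa using (h.mem i (by simpa using hi)).1)
    (fun i hi j hj hij => h.inj i (by simpa using hi) j (by simpa using hj) hij)
  simpa using this

/-- General enough for both uses: in the initial filling the bound `K` grows while the marks stay,
and in the search a mark is added while the bound stays. -/
theorem IsQueue.snoc {f q f' : ℕ → ℕ} {K' tail v : ℕ} (h : IsQueue K f q tail) (hK : K ≤ K')
    (hf : ∀ w, f w ≠ 0 → f' w ≠ 0) (hv : v < K') (hfv : f' v ≠ 0) (hnew : v < K → f v = 0)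
    (hold : ∀ w < K', f' w ≠ 0 → w ≠ v → w < K ∧ f w ≠ 0) :
    IsQueue K' f' (Function.update q tail v) (tail + 1) := by
  have hq : ∀ i < tail, Function.update q tail v i = q i := fun i hi =>
    Function.update_of_ne (by omega) _ _
  have hqv : ∀ i < tail, q i ≠ v := by
    rintro i hi rfl
    exact (h.mem i hi).2 (hnew (h.mem i hi).1)
  have split : ∀ i < tail + 1, i < tail ∨ i = tail := fun i hi => by omega
  refine ⟨fun i hi j hj => ?_, fun i hi => ?_, fun w hw hfw => ?_⟩
  · rcases split i hi with hi | rfl <;> rcases split j hj with hj | rfl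
    · rw [hq i hi, hq j hj]
      exact h.inj i hi j hj
    · rw [hq i hi, Function.update_self]
      exact fun he => absurd he (hqv i hi)
    · rw [hq j hj, Function.update_self]
      exact fun he => absurd he.symm (hqv j hj)
    · exact fun _ => rfl
  · rcases split i hi with hi | rfl
    · rw [hq i hi]
      exact ⟨(h.mem i hi).1.trans_le hK, hf _ (h.mem i hi).2⟩
    · rw [Function.update_self]
      exact ⟨hv, hfv⟩
  · by_cases hwv : w = v
    · exact ⟨tail, by omega, by simp [hwv]⟩
    · obtain ⟨hw, hfw⟩ := hold w hw hfw hwv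
      obtain ⟨i, hi, hqi⟩ := h.surj w hw hfw
      exact ⟨i, by omega, by rw [hq i hi, hqi]⟩

/-- Queue the marked vertices. -/
def queueProg : Prog :=
  .seq (.const 12 0) (.for_ 8 11 (.seq (.load 20 16 8 1)
    (.cond (.eq 20 1) .skip (.seq (.store 19 12 1 8) (.inc 12)))))

theorem runs_queueProg (h1 : s.reg 1 = 0) (hK : s.reg 11 = K) :
    Runs queueProg s (1 + ((5 + 2) * K + 2)) fun s' =>
      IsQueue K (s.arr 16) (s'.arr 19) (s'.reg 12) := by
  refine Runs.seq (Q := fun s' => s'.reg 12 = 0) (Runs.of_wp (p := .const 12 0) (by simp [wp]))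
    fun s₁ hf₁ h₁ => ?_
  refine (Runs.for_ (I := fun k s' => IsQueue k (s.arr 16) (s'.arr 19) (s'.reg 12))
    ((hf₁.reg 11 (by decide)).trans hK) (by decide) (by decide) (by decide) ?_ ?_).mono le_rfl
    fun s' _ h => h
  · simp only [Store.setReg_reg, Store.setReg_arr, Nat.reduceEqDiff, if_false, h₁]
    exact ⟨fun i hi => by omega, fun i hi => by omega, fun i hi => by omega⟩
  · intro k hk s₂ h8 hf₂ hI
    refine Runs.of_wp_le (by decide) ?_
    simp only [wp, Test.Holds, Store.setReg_reg, Store.setReg_arr, Store.setArr_arr,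
      Store.setArr_reg, hf₂.reg 1 (by decide), hf₁.reg 1 (by decide), h1, h8, add_zero,
      hf₂.arr 16 (by decide), hf₁.arr 16 (by decide), if_true, if_false, Nat.reduceEqDiff]
    refine ⟨fun h0 => ⟨hI.inj, fun i hi => ?_, fun v hv hfv => ?_⟩, fun h0 => ?_⟩
    · exact ⟨(hI.mem i hi).1.trans k.lt_succ_self, (hI.mem i hi).2⟩
    · exact hI.surj v (lt_of_le_of_ne (by omega) fun he => hfv (he ▸ h0)) hfv
    · exact hI.snoc k.le_succ (fun _ h => h) k.lt_succ_self h0 (fun h => absurd h (lt_irrefl k))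
        fun w hw hfw hwk => ⟨by omega, hfw⟩

/-- One step of the search: start with the next vertex in the queue, or follow the next edge of the
current vertex. -/
def searchStep : Prog :=
  .cond (.eq 14 1)
    (.cond (.lt 13 12) (block [.load 20 19 13 1, .load 14 17 20 1, .inc 13]) .skip)
    (block [.dec 14, .load 20 15 14 1, .load 14 18 14 1, .load 21 16 20 1,
      .cond (.eq 21 1) (block [.store 16 20 1 2, .store 19 12 1 20, .inc 12]) .skip])

/-- Mark all reachable vertices. -/
def searchProg : Prog :=
  .seq (.seq (.const 13 0) (.const 14 0)) (.for_ 8 11 (.seq searchStep searchStep))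

open Classical in
/-- The edges that have been followed when the search has started with the first `hd` vertices of
the queue `q`, and all edges below `x` are left for the last one. -/
noncomputable def followed (K : ℕ) (src q : ℕ → ℕ) (hd x : ℕ) : Finset ℕ :=
  (Finset.range K).filter fun e => ∃ j < hd, q j = src e ∧ (j + 1 = hd → x ≤ e)

theorem mem_followed {q : ℕ → ℕ} {hd x e : ℕ} : e ∈ followed K src q hd x ↔
    e < K ∧ ∃ j < hd, q j = src e ∧ (j + 1 = hd → x ≤ e) := by
  simp [followed]

theorem followed_congr {q q' : ℕ → ℕ} {hd x : ℕ} (h : ∀ j < hd, q j = q' j) :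
    followed K src q hd x = followed K src q' hd x := by
  ext e
  simp only [mem_followed]
  refine and_congr_right fun _ => exists_congr fun j => and_congr_right fun hj => ?_
  rw [h j hj]

/-- What the search needs to know about the graph. -/
structure GraphMem (K : ℕ) (src dst : ℕ → ℕ) (s : Store) : Prop where
  c0 : s.reg 1 = 0
  c1 : s.reg 2 = 1
  size : s.reg 11 = K
  dst_eq : ∀ e < K, s.arr 15 e = dst e
  dst_lt : ∀ e < K, dst e < K
  first : ∀ v, s.arr 17 v = lastEdge src K v
  next : ∀ e < K, s.arr 18 e = lastEdge src e (src e)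

theorem GraphMem.of_frame {p : Prog} (h : GraphMem K src dst s) (hf : Frame p s s')
    (hr : ∀ r ∈ p.regs, r ∉ [1, 2, 11] := by decide)
    (ha : ∀ a ∈ p.arrs, a ∉ [15, 17, 18] := by decide) : GraphMem K src dst s' where
  c0 := by rw [hf.reg 1 fun hm => absurd (hr 1 hm) (by decide), h.c0]
  c1 := by rw [hf.reg 2 fun hm => absurd (hr 2 hm) (by decide), h.c1]
  size := by rw [hf.reg 11 fun hm => absurd (hr 11 hm) (by decide), h.size]
  dst_eq := by rw [hf.arr 15 fun hm => absurd (ha 15 hm) (by decide)]; exact h.dst_eq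
  dst_lt := h.dst_lt
  first := by rw [hf.arr 17 fun hm => absurd (ha 17 hm) (by decide)]; exact h.first
  next := by rw [hf.arr 18 fun hm => absurd (ha 18 hm) (by decide)]; exact h.next

/-- The state of the search after `m` steps. -/
structure SearchInv (K : ℕ) (src dst : ℕ → ℕ) (F : ℕ → Prop) (m : ℕ) (f q : ℕ → ℕ)
    (tail hd x : ℕ) : Prop where
  queue : IsQueue K f q tail
  hd_le : hd ≤ tail
  reach : ∀ v < K, f v ≠ 0 → Reach K src dst F v
  init : ∀ v < K, F v → f v ≠ 0
  cur : x ≠ 0 → 0 < hd ∧ x ≤ K ∧ src (x - 1) = q (hd - 1)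
  closed : ∀ e ∈ followed K src q hd x, f (dst e) ≠ 0
  count : x = 0 ∧ hd = tail ∨ m ≤ hd + (followed K src q hd x).card

namespace SearchInv

variable {m tail hd x : ℕ} {f q : ℕ → ℕ}

theorem start (h : SearchInv K src dst F m f q tail hd 0) (hlt : hd < tail) :
    SearchInv K src dst F (m + 1) f q tail (hd + 1) (lastEdge src K (q hd)) := by
  have heq : followed K src q (hd + 1) (lastEdge src K (q hd)) = followed K src q hd 0 := by
    ext e
    simp only [mem_followed]
    refine and_congr_right fun he => ⟨?_, ?_⟩
    · rintro ⟨j, hj, hq, hx⟩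
      -- All edges of the vertex just started lie below its last edge, so it contributes no followed
      -- edge yet; progress comes from `hd` alone.
      have hne : j ≠ hd := by
        rintro rfl
        have := lt_lastEdge he hq.symm
        have := hx rfl
        omega
      exact ⟨j, by omega, hq, by omega⟩
    · rintro ⟨j, hj, hq, -⟩
      exact ⟨j, by omega, hq, by omega⟩
  refine ⟨h.queue, hlt, h.reach, h.init, fun hx => ⟨by omega, lastEdge_le _ _ _, ?_⟩, ?_, .inr ?_⟩
  · exact src_lastEdge hx
  · rw [heq]
    exact h.closed
  · rw [heq]
    have := h.count
    omega

theorem idle (h : SearchInv K src dst F m f q tail hd 0) (hlt : ¬ hd < tail) :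
    SearchInv K src dst F (m + 1) f q tail hd 0 :=
  { h with count := .inl ⟨rfl, le_antisymm h.hd_le (not_lt.1 hlt)⟩ }

/-- Follow the edge `x - 1`. -/
theorem follow (h : SearchInv K src dst F m f q tail hd x) (hx : x ≠ 0) {f' q' : ℕ → ℕ} {tail' : ℕ}
    (hq : ∀ j < tail, q' j = q j) (htail : tail ≤ tail') (hqueue : IsQueue K f' q' tail')
    (hf : ∀ v, f v ≠ 0 → f' v ≠ 0) (hf' : ∀ v, f' v ≠ 0 → f v ≠ 0 ∨ v = dst (x - 1))
    (hdst : f' (dst (x - 1)) ≠ 0) :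
    SearchInv K src dst F (m + 1) f' q' tail' hd (lastEdge src (x - 1) (src (x - 1))) := by
  obtain ⟨hhd, hxK, hsrc⟩ := h.cur hx
  have hle := h.hd_le
  have hqhd : ∀ j < hd, q' j = q j := fun j hj => hq j (by omega)
  have hlast := lastEdge_le src (x - 1) (src (x - 1))
  have heq : followed K src q' hd (lastEdge src (x - 1) (src (x - 1))) =
      insert (x - 1) (followed K src q hd x) := by
    rw [followed_congr hqhd]
    ext e
    simp only [mem_followed, Finset.mem_insert]
    constructor
    · rintro ⟨he, j, hj, hqe, hxe⟩
      by_cases hex : e = x - 1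
      · exact .inl hex
      · refine .inr ⟨he, j, hj, hqe, fun hjh => ?_⟩
        by_contra hlt
        -- Between the preceding edge and `x - 1` there is no other edge of the current vertex, so
        -- exactly one edge becomes followed.
        have hs : src e = src (x - 1) := by
          rw [hsrc, ← hqe]
          congr 1
          omega
        have := lt_lastEdge (e := x - 1) (by omega) hs
        have := hxe hjh
        omega
    · rintro (rfl | ⟨he, j, hj, hqe, hxe⟩)
      · exact ⟨by omega, hd - 1, by omega, hsrc.symm, fun _ => hlast⟩
      · exact ⟨he, j, hj, hqe, fun hjh => by have := hxe hjh; omega⟩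
  -- The queue has no repetitions, so edge `x - 1` can only belong to its last started entry, where
  -- the edges below `x` are still open.
  have hnot : x - 1 ∉ followed K src q hd x := by
    rw [mem_followed]
    rintro ⟨-, j, hj, hqe, hxe⟩
    have := h.queue.inj j (by omega) (hd - 1) (by omega) (hqe.trans hsrc)
    have := hxe (by omega)
    omega
  have hreach : Reach K src dst F (dst (x - 1)) := by
    refine .step (by omega) ?_
    have hm := h.queue.mem (hd - 1) (by omega)
    rw [hsrc]
    exact h.reach _ hm.1 hm.2
  refine ⟨hqueue, by omega, fun v hv hfv => ?_, fun v hv hF => hf v (h.init v hv hF),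
    fun hl => ⟨hhd, by omega, ?_⟩, fun e he => ?_, ?_⟩
  · rcases hf' v hfv with h' | rfl
    exacts [h.reach v hv h', hreach]
  · rw [src_lastEdge hl, hsrc, hqhd _ (by omega)]
  · rw [heq, Finset.mem_insert] at he
    rcases he with rfl | he
    exacts [hdst, hf _ (h.closed e he)]
  · rw [heq, Finset.card_insert_of_notMem hnot]
    have := h.count
    omega

/-- At most `K` vertices are started and at most `K` edges followed, so after `2K` steps the search
is over. The marked set then contains the initial vertices and is closed under all edges. -/
theorem iff_reach (h : SearchInv K src dst F (K + K) f q tail hd x) (hsrc : ∀ e < K, src e < K)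
    {v : ℕ} (hv : v < K) : f v ≠ 0 ↔ Reach K src dst F v := by
  have hcard : (followed K src q hd x).card ≤ K := by
    refine (Finset.card_filter_le _ _).trans ?_
    rw [Finset.card_range]
  have htail := h.queue.tail_le
  have hle := h.hd_le
  have hend : x = 0 ∧ hd = tail := by
    refine h.count.elim id fun hc => ⟨?_, by omega⟩
    -- With the budget used up, all edges have been followed, but a nonzero `x` would leave edge `x
    -- - 1` open.
    by_contra hx
    obtain ⟨h1, h2, h3⟩ := h.cur hx
    have hall : followed K src q hd x = Finset.range K := by
      refine Finset.eq_of_subset_of_card_le (Finset.filter_subset _ _) ?_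
      rw [Finset.card_range]
      omega
    have hmem : x - 1 ∈ followed K src q hd x := by
      rw [hall, Finset.mem_range]
      omega
    obtain ⟨-, j, hj, hqe, hxe⟩ := mem_followed.1 hmem
    have := h.queue.inj j (by omega) (hd - 1) (by omega) (hqe.trans h3)
    have := hxe (by omega)
    omega
  refine ⟨h.reach v hv, fun hr => ?_⟩
  clear hv
  induction hr with
  | init hv hF => exact h.init _ hv hF
  | @step e he _ ih =>
    refine h.closed e (mem_followed.2 ⟨he, ?_⟩)
    obtain ⟨j, hj, hqe⟩ := h.queue.surj _ (hsrc e he) ih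
    exact ⟨j, by omega, hqe, by omega⟩

end SearchInv

theorem runs_searchStep (h : GraphMem K src dst s) {m : ℕ}
    (hI : SearchInv K src dst F m (s.arr 16) (s.arr 19) (s.reg 12) (s.reg 13) (s.reg 14)) :
    Runs searchStep s 20 fun s' =>
      SearchInv K src dst F (m + 1) (s'.arr 16) (s'.arr 19) (s'.reg 12) (s'.reg 13) (s'.reg 14) := by
  refine Runs.of_wp_le (by decide) ?_
  simp only [searchStep, block, wp, Test.Holds, Store.setReg_reg, Store.setReg_arr, Store.setArr_arr,
    Store.setArr_reg, h.c0, h.c1, add_zero, if_true, if_false, Nat.reduceEqDiff, h.first]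
  refine ⟨fun hx => ?_, fun hx => ?_⟩
  · rw [hx] at hI ⊢
    exact ⟨hI.start, hI.idle⟩
  · obtain ⟨h1, h2, h3⟩ := hI.cur hx
    have hlt : s.reg 14 - 1 < K := by omega
    rw [h.dst_eq _ hlt, h.next _ hlt]
    refine ⟨fun h0 => ?_, fun h0 => ?_⟩
    · refine hI.follow hx (fun j hj => Function.update_of_ne (by omega) _ _) (Nat.le_succ _)
        (hI.queue.snoc le_rfl ?_ (h.dst_lt _ hlt) (by simp) (fun _ => h0) ?_) ?_ ?_ (by simp)
      · intro w hw
        by_cases hwd : w = dst (s.reg 14 - 1) <;> simp [hwd, hw]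
      · intro w hw hfw hwd
        rw [Function.update_of_ne hwd] at hfw
        exact ⟨hw, hfw⟩
      · intro w hw
        by_cases hwd : w = dst (s.reg 14 - 1) <;> simp [hwd, hw]
      · intro w hw
        by_cases hwd : w = dst (s.reg 14 - 1)
        · exact .inr hwd
        · rw [Function.update_of_ne hwd] at hw
          exact .inl hw
    · exact hI.follow hx (fun _ _ => rfl) le_rfl hI.queue (fun _ h => h) (fun _ h => .inl h) h0

/-- The loop bound available is `K`, so each round performs two search steps to reach the `2K`
required by `iff_reach`. -/
theorem runs_searchProg (h : GraphMem K src dst s) (hsrc : ∀ e < K, src e < K)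
    (hF : ∀ v < K, s.arr 16 v ≠ 0 ↔ F v) (hq : IsQueue K (s.arr 16) (s.arr 19) (s.reg 12)) :
    Runs searchProg s (2 + ((40 + 2) * K + 2)) fun s' =>
      ∀ v < K, s'.arr 16 v ≠ 0 ↔ Reach K src dst F v := by
  refine Runs.seq (Q := fun s' => s'.reg 13 = 0 ∧ s'.reg 14 = 0)
    (Runs.of_wp_le (by decide) (by simp [wp])) fun s₁ hf₁ h₁ => ?_
  have hg₁ := h.of_frame hf₁
  refine (Runs.for_ (I := fun k s => SearchInv K src dst F (k + k) (s.arr 16) (s.arr 19) (s.reg 12)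
    (s.reg 13) (s.reg 14)) hg₁.size (by decide) (by decide) (by decide) ?_ ?_).mono le_rfl
    fun s' _ h v hv => h.iff_reach hsrc hv
  · simp only [Store.setReg_reg, Store.setReg_arr, h₁, hf₁.arr 16 (by decide),
      hf₁.arr 19 (by decide), hf₁.reg 12 (by decide), if_false, Nat.reduceEqDiff]
    refine ⟨hq, Nat.zero_le _, fun v hv hfv => .init hv ((hF v hv).1 hfv),
      fun v hv => (hF v hv).2, by simp, fun e he => ?_, .inr (Nat.zero_le _)⟩
    obtain ⟨-, j, hj, -⟩ := mem_followed.1 he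
    omega
  · intro k hk s₂ _ hf₂ hI
    have hg₂ := hg₁.of_frame hf₂
    refine Runs.seq (B := 20) (B' := 20) (runs_searchStep hg₂ hI) fun s₃ hf₃ h₃ => ?_
    refine (runs_searchStep (hg₂.of_frame hf₃) h₃).mono le_rfl fun s₄ _ h₄ => ?_
    rwa [show k + 1 + (k + 1) = k + k + 1 + 1 by omega]

/-- Write the result. -/
def outputProg : Prog :=
  .for_ 8 11 (.seq (.load 20 14 8 1) (.seq (.load 21 16 20 1)
    (.cond (.eq 21 1) (.store 3 8 1 2) .skip)))

theorem runs_outputProg (h0 : s.reg 1 = 0) (h1 : s.reg 2 = 1) (hK : s.reg 11 = K)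
    (hout : ∀ i, s.arr 3 i = 0) (hsrc : ∀ e < K, s.arr 14 e = src e) :
    Runs outputProg s ((5 + 2) * K + 2) fun s' =>
      ∀ v < K, s'.arr 3 v = if s.arr 16 (src v) = 0 then 1 else 0 := by
  refine (Runs.for_ (I := fun k s' => (∀ v < k, s'.arr 3 v = if s.arr 16 (src v) = 0 then 1 else 0) ∧
    ∀ v, k ≤ v → s'.arr 3 v = 0) hK (by decide) (by decide) (by decide)
    ⟨fun v hv => by omega, fun v _ => hout v⟩ ?_).mono le_rfl fun s' _ h => h.1
  rintro k hk s₁ h8 hf₁ ⟨hI1, hI2⟩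
  refine Runs.of_wp_le (by decide) ?_
  simp only [wp, Test.Holds, Store.setReg_reg, Store.setReg_arr, Store.setArr_arr,
    hf₁.reg 1 (by decide), hf₁.reg 2 (by decide), h0, h1, h8, add_zero, hf₁.arr 14 (by decide),
    hf₁.arr 16 (by decide), hsrc k hk, if_true, if_false, Nat.reduceEqDiff]
  refine ⟨fun hz => ⟨fun v hv => ?_, fun v hv => ?_⟩, fun hz => ⟨fun v hv => ?_, fun v hv => ?_⟩⟩
  · by_cases hvk : v = k
    · simp [hvk, hz]
    · rw [Function.update_of_ne hvk, hI1 v (by omega)]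
  · rw [Function.update_of_ne (by omega), hI2 v (by omega)]
  · by_cases hvk : v = k
    · rw [hvk, if_neg hz, hI2 k le_rfl]
    · exact hI1 v (by omega)
  · exact hI2 v (by omega)

end SessionTypes

/-! ### Assembling the program and its running time -/

namespace SessionTypes
open Prog SType

variable {L : Layout} {s s' : Store} {ty : ℕ → SType}

theorem runs_dst (h : Tables L s) (ht : L.Typed ty) :
    Runs (fillPairs 15 23 dstBody) s ((((60 + 1 + 3) * L.n + 4) * L.n) + 3)
      fun s' => ∀ v < L.n * L.n, s'.arr 15 v = L.edgeDst v := by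
  refine runs_fillPairs (G := fun v x => x = L.edgeDst v) h (by decide) (by decide)
    fun k hk l hl s₁ h8 h9 h10 hf₁ => ?_
  rw [Layout.edgeDst, (pair_div hl).1, (pair_div hl).2]
  exact runs_dstBody (h.of_frame hf₁) ht hk hl h8 h9

theorem Layout.Typed.edgeSrc_lt (ht : L.Typed ty) {e : ℕ} (he : e < L.n * L.n) :
    L.edgeSrc e < L.n * L.n := by
  have hn : 0 < L.n := Nat.pos_of_ne_zero fun h => by simp [h] at he
  exact pair_lt (ht.head_spec _ (Nat.div_lt_of_lt_mul he)).1 (ht.head_spec _ (Nat.mod_lt _ hn)).1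

theorem Layout.Typed.edgeDst_lt (ht : L.Typed ty) {e : ℕ} (he : e < L.n * L.n) :
    L.edgeDst e < L.n * L.n := by
  have hn : 0 < L.n := Nat.pos_of_ne_zero fun h => by simp [h] at he
  have hc : e / L.n < L.n := Nat.div_lt_of_lt_mul he
  have hd : e % L.n < L.n := Nat.mod_lt _ hn
  have hc' := L.par_le (e / L.n)
  have hd' := L.par_le (e % L.n)
  rw [Layout.edgeDst, Layout.parPair]
  split_ifs
  · exact pair_lt (by omega) (by omega)
  · exact pair_lt (by omega) (by omega)
  · exact pair_lt (ht.head_spec _ hc).1 (ht.head_spec _ hd).1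

/-- Compute the tables that describe the nodes. -/
def nodeProg : Prog :=
  .seq initProg (.seq parseProg (.seq bindProg (.seq headProg tableProg)))

/-- Compute the graph of pairs of nodes. -/
def graphProg : Prog :=
  .seq (forPairs labMatchBody) (.seq (forPairs missingBody) (.seq (fillPairs 14 23 srcBody)
    (.seq (fillPairs 15 23 dstBody) (fillPairs 16 23 badBody))))

/-- Search the graph of pairs of nodes, and write the result. -/
def solveProg : Prog := .seq linkProg (.seq queueProg (.seq searchProg outputProg))

/-- Decide subtyping for all pairs of nodes. -/
def subtypeProg : Prog := .seq nodeProg (.seq graphProg solveProg)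

/-- The input for a layout. -/
structure IsInput (L : Layout) (s : Store) : Prop where
  n : s.reg 0 = L.n
  tag : ∀ i, s.arr 0 i = L.tag i
  arg : ∀ i, s.arr 1 i = L.arg i
  lab : ∀ i, s.arr 2 i = L.lab i
  zero : ∀ a, 3 ≤ a → ∀ i, s.arr a i = 0

theorem runs_nodeProg (h : IsInput L s) (ht : L.Typed ty) (hn : 0 < L.n) :
    Runs nodeProg s (300 * (L.n * L.n)) fun s' => Tables L s' ∧ s'.reg 11 = L.n * L.n := by
  have hnn : L.n ≤ L.n * L.n := Nat.le_mul_self _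
  refine Runs.mono (B := 7 + (_ + (_ + (_ + _)))) (Q := fun s' => Tables L s' ∧ s'.reg 11 = L.n * L.n)
    (Runs.seq (Q := Basic L) (Runs.of_wp_le (by decide) ?_) fun s₁ hf₁ h₁ =>
      (runs_parseProg h₁ ?_).seq fun s₂ hf₂ h₂ =>
      (runs_bindProg (h₁.of_frame hf₂) ?_).seq fun s₃ hf₃ h₃ =>
      (runs_headProg ((h₁.of_frame hf₂).of_frame hf₃) ht ?_ h₃).seq fun s₄ hf₄ h₄ =>
      (runs_tableProg (((h₁.of_frame hf₂).of_frame hf₃).of_frame hf₄)).mono le_rfl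
        fun s₅ hf₅ h₅ => ⟨⟨((((h₁.of_frame hf₂).of_frame hf₃).of_frame hf₄)).of_frame hf₅,
          ?_, ?_, ?_, h₅.2.1, h₅.2.2⟩, h₅.1⟩) ?_ fun _ _ h => h
  · simp only [initProg, block, wp]
    constructor <;> simp [h.n, h.tag, h.arg, h.lab]
  · intro a ha
    rw [hf₁.arr a (by simp [initProg, block, arrs])]
    exact h.zero a ha
  · intro i hi
    rw [h₂.par i hi]
    split_ifs <;> omega
  · rw [hf₃.arr 7 (by decide)]
    exact fun i hi => h₂.chainEnd i hi (Nat.zero_le _)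
  · rw [hf₅.arr 5 (by decide), hf₄.arr 5 (by decide), hf₃.arr 5 (by decide)]
    intro i hi
    rw [h₂.par i hi]
    split_ifs <;> omega
  · rw [hf₅.arr 6 (by decide), hf₄.arr 6 (by decide), hf₃.arr 6 (by decide)]
    exact fun i hi hp => h₂.pos i hi (Nat.pos_of_ne_zero hp)
  · rw [hf₅.arr 9 (by decide)]
    exact h₄
  -- The unspecified bounds are those of the stages; `1 ≤ n ≤ n²` absorbs the linear and constant
  -- terms.
  · nlinarith

/-- The graph of pairs of nodes is in memory. -/
structure IsGraph (L : Layout) (s : Store) : Prop where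
  src : ∀ v < L.n * L.n, s.arr 14 v = L.edgeSrc v
  dst : ∀ v < L.n * L.n, s.arr 15 v = L.edgeDst v
  bad : ∀ v < L.n * L.n, s.arr 16 v ≠ 0 ↔ L.Bad v

theorem runs_graphProg (h : Tables L s) (ht : L.Typed ty) (hn : 0 < L.n)
    (h11 : ∀ i, s.arr 11 i = 0) (h13 : ∀ i, s.arr 13 i = 0) :
    Runs graphProg s (300 * (L.n * L.n)) (IsGraph L) := by
  have hnn : L.n ≤ L.n * L.n := Nat.le_mul_self _
  refine Runs.mono (B := _ + (_ + (_ + (_ + _)))) (Q := IsGraph L)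
    ((runs_labMatch h h11).seq fun s₁ hf₁ h₁ =>
      (runs_missing (h.of_frame hf₁) ?_ h₁).seq fun s₂ hf₂ h₂ =>
      (runs_src ((h.of_frame hf₁).of_frame hf₂) ht).seq fun s₃ hf₃ h₃ =>
      (runs_dst (((h.of_frame hf₁).of_frame hf₂).of_frame hf₃) ht).seq fun s₄ hf₄ h₄ =>
      (runs_bad ((((h.of_frame hf₁).of_frame hf₂).of_frame hf₃).of_frame hf₄) ?_).mono le_rfl
        fun s₅ hf₅ h₅ => ⟨?_, ?_, h₅⟩) ?_ fun _ _ h => h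
  · rwa [hf₁.arr 13 (by decide)]
  · rwa [hf₄.arr 13 (by decide), hf₃.arr 13 (by decide)]
  · rwa [hf₅.arr 14 (by decide), hf₄.arr 14 (by decide)]
  · rwa [hf₅.arr 15 (by decide)]
  · nlinarith

theorem runs_solveProg (h : Tables L s) (ht : L.Typed ty) (hn : 0 < L.n) (hg : IsGraph L s)
    (hK : s.reg 11 = L.n * L.n) (h3 : ∀ i, s.arr 3 i = 0) (h17 : ∀ i, s.arr 17 i = 0) :
    Runs solveProg s (100 * (L.n * L.n)) fun s' => ∀ v < L.n * L.n,
      (L.Fails (L.edgeSrc v) → s'.arr 3 v = 0) ∧ (¬ L.Fails (L.edgeSrc v) → s'.arr 3 v = 1) := by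
  have hnn : L.n ≤ L.n * L.n := Nat.le_mul_self _
  have hsrc : ∀ e < L.n * L.n, L.edgeSrc e < L.n * L.n := fun e he => ht.edgeSrc_lt he
  refine Runs.mono (B := _ + (_ + (_ + _))) (Q := fun s' => ∀ v < L.n * L.n,
      (L.Fails (L.edgeSrc v) → s'.arr 3 v = 0) ∧ (¬ L.Fails (L.edgeSrc v) → s'.arr 3 v = 1))
    ((runs_linkProg h.c0 hK h17 hg.src).seq fun s₁ hf₁ h₁ =>
      (runs_queueProg ((h.of_frame hf₁).c0) ((hf₁.reg 11 (by decide)).trans hK)).seq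
      fun s₂ hf₂ h₂ =>
      (runs_searchProg (K := L.n * L.n) (src := L.edgeSrc) (dst := L.edgeDst) (F := L.Bad)
        ⟨((h.of_frame hf₁).of_frame hf₂).c0, ((h.of_frame hf₁).of_frame hf₂).c1,
          ?_, ?_, fun e he => ht.edgeDst_lt he, ?_, ?_⟩ hsrc ?_ ?_).seq fun s₃ hf₃ h₃ =>
      (runs_outputProg (K := L.n * L.n) (src := L.edgeSrc) ((((h.of_frame hf₁).of_frame hf₂).of_frame hf₃).c0)
        ((((h.of_frame hf₁).of_frame hf₂).of_frame hf₃).c1) ?_ ?_ ?_).mono le_rfl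
        fun s₄ hf₄ h₄ => ?_) ?_ fun _ _ h => h
  · rw [hf₂.reg 11 (by decide), hf₁.reg 11 (by decide), hK]
  · rw [hf₂.arr 15 (by decide), hf₁.arr 15 (by decide)]
    exact hg.dst
  · rw [hf₂.arr 17 (by decide)]
    exact h₁.1
  · rw [hf₂.arr 18 (by decide)]
    exact h₁.2
  · rw [hf₂.arr 16 (by decide), hf₁.arr 16 (by decide)]
    exact hg.bad
  · rwa [hf₂.arr 16 (by decide)]
  · rw [hf₃.reg 11 (by decide), hf₂.reg 11 (by decide), hf₁.reg 11 (by decide), hK]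
  · rwa [hf₃.arr 3 (by decide), hf₂.arr 3 (by decide), hf₁.arr 3 (by decide)]
  · rw [hf₃.arr 14 (by decide), hf₂.arr 14 (by decide), hf₁.arr 14 (by decide)]
    exact hg.src
  · intro v hv
    have := h₃ _ (hsrc v hv)
    rw [h₄ v hv]
    constructor
    · intro hF
      rw [if_neg (this.2 hF)]
    · intro hF
      rw [if_pos (not_not.1 (mt this.1 hF))]
  · nlinarith

theorem runs_subtypeProg (h : IsInput L s) (ht : L.Typed ty) (hn : 0 < L.n) :
    Runs subtypeProg s (700 * (L.n * L.n)) fun s' => ∀ v < L.n * L.n,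
      (L.Fails (L.edgeSrc v) → s'.arr 3 v = 0) ∧ (¬ L.Fails (L.edgeSrc v) → s'.arr 3 v = 1) := by
  refine Runs.mono (B := _ + (_ + _)) ((runs_nodeProg h ht hn).seq fun s₁ hf₁ h₁ =>
    (runs_graphProg h₁.1 ht hn ?_ ?_).seq fun s₂ hf₂ h₂ =>
    runs_solveProg (h₁.1.of_frame hf₂) ht hn h₂ ?_ ?_ ?_) (by omega) fun _ _ h => h
  · rw [hf₁.arr 11 (by decide)]
    exact h.zero 11 (by omega)
  · rw [hf₁.arr 13 (by decide)]
    exact h.zero 13 (by omega)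
  · rw [hf₂.reg 11 (by decide), h₁.2]
  · rw [hf₂.arr 3 (by decide), hf₁.arr 3 (by decide)]
    exact h.zero 3 (by omega)
  · rw [hf₂.arr 17 (by decide), hf₁.arr 17 (by decide)]
    exact h.zero 17 (by omega)

theorem isInput_initStore (T U : SType) : IsInput (layout T U) (initStore (pairCode T U)) := by
  have hget : ∀ i, (pairCode T U)[i]? =
      (allNodes T U)[i]?.map fun x : Place × SType =>
        (⟨x.2.tagOf, x.2.argOf, x.1.lab⟩ : Token) := fun i => by
    rw [pairCode_eq, List.getElem?_map]
  constructor
  · simp [initStore, pairCode_eq, length_allNodes, layout]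
  · intro i
    cases hi : (allNodes T U)[i]? <;> simp [initStore, hget, layout, nodeVal, hi]
  · intro i
    cases hi : (allNodes T U)[i]? <;> simp [initStore, hget, layout, nodeVal, hi]
  · intro i
    cases hi : (allNodes T U)[i]? <;> simp [initStore, hget, layout, nodeVal, hi]
  · intro a ha i
    obtain ⟨b, rfl⟩ := Nat.exists_eq_add_of_le' ha
    simp only [initStore]
    split <;> simp_all

end SessionTypes

open SessionTypes SType in
theorem mainTheorem2 :
    ∃ (P : SessionTypes.Prog) (C : ℕ), ∀ T U : SessionTypes.SType,
      T.IsSessionType → U.IsSessionType →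
        (∀ S : SessionTypes.SType, S ∈ T.Sub U ↔ S ∈ T.pairNodeTypes U) ∧
        ∃ (t : ℕ) (s : SessionTypes.Store),
          SessionTypes.Exec P (SessionTypes.initStore (T.pairCode U)) t s ∧
          t ≤ C * (T.size + U.size) ^ 2 ∧
          ∀ (i j : ℕ) (T' U' : SessionTypes.SType),
            (T.pairNodeTypes U)[i]? = some T' → (T.pairNodeTypes U)[j]? = some U' →
              (T'.SubtypeOf U' → s.arr 3 (i * (T.size + U.size) + j) = 1) ∧
              (¬ T'.SubtypeOf U' → s.arr 3 (i * (T.size + U.size) + j) = 0) := by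
  -- The constant is `300 + 300 + 100`, for the node tables, the graph and the search with output.
  refine ⟨subtypeProg, 700, fun T U hT hU => ⟨mem_sub_iff hT hU, ?_⟩⟩
  have ht := layout_typed hT hU
  obtain ⟨t, s, h1, h2, h3⟩ := runs_subtypeProg (isInput_initStore T U) ht
    (Nat.zero_lt_of_lt (Occ.left (T := T) (U := U)).idx_lt)
  refine ⟨t, s, h1, h2.trans_eq (by rw [sq]; rfl), fun i j T' U' hi hj => ?_⟩
  obtain ⟨hi', rfl⟩ := nodeTy_of_getElem? hi
  obtain ⟨hj', rfl⟩ := nodeTy_of_getElem? hj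
  change i < (layout T U).n at hi'
  change j < (layout T U).n at hj'
  have h3 := h3 (i * (layout T U).n + j) (pair_lt hi' hj')
  rw [ht.subtypeOf_iff hi' hj', not_not]
  -- The output entry of a pair is the answer for the pair of heads, which is what `subtypeOf_iff`
  -- asks for.
  rw [Layout.edgeSrc, (pair_div hj').1, (pair_div hj').2] at h3
  exact h3.symm
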